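/- Let $S^2\subset\mathbb R^3$ be the unit sphere with surface measure, colatitude $\theta$ and longitude $\varphi$, let $(u,v)=\int_{S^2}u\bar v$ and $\|u\|=(u,u)^{1/2}$ be the inner product and norm of the complex space $L^2(S^2)$, and let $L^2_0(S^2)$ be the subspace of functions with zero mean. Let $\Delta$ be the Laplace--Beltrami operator, which is invertible from $L^2_0(S^2)\cap H^2(S^2)$ onto $L^2_0(S^2)$, and let $$Y_n^m=\sqrt{\frac{2n+1}{4\pi}\frac{(n-m)!}{(n+m)!}}\;P_n^m(\cos\theta)e^{im\varphi},\qquad n\ge0,\ |m|\le n,$$ be the spherical harmonics, where $P_n(s)=\frac1{2^nn!}\frac{d^n}{ds^n}(s^2-1)^n$, $P_n^m(s)=(-1)^m(1-s^2)^{m/2}\frac{d^m}{ds^m}P_n(s)$ for $m\ge0$, and $P_n^{-m}=(-1)^{m}\frac{(n-m)!}{(n+m)!}P_n^{m}$ for $m>0$. For $u\in L^2_0(S^2)$ put $u_{=n}=\sum_{m=-n}^n(u,Y_n^m)Y_n^m$ and $u_{\ge N}=\sum_{n\ge N}u_{=n}$. On $L^2_0(S^2)$ let $$A=\Delta+2,\qquad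 \Lambda=-i\,\partial_\varphi\cos\theta\,(I+6\Delta^{-1}),\qquad \mathcal L^{\nu,a}=\nu A-ia\Lambda,$$ where $A$ and $\mathcal L^{\nu,a}$ have the domain $L^2_0(S^2)\cap H^2(S^2)$. There is a constant $C>0$ such that the following holds for all $\nu>0$ and $a\in\mathbb R$. The operator $\mathcal L^{\nu,a}$ generates a strongly continuous semigroup $(e^{t\mathcal L^{\nu,a}})_{t\ge0}$ on $L^2_0(S^2)$. For $\omega_0\in L^2_0(S^2)$ put $$\Omega_0^{\nu,a}=(\omega_0,Y_1^0)Y_1^0+\sum_{m=\pm1}(\omega_0,Y_1^m)\Bigl(Y_1^m+\frac a\nu\frac{im}{2\sqrt5}Y_2^m\Bigr),\qquad \tilde\omega(t)=e^{t\mathcal L^{\nu,a}}\omega_0-\Omega_0^{\nu,a}.$$ Then for all $\omega_0\in L^2_0(S^2)$ and $t\ge0$: 1. $\|\tilde\omega(t)\|\le C\bigl(1+\frac{|a|}\nu\bigr)e^{-4\nu t}\|\omega_0\|$; 2. $\tilde\omega_{=1}(t)=0$; 3. $\|\tilde\omega_{\ge3}(t)\|\le\sqrt2\,e^{-10\nu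 t}\|\omega_{0,\ge3}\|$; 4. $(\tilde\omega(t),Y_2^0)=e^{-4\nu t}(\omega_0,Y_2^0)$; 5. for $|m|=1,2$, $\ |(\tilde\omega(t),Y_2^m)|\le Ce^{-4\nu t}\bigl\{|(\omega_0,Y_2^m)|+\frac{|a|}\nu R_m(\omega_0)\bigr\}$, where $R_{\pm1}(\omega_0)=|(\omega_0,Y_1^{\pm1})|+\|\omega_{0,\ge3}\|$ and $R_{\pm2}(\omega_0)=\|\omega_{0,\ge3}\|$. -/

import Mathlib

noncomputable section

open MeasureTheory Filter Topology
open scoped ContDiff Nat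

namespace SphereFlow

/-- The ambient space `ℝ³` with the Euclidean norm. -/
abbrev E3 : Type := EuclideanSpace ℝ (Fin 3)

/-- The unit sphere `S²` in `ℝ³`. -/
abbrev S2 : Type := Metric.sphere (0 : E3) 1

/-- The surface measure of `S²`; its total mass is `4π`. -/
def surf : Measure S2 := (volume : Measure E3).toSphere

instance : IsFiniteMeasure surf := by unfold surf; infer_instance

/-- The space `L²(S²)` of complex-valued functions. Mathlib's `inner ℂ v u` is `∫ u v̄`. -/
abbrev LTwo : Type := Lp ℂ 2 surf

/-- The space `L²₀(S²)` of functions in `L²(S²)` with zero mean. -/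
def LTwoZero : Submodule ℂ LTwo where
  carrier := {u | ∫ x, u x ∂surf = 0}
  zero_mem' := by
    change ∫ x, (0 : LTwo) x ∂surf = 0
    rw [integral_congr_ae (Lp.coeFn_zero ℂ 2 surf)]
    simp
  add_mem' := by
    intro u v hu hv
    change ∫ x, (u + v) x ∂surf = 0
    have h1 := (Lp.memLp u).integrable one_le_two
    have h2 := (Lp.memLp v).integrable one_le_two
    rw [integral_congr_ae (Lp.coeFn_add u v)]
    have h3 := integral_add h1 h2
    simp only [Pi.add_apply] at h3 ⊢
    rw [h3, show ∫ x, u x ∂surf = 0 from hu, show ∫ x, v x ∂surf = 0 from hv, add_zero]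
  smul_mem' := by
    intro c u hu
    change ∫ x, (c • u) x ∂surf = 0
    rw [integral_congr_ae (Lp.coeFn_smul c u)]
    simp only [Pi.smul_apply]
    rw [integral_smul, show ∫ x, u x ∂surf = 0 from hu, smul_zero]

/-! ### Spherical harmonics -/

/-- The Legendre polynomial `P_n(s) = (2ⁿ n!)⁻¹ (d/ds)ⁿ (s² - 1)ⁿ`. -/
def legendre (n : ℕ) : Polynomial ℝ :=
  Polynomial.C (1 / (2 ^ n * (n ! : ℝ))) *
    Polynomial.derivative^[n] ((Polynomial.X ^ 2 - 1) ^ n)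

/-- The associated Legendre function `P_n^m` for `m ≥ 0`,
`(-1)^m (1 - s²)^{m/2} (d/ds)^m P_n(s)`. -/
def assocLegendreNat (n m : ℕ) (s : ℝ) : ℝ :=
  (-1) ^ m * Real.sqrt (1 - s ^ 2) ^ m * (Polynomial.derivative^[m] (legendre n)).eval s

/-- The associated Legendre function `P_n^m` for `|m| ≤ n`. -/
def assocLegendre (n : ℕ) (m : ℤ) (s : ℝ) : ℝ :=
  if 0 ≤ m then assocLegendreNat n m.natAbs s
  else (-1) ^ m.natAbs * (((n - m.natAbs)! : ℝ) / ((n + m.natAbs)! : ℝ)) *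
    assocLegendreNat n m.natAbs s

/-- The longitude of a point of the sphere, in `(-π, π]` (and `0` at the poles, where the
harmonics with `m ≠ 0` vanish anyway). -/
def longitude (x : S2) : ℝ := Complex.arg ⟨x.1 0, x.1 1⟩

/-- The spherical harmonic
`Y_n^m = ((2n+1)/(4π) · (n-m)!/(n+m)!)^{1/2} P_n^m(cos θ) e^{imφ}`, `|m| ≤ n`, as a function;
`cos θ` is the third coordinate. -/
def sphHarmFun (n : ℕ) (m : ℤ) (x : S2) : ℂ :=
  (Real.sqrt ((2 * n + 1) / (4 * Real.pi) *
      (((((n : ℤ) - m).toNat)! : ℝ) / ((((n : ℤ) + m).toNat)! : ℝ))) : ℝ) *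
    (assocLegendre n m (x.1 2) : ℝ) * Complex.exp (Complex.I * m * (longitude x : ℝ))

theorem continuous_assocLegendre (n : ℕ) (m : ℤ) : Continuous (assocLegendre n m) := by
  have h : Continuous (assocLegendreNat n m.natAbs) := by
    unfold assocLegendreNat
    have := (Polynomial.derivative^[m.natAbs] (legendre n)).continuous
    fun_prop
  unfold assocLegendre
  split_ifs
  · exact h
  · fun_prop

theorem memLp_sphHarmFun (n : ℕ) (m : ℤ) : MemLp (sphHarmFun n m) 2 surf := by
  have hc : Continuous fun x : S2 => assocLegendre n m (x.1 2) :=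
    (continuous_assocLegendre n m).comp (by fun_prop)
  have hl : Measurable longitude := by
    unfold longitude
    refine Complex.measurable_arg.comp ?_
    have : Continuous fun x : S2 => (⟨x.1 0, x.1 1⟩ : ℂ) := by
      have h : (fun x : S2 => (⟨x.1 0, x.1 1⟩ : ℂ)) =
          fun x : S2 => ((x.1 0 : ℝ) : ℂ) + ((x.1 1 : ℝ) : ℂ) * Complex.I := by
        funext x
        exact Complex.mk_eq_add_mul_I _ _
      rw [h]
      fun_prop
    exact this.measurable
  obtain ⟨K, hK⟩ := isCompact_univ.exists_bound_of_continuousOn hc.continuousOn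
  have hmeas : Measurable (sphHarmFun n m) := by
    unfold sphHarmFun
    have := hc.measurable
    fun_prop
  refine MemLp.of_bound hmeas.aestronglyMeasurable
    (‖Real.sqrt ((2 * n + 1) / (4 * Real.pi) *
      (((((n : ℤ) - m).toNat)! : ℝ) / ((((n : ℤ) + m).toNat)! : ℝ)))‖ * K) ?_
  refine Eventually.of_forall fun x => ?_
  have he : ‖Complex.exp (Complex.I * m * (longitude x : ℝ))‖ = 1 := by
    have : Complex.I * m * (longitude x : ℝ) =
        (((m : ℝ) * longitude x : ℝ) : ℂ) * Complex.I := by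
      push_cast
      ring
    rw [this, Complex.norm_exp_ofReal_mul_I]
  unfold sphHarmFun
  rw [norm_mul, norm_mul, he, mul_one, Complex.norm_real, Complex.norm_real]
  exact mul_le_mul_of_nonneg_left (hK x (Set.mem_univ x)) (norm_nonneg _)

/-- The spherical harmonic `Y_n^m` as an element of `L²(S²)`. -/
def sphHarm (n : ℕ) (m : ℤ) : LTwo := (memLp_sphHarmFun n m).toLp

/-- The coefficient `(u, Y_n^m)_{L²(S²)} = ∫ u · conj Y_n^m`. -/
def coeff (u : LTwo) (n : ℕ) (m : ℤ) : ℂ := inner ℂ (sphHarm n m) u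

/-- The part of degree `n`, `u_{=n} = ∑_{m=-n}^n (u, Y_n^m) Y_n^m`. -/
def degPart (n : ℕ) (u : LTwo) : LTwo :=
  ∑ m ∈ Finset.Icc (-(n : ℤ)) n, coeff u n m • sphHarm n m

/-- The part of degree at least `N`, `u_{≥N} = ∑_{n ≥ N} u_{=n}` (an orthogonal series, which
converges in `L²(S²)`). -/
def tailPart (N : ℕ) (u : LTwo) : LTwo := ∑' k : ℕ, degPart (N + k) u

/-! ### Weak derivatives on the sphere and the operators -/

/-- The tangential vector fields `x ↦ e_i × x` that generate the rotations about the three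
coordinate axes. The third one is `∂_φ`. -/
def rotField (i : Fin 3) (x : E3) : E3 :=
  ![!₂[0, -x 2, x 1], !₂[x 2, 0, -x 0], !₂[-x 1, x 0, 0]] i

/-- `v` is the weak derivative of `u` on `S²` along the divergence-free field `e_i × x`. The test
functions are the smooth functions on `S²`, that is, the restrictions of smooth functions on `ℝ³`;
as the field is tangential, only the restriction matters. -/
def IsWeakRotDeriv (i : Fin 3) (u v : S2 → ℂ) : Prop :=
  ∀ ψ : E3 → ℂ, ContDiff ℝ ∞ ψ →
    ∫ x : S2, u x * fderiv ℝ ψ x.1 (rotField i x.1) ∂surf = -∫ x : S2, v x * ψ x.1 ∂surf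

/-- `u` lies in the Sobolev space `H²(S²)` and `Δ u = f`, where `Δ` is the Laplace-Beltrami
operator. At every point of `S²` the three rotation fields span the tangent plane, so `u ∈ H²(S²)`
means that its weak derivatives of order one and two along them are in `L²(S²)`; and `Δ` is the sum
of the squares of these fields. -/
def HasLaplacian (u f : LTwo) : Prop :=
  ∃ (v : Fin 3 → LTwo) (w : Fin 3 → Fin 3 → LTwo),
    (∀ i, IsWeakRotDeriv i u (v i)) ∧ (∀ i j, IsWeakRotDeriv j (v i) (w i j)) ∧
    f = ∑ i, w i i

/-- The graph of `A = Δ + 2` on `L²₀(S²)`, with domain `L²₀(S²) ∩ H²(S²)`. -/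
def GraphA (u g : LTwoZero) : Prop :=
  ∃ f : LTwo, HasLaplacian u f ∧ (g : LTwo) = f + (2 : ℂ) • (u : LTwo)

/-- The graph of `Λ = -i ∂_φ M_{cos θ} (I + 6 Δ⁻¹)` on `L²₀(S²)`: here `p = Δ⁻¹ u` is the element
of `L²₀(S²) ∩ H²(S²)` with `Δ p = u`. -/
def GraphLambda (u h : LTwoZero) : Prop :=
  ∃ (p : LTwoZero) (v : LTwo), HasLaplacian p u ∧
    IsWeakRotDeriv 2 (fun x => ((x.1 2 : ℝ) : ℂ) * (u.1 x + 6 * p.1 x)) v ∧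
    (h : LTwo) = -Complex.I • v

/-- The graph of `𝓛^{ν,a} = ν A - i a Λ` on `L²₀(S²)`. -/
def GraphL (ν a : ℝ) (u f : LTwoZero) : Prop :=
  ∃ g h : LTwoZero, GraphA u g ∧ GraphLambda u h ∧
    f = (ν : ℂ) • g - (Complex.I * a) • h

/-- `(T t)_{t ≥ 0}` is a strongly continuous semigroup of bounded operators whose infinitesimal
generator, `x ↦ lim_{t → 0+} (T t x - x) / t` where this limit exists, is the operator with graph
`G`. Such a semigroup is the semigroup `e^{tG}`. -/
structure IsSemigroupGeneratedBy {X : Type*} [NormedAddCommGroup X] [NormedSpace ℂ X]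
    (T : ℝ → X →L[ℂ] X) (G : X → X → Prop) : Prop where
  map_zero : T 0 = 1
  map_add : ∀ s t : ℝ, 0 ≤ s → 0 ≤ t → T (s + t) = T s * T t
  tendsto_zero : ∀ x : X, Tendsto (fun t : ℝ => T t x) (𝓝[>] 0) (𝓝 x)
  generator : ∀ x y : X,
    G x y ↔ Tendsto (fun t : ℝ => ((t : ℂ)⁻¹) • (T t x - x)) (𝓝[>] 0) (𝓝 y)

/-- The equilibrium
`Ω₀^{ν,a} = (ω₀,Y_1^0) Y_1^0 + ∑_{m=±1} (ω₀,Y_1^m) (Y_1^m + (a/ν) (im/(2√5)) Y_2^m)`. -/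
def equilibrium (ν a : ℝ) (ω₀ : LTwo) : LTwo :=
  coeff ω₀ 1 0 • sphHarm 1 0 +
    ∑ m ∈ ({1, -1} : Finset ℤ), coeff ω₀ 1 m •
      (sphHarm 1 m + (((a / ν : ℝ) : ℂ) * (Complex.I * m / (2 * (Real.sqrt 5 : ℝ)))) •
        sphHarm 2 m)

/-- `R_{±1}(ω₀) = |(ω₀,Y_1^{±1})| + ‖ω₀,≥3‖` and `R_{±2}(ω₀) = ‖ω₀,≥3‖`. -/
def remainder (m : ℤ) (ω₀ : LTwo) : ℝ :=
  if |m| = 1 then ‖coeff ω₀ 1 m‖ + ‖tailPart 3 ω₀‖ else ‖tailPart 3 ω₀‖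

end SphereFlow

end

open SphereFlow

noncomputable section

open MeasureTheory Filter Topology
open scoped Nat

/-! Everything is read off in the basis of spherical harmonics. There `Δ` is diagonal with
eigenvalues `-n(n+1)`, the longitude derivative multiplies by `im`, and multiplication by `cos θ`
couples degree `n` only to degrees `n ± 1` at the same order `m` (`mul_solid`). The factor `I +
6Δ⁻¹` has the eigenvalue `gap n = 1 - 6/(n(n+1))`, which is `-2` for `n = 1`, vanishes for `n = 2`
and lies in `[1/2, 1]` for `n ≥ 3`. The zero at `n = 2` makes the system triangular, because degree
two acts on no other degree.

The estimates follow from this. Degree one is conserved: `A` vanishes there and its neighbours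
contribute nothing (`coeff_one_semigroup`). The degrees `≥ 3` evolve on their own. In the inner
product weighted by `gap`, which is comparable to the usual one with the constants `1/2` and `1`,
transport is skew (`im_inner_gapOp`) and the viscous term damps at rate at least `3·4 - 2 = 10`
times `ν`; this gives `exp(-10νt)` with the factor `√2` (`norm_tailPart_semigroup_le`). Each
coefficient of degree two solves a scalar equation with damping `4ν`, a constant force from degree
one and a force from degree three that decays like `exp(-10νt)`. The constant force is balanced
exactly by the equilibrium, and Duhamel's formula for the rest costs a factor of order `|a|/ν`
(`coeff_two_semigroup`). These bounds use only the defining properties of a semigroup generated by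
the graph, so uniqueness of the semigroup is not needed. They are shown on the domain and extended
by density.

For existence, transport is not skew in the plain norm, and `gap` is not positive in low degrees.
With a weight equal to `1` in degrees `≤ 2` and to `gap` above, the non-skew part involves finitely
many degrees and is bounded (`re_inner_weight_le`), so a shift of the operator is dissipative. Its
resolvents come from a Neumann series around `νA` (`exists_resolvent`), and the Hille–Yosida theorem
applies (`exists_semigroup_graphL`).

What links this to the operators defined by weak derivatives is `graphL_iff`. It rests on three
facts: the ladder relations for the rotation fields on the harmonics, orthonormality deduced from
these relations, and completeness by Stone–Weierstrass. They make the weak derivatives, `H²` and `Δ`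
conditions on coefficients (`coeff_of_isWeakRotDeriv`, `isWeakRotDeriv_of_coeff`,
`hasLaplacian_iff`). -/

namespace SphereFlow

/-! ### Contraction semigroups: Yosida approximation and the Hille–Yosida theorem -/

section HilleYosida

variable {X : Type*} [NormedAddCommGroup X] [NormedSpace ℂ X]

/-- The uniformly continuous group `e^{tA}` of a bounded operator. -/
def expGroup (A : X →L[ℂ] X) (t : ℝ) : X →L[ℂ] X := NormedSpace.exp ((t : ℂ) • A)

theorem expGroup_zero (A : X →L[ℂ] X) : expGroup A 0 = 1 := by
  simp [expGroup]

theorem commute_expGroup {A B : X →L[ℂ] X} (h : Commute A B) (t : ℝ) :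
    Commute A (expGroup B t) :=
  (h.smul_right _).exp_right

theorem hasDerivAt_expGroup [CompleteSpace X] (A : X →L[ℂ] X) (t : ℝ) :
    HasDerivAt (expGroup A) (expGroup A t * A) t :=
  (hasDerivAt_exp_smul_const (𝕂 := ℂ) A (t : ℂ)).scomp t Complex.ofRealCLM.hasDerivAt
    |>.congr_deriv (by simp [expGroup])

theorem hasDerivAt_expGroup_apply [CompleteSpace X] (A : X →L[ℂ] X) (t : ℝ) (x : X) :
    HasDerivAt (fun s => expGroup A s x) (expGroup A t (A x)) t := by
  have h := ((ContinuousLinearMap.apply ℂ X x).restrictScalars ℝ).hasFDerivAt.comp_hasDerivAt t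
    (hasDerivAt_expGroup A t)
  exact h

theorem expGroup_add [CompleteSpace X] (A : X →L[ℂ] X) (s t : ℝ) :
    expGroup A (s + t) = expGroup A s * expGroup A t := by
  let : NormedAlgebra ℚ (X →L[ℂ] X) := NormedAlgebra.restrictScalars ℚ ℂ _
  unfold expGroup
  rw [← NormedSpace.exp_add_of_commute]
  · push_cast
    rw [add_smul]
  · exact ((Commute.refl A).smul_left _).smul_right _

/-- The curve `exp(ct) exp(tA) x` solves `g' = (A + c) g`, so Grönwall bounds it by `exp(ct) ‖x‖`,
and the factor `exp(ct)` cancels. A Yosida approximation has exactly this form, with `c` its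
resolvent point. -/
theorem norm_expGroup_apply_le [CompleteSpace X] {A : X →L[ℂ] X} {c : ℝ}
    (h : ‖A + (c : ℂ) • (1 : X →L[ℂ] X)‖ ≤ c) {t : ℝ} (ht : 0 ≤ t) (x : X) :
    ‖expGroup A t x‖ ≤ ‖x‖ := by
  set g : ℝ → X := fun s => ((Real.exp (c * s) : ℝ) : ℂ) • expGroup A s x with hg
  have hderiv : ∀ s, HasDerivAt g ((A + (c : ℂ) • (1 : X →L[ℂ] X)) (g s)) s := by
    intro s
    have h1 : HasDerivAt (fun s : ℝ => ((Real.exp (c * s) : ℝ) : ℂ))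
        ((Real.exp (c * s) * c : ℝ) : ℂ) s := by
      have := ((hasDerivAt_id s).const_mul c).exp.ofReal_comp
      simpa using this
    have h2 := h1.smul (hasDerivAt_expGroup_apply A s x)
    have hc : A (expGroup A s x) = expGroup A s (A x) := by
      have := commute_expGroup (Commute.refl A) s
      exact congrArg (fun B : X →L[ℂ] X => B x) this
    refine HasDerivAt.congr_deriv h2 ?_
    change _ = A (((Real.exp (c * s) : ℝ) : ℂ) • expGroup A s x) +
      (c : ℂ) • (((Real.exp (c * s) : ℝ) : ℂ) • expGroup A s x)
    rw [map_smul, hc, smul_smul, mul_comm (c : ℂ), Complex.ofReal_mul]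
  have hb := norm_le_gronwallBound_of_norm_deriv_right_le (f := g) (δ := ‖x‖) (K := c) (ε := 0)
    (a := 0) (b := t) (fun s _ => (hderiv s).continuousAt.continuousWithinAt)
    (fun s _ => (hderiv s).hasDerivWithinAt) (by simp [hg, expGroup_zero])
    (fun s _ => by
      rw [add_zero]
      exact (ContinuousLinearMap.le_opNorm _ _).trans (by gcongr)) t ⟨ht, le_rfl⟩
  rw [gronwallBound_ε0, sub_zero] at hb
  have : ‖g t‖ = Real.exp (c * t) * ‖expGroup A t x‖ := by
    simp only [hg]
    rw [norm_smul, Complex.norm_real, Real.norm_of_nonneg (Real.exp_pos _).le]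
  rw [this, mul_comm ‖x‖] at hb
  exact le_of_mul_le_mul_left hb (Real.exp_pos _)

/-- Interpolate by `s ↦ exp((t-s)B) exp(sA) x`. By commutation its derivative is two contractions
applied to `A x - B x`. -/
theorem norm_expGroup_sub_le [CompleteSpace X] {A B : X →L[ℂ] X} (hAB : Commute A B)
    (hA : ∀ t, 0 ≤ t → ∀ x, ‖expGroup A t x‖ ≤ ‖x‖)
    (hB : ∀ t, 0 ≤ t → ∀ x, ‖expGroup B t x‖ ≤ ‖x‖) {t : ℝ} (ht : 0 ≤ t) (x : X) :
    ‖expGroup A t x - expGroup B t x‖ ≤ t * ‖A x - B x‖ := by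
  set f : ℝ → X := fun s => (expGroup B (t - s) * expGroup A s) x with hf
  have hderiv : ∀ s, HasDerivAt f (expGroup B (t - s) (expGroup A s (A x - B x))) s := by
    intro s
    have h1 : HasDerivAt (fun s => expGroup B (t - s)) (-(expGroup B (t - s) * B)) s := by
      have := (hasDerivAt_expGroup B (t - s)).scomp s ((hasDerivAt_id s).const_sub t)
      rw [neg_one_smul] at this
      exact this
    have h2 := h1.mul (hasDerivAt_expGroup A s)
    have h3 := ((ContinuousLinearMap.apply ℂ X x).restrictScalars ℝ).hasFDerivAt.comp_hasDerivAt s h2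
    refine HasDerivAt.congr_deriv h3 ?_
    have hc : B (expGroup A s x) = expGroup A s (B x) :=
      congrArg (fun C : X →L[ℂ] X => C x) (commute_expGroup hAB.symm s)
    change -(expGroup B (t - s) (B (expGroup A s x))) + expGroup B (t - s) (expGroup A s (A x)) = _
    rw [hc, map_sub, map_sub]
    abel
  have h := norm_image_sub_le_of_norm_deriv_right_le_segment (f := f) (a := 0) (b := t)
    (C := ‖A x - B x‖)
    (fun s _ => (hderiv s).continuousAt.continuousWithinAt)
    (fun s _ => (hderiv s).hasDerivWithinAt)
    (fun s hs => (hB _ (by linarith [hs.2]) _).trans (hA _ hs.1 _)) t ⟨ht, le_rfl⟩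
  simp only [hf, sub_self, expGroup_zero, sub_zero, one_mul, mul_one] at h
  rwa [mul_comm] at h

/-- A sequence of uniformly bounded operators that converges on a dense set is pointwise Cauchy. -/
theorem cauchySeq_apply_of_dense {E : ℕ → X →L[ℂ] X} (hE : ∀ n x, ‖E n x‖ ≤ ‖x‖) {D : Set X}
    (hD : Dense D) (h : ∀ x ∈ D, CauchySeq fun n => E n x) (x : X) :
    CauchySeq fun n => E n x := by
  rw [Metric.cauchySeq_iff]
  intro ε hε
  obtain ⟨y, hy, hxy⟩ := hD.exists_dist_lt x (show 0 < ε / 3 by positivity)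
  obtain ⟨N, hN⟩ := Metric.cauchySeq_iff.1 (h y hy) (ε / 3) (by positivity)
  refine ⟨N, fun m hm n hn => ?_⟩
  have h1 : ∀ k, dist (E k x) (E k y) < ε / 3 := fun k => by
    rw [dist_eq_norm, ← map_sub]
    exact (hE k _).trans_lt (by rwa [← dist_eq_norm])
  calc dist (E m x) (E n x) ≤ dist (E m x) (E m y) + dist (E m y) (E n y) + dist (E n y) (E n x) :=
        dist_triangle4 _ _ _ _
    _ < ε / 3 + ε / 3 + ε / 3 := by
        have := hN m hm n hn
        have h2 := h1 n
        rw [dist_comm] at h2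
        linarith [h1 m]
    _ = ε := by ring

/-- The data of the Hille–Yosida theorem: `G` is the graph of a densely defined operator whose
resolvents `R lam`, `lam > lam₀`, satisfy `‖R lam‖ ≤ 1 / lam`. -/
structure IsHilleYosida (G : X → X → Prop) (lam₀ : ℝ) (R : ℝ → X →L[ℂ] X) : Prop where
  nonneg : 0 ≤ lam₀
  norm_le : ∀ lam, lam₀ < lam → ‖R lam‖ ≤ 1 / lam
  graph_iff : ∀ lam, lam₀ < lam → ∀ x y, G x y ↔ x = R lam ((lam : ℂ) • x - y)
  dense : Dense {x | ∃ y, G x y}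

namespace IsHilleYosida

variable {G : X → X → Prop} {lam₀ : ℝ} {R : ℝ → X →L[ℂ] X}

theorem graph_resolvent (h : IsHilleYosida G lam₀ R) {lam : ℝ} (hl : lam₀ < lam) (z : X) :
    G (R lam z) ((lam : ℂ) • R lam z - z) := by
  rw [h.graph_iff lam hl, sub_sub_cancel]

theorem resolvent_identity (h : IsHilleYosida G lam₀ R) {lam mu : ℝ} (hl : lam₀ < lam)
    (hm : lam₀ < mu) : R lam - R mu = ((mu : ℂ) - lam) • (R mu * R lam) := by
  ext z
  have h1 := (h.graph_iff mu hm _ _).1 (h.graph_resolvent hl z)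
  have h2 : R lam z = ((mu : ℂ) - lam) • R mu (R lam z) + R mu z := by
    conv_lhs => rw [h1]
    rw [← map_smul (R mu), ← map_add (R mu)]
    congr 1
    rw [sub_smul]
    abel
  change R lam z - R mu z = ((mu : ℂ) - lam) • R mu (R lam z)
  rw [sub_eq_iff_eq_add]
  exact h2

/-- Exchanging the two points in the resolvent identity changes the sign of the left side, and the
scalar factor can be cancelled when the points differ. -/
theorem commute_resolvent (h : IsHilleYosida G lam₀ R) {lam mu : ℝ} (hl : lam₀ < lam)
    (hm : lam₀ < mu) : Commute (R lam) (R mu) := by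
  rcases eq_or_ne lam mu with rfl | hne
  · exact Commute.refl _
  have h1 := h.resolvent_identity hl hm
  have h2 := h.resolvent_identity hm hl
  have hne' : ((mu : ℂ) - lam) ≠ 0 := by
    rw [sub_ne_zero]
    exact_mod_cast hne.symm
  have h3 : ((mu : ℂ) - lam) • (R mu * R lam) = ((mu : ℂ) - lam) • (R lam * R mu) := by
    rw [← h1, ← neg_sub (R mu), h2, ← neg_smul, neg_sub]
  exact ((smul_right_injective _ hne') h3).symm

/-- The points of the resolvent set used in the Yosida approximation. -/
def point (lam₀ : ℝ) (n : ℕ) : ℝ := lam₀ + 1 + n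

theorem lt_point (lam₀ : ℝ) (n : ℕ) : lam₀ < point lam₀ n := by
  unfold point
  have : (0 : ℝ) ≤ n := n.cast_nonneg
  linarith

theorem point_pos (h : IsHilleYosida G lam₀ R) (n : ℕ) : 0 < point lam₀ n :=
  h.nonneg.trans_lt (lt_point lam₀ n)

theorem tendsto_point (lam₀ : ℝ) : Tendsto (point lam₀) atTop atTop :=
  tendsto_atTop_add_const_left _ _ tendsto_natCast_atTop_atTop

/-- The Yosida approximation `lam² R - lam`. -/
def yosida (lam₀ : ℝ) (R : ℝ → X →L[ℂ] X) (n : ℕ) : X →L[ℂ] X :=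
  ((point lam₀ n : ℂ) ^ 2) • R (point lam₀ n) - (point lam₀ n : ℂ) • 1

theorem commute_yosida (h : IsHilleYosida G lam₀ R) (m n : ℕ) :
    Commute (yosida lam₀ R m) (yosida lam₀ R n) := by
  have := h.commute_resolvent (lt_point lam₀ m) (lt_point lam₀ n)
  unfold yosida
  refine Commute.sub_left (Commute.sub_right ?_ ?_) (Commute.sub_right ?_ ?_)
  · exact (this.smul_left _).smul_right _
  · exact ((Commute.one_right _).smul_left _).smul_right _
  · exact ((Commute.one_left _).smul_left _).smul_right _
  · exact ((Commute.one_left _).smul_left _).smul_right _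

theorem norm_exp_yosida_le [CompleteSpace X] (h : IsHilleYosida G lam₀ R) (n : ℕ) {t : ℝ}
    (ht : 0 ≤ t) (x : X) : ‖expGroup (yosida lam₀ R n) t x‖ ≤ ‖x‖ := by
  refine norm_expGroup_apply_le (c := point lam₀ n) ?_ ht x
  have hp := h.point_pos n
  rw [yosida, sub_add_cancel, norm_smul, norm_pow, Complex.norm_real, Real.norm_of_nonneg hp.le]
  calc point lam₀ n ^ 2 * ‖R (point lam₀ n)‖ ≤ point lam₀ n ^ 2 * (1 / point lam₀ n) := by
        gcongr
        exact h.norm_le _ (lt_point _ _)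
    _ = point lam₀ n := by field_simp

theorem resolvent_apply_eq (h : IsHilleYosida G lam₀ R) {lam : ℝ} (hl : lam₀ < lam) {x y : X}
    (hxy : G x y) : (lam : ℂ) • R lam x - x = R lam y := by
  have := (h.graph_iff lam hl x y).1 hxy
  rw [map_sub, map_smul] at this
  rw [sub_eq_iff_eq_add, ← sub_eq_iff_eq_add']
  exact this.symm

/-- On the domain, `lam R z - z = R y` has norm at most `‖y‖ / lam`. The uniform bound `‖lam R‖ ≤ 1`
carries the limit to the closure of the domain. -/
theorem tendsto_smul_resolvent (h : IsHilleYosida G lam₀ R) (x : X) :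
    Tendsto (fun n => (point lam₀ n : ℂ) • R (point lam₀ n) x) atTop (𝓝 x) := by
  have hb : ∀ n z, ‖(point lam₀ n : ℂ) • R (point lam₀ n) z‖ ≤ ‖z‖ := fun n z => by
    have hp := h.point_pos n
    rw [norm_smul, Complex.norm_real, Real.norm_of_nonneg hp.le]
    calc point lam₀ n * ‖R (point lam₀ n) z‖ ≤ point lam₀ n * (1 / point lam₀ n * ‖z‖) := by
          gcongr
          exact (ContinuousLinearMap.le_opNorm _ _).trans
            (by gcongr; exact h.norm_le _ (lt_point _ _))
      _ = ‖z‖ := by field_simp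
  rw [Metric.tendsto_atTop]
  intro ε hε
  obtain ⟨z, ⟨y, hzy⟩, hxz⟩ := h.dense.exists_dist_lt x (show 0 < ε / 3 by positivity)
  have hz : Tendsto (fun n => ‖y‖ / point lam₀ n) atTop (𝓝 0) :=
    tendsto_const_nhds.div_atTop (tendsto_point lam₀)
  obtain ⟨N, hN⟩ := (Metric.tendsto_atTop.1 hz) (ε / 3) (by positivity)
  refine ⟨N, fun n hn => ?_⟩
  have hp := h.point_pos n
  have h1 := hN n hn
  rw [Real.dist_eq, sub_zero, abs_of_nonneg (by positivity)] at h1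
  have h2 : ‖(point lam₀ n : ℂ) • R (point lam₀ n) z - z‖ ≤ ‖y‖ / point lam₀ n := by
    rw [h.resolvent_apply_eq (lt_point _ _) hzy]
    refine (ContinuousLinearMap.le_opNorm _ _).trans ?_
    calc ‖R (point lam₀ n)‖ * ‖y‖ ≤ 1 / point lam₀ n * ‖y‖ := by
          gcongr
          exact h.norm_le _ (lt_point _ _)
      _ = ‖y‖ / point lam₀ n := by ring
  have h3 := hb n (x - z)
  rw [map_sub, smul_sub] at h3
  rw [dist_eq_norm] at hxz ⊢
  set a := (point lam₀ n : ℂ) • R (point lam₀ n) x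
  set b := (point lam₀ n : ℂ) • R (point lam₀ n) z
  calc ‖a - x‖ = ‖(a - b) + (b - z) - (x - z)‖ := by congr 1; abel
    _ ≤ ‖a - b‖ + ‖b - z‖ + ‖x - z‖ := (norm_sub_le _ _).trans (by gcongr; exact norm_add_le _ _)
    _ < ε := by linarith

theorem tendsto_yosida (h : IsHilleYosida G lam₀ R) {x y : X} (hxy : G x y) :
    Tendsto (fun n => yosida lam₀ R n x) atTop (𝓝 y) := by
  refine (h.tendsto_smul_resolvent y).congr fun n => ?_
  rw [← h.resolvent_apply_eq (lt_point lam₀ n) hxy, smul_sub, smul_smul, yosida]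
  simp [pow_two]

theorem cauchySeq_exp_yosida [CompleteSpace X] (h : IsHilleYosida G lam₀ R) {t : ℝ} (ht : 0 ≤ t)
    (x : X) : CauchySeq fun n => expGroup (yosida lam₀ R n) t x := by
  refine cauchySeq_apply_of_dense (fun n x => h.norm_exp_yosida_le n ht x) h.dense ?_ x
  rintro x ⟨y, hxy⟩
  have hc := (h.tendsto_yosida hxy).cauchySeq
  rw [Metric.cauchySeq_iff] at hc ⊢
  intro ε hε
  obtain ⟨N, hN⟩ := hc (ε / (t + 1)) (by positivity)
  refine ⟨N, fun m hm n hn => ?_⟩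
  rw [dist_eq_norm]
  refine (norm_expGroup_sub_le (h.commute_yosida m n) (fun s hs z => h.norm_exp_yosida_le m hs z)
    (fun s hs z => h.norm_exp_yosida_le n hs z) ht x).trans_lt ?_
  have := hN m hm n hn
  rw [dist_eq_norm] at this
  calc t * ‖yosida lam₀ R m x - yosida lam₀ R n x‖
      ≤ t * (ε / (t + 1)) := by gcongr
    _ < (t + 1) * (ε / (t + 1)) := by
        have : 0 < ε / (t + 1) := by positivity
        nlinarith
    _ = ε := by field_simp

theorem exists_limit [CompleteSpace X] (h : IsHilleYosida G lam₀ R) :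
    ∃ T : ℝ → X →L[ℂ] X, ∀ t, 0 ≤ t → ∀ x,
      Tendsto (fun n => expGroup (yosida lam₀ R n) t x) atTop (𝓝 (T t x)) := by
  have h1 : ∀ t : ℝ, ∃ S : X →L[ℂ] X, 0 ≤ t → ∀ x,
      Tendsto (fun n => expGroup (yosida lam₀ R n) t x) atTop (𝓝 (S x)) := by
    intro t
    by_cases ht : 0 ≤ t
    · choose f hf using fun x => cauchySeq_tendsto_of_complete (h.cauchySeq_exp_yosida ht x)
      exact ⟨continuousLinearMapOfTendsto _ (tendsto_pi_nhds.2 hf), fun _ x => hf x⟩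
    -- Negative times get the default value `0`; no property of the semigroup refers to them.
    · exact ⟨0, fun h => absurd h ht⟩
  choose T hT using h1
  exact ⟨T, hT⟩

/-- **Hille–Yosida theorem** (contraction semigroups). -/
theorem exists_semigroup [CompleteSpace X] (h : IsHilleYosida G lam₀ R) :
    ∃ T : ℝ → X →L[ℂ] X, IsSemigroupGeneratedBy T G := by
  obtain ⟨T, hT⟩ := h.exists_limit
  have hnorm : ∀ t, 0 ≤ t → ∀ x, ‖T t x‖ ≤ ‖x‖ := fun t ht x =>
    le_of_tendsto (hT t ht x).norm (Eventually.of_forall fun n => h.norm_exp_yosida_le n ht x)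
  have hsub : ∀ n t, 0 ≤ t → ∀ x, ‖expGroup (yosida lam₀ R n) t x - x‖ ≤
      t * ‖yosida lam₀ R n x‖ := by
    intro n t ht x
    have := norm_image_sub_le_of_norm_deriv_right_le_segment (a := 0) (b := t)
      (C := ‖yosida lam₀ R n x‖)
      (fun s _ => (hasDerivAt_expGroup_apply (yosida lam₀ R n) s x).continuousAt.continuousWithinAt)
      (fun s _ => (hasDerivAt_expGroup_apply (yosida lam₀ R n) s x).hasDerivWithinAt)
      (fun s hs => h.norm_exp_yosida_le n hs.1 _) t ⟨ht, le_rfl⟩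
    simpa [expGroup_zero, mul_comm] using this
  -- A first-order Taylor estimate that passes to the limit without integrals. As `y` need not lie
  -- in the domain, it is compared with a nearby `y'` that does.
  have hmain : ∀ x y y' z', G x y → G y' z' → ∀ t, 0 ≤ t →
      ‖T t x - x - (t : ℂ) • y‖ ≤ t * (2 * ‖y - y'‖ + t * ‖z'‖) := by
    intro x y y' z' hxy hyz t ht
    have h1 : ∀ n, ‖expGroup (yosida lam₀ R n) t x - x - (t : ℂ) • yosida lam₀ R n x‖ ≤
        t * (2 * ‖y - y'‖ + t * ‖yosida lam₀ R n y'‖ + 2 * ‖yosida lam₀ R n x - y‖) := by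
      intro n
      set A := yosida lam₀ R n
      have hd : ∀ s : ℝ, HasDerivAt (fun s : ℝ => expGroup A s x - (s : ℂ) • A x)
          (expGroup A s (A x) - A x) s := by
        intro s
        refine (hasDerivAt_expGroup_apply A s x).sub ?_
        simpa using! (hasDerivAt_id s).ofReal_comp.smul_const (A x)
      have := norm_image_sub_le_of_norm_deriv_right_le_segment (a := 0) (b := t)
        (C := 2 * ‖y - y'‖ + t * ‖A y'‖ + 2 * ‖A x - y‖)
        (fun s _ => (hd s).continuousAt.continuousWithinAt)
        (fun s _ => (hd s).hasDerivWithinAt)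
        (fun s hs => by
          have e1 := h.norm_exp_yosida_le n hs.1 (A x - y)
          have e2 := h.norm_exp_yosida_le n hs.1 (y - y')
          have e3 := hsub n s hs.1 y'
          have e4 : s * ‖A y'‖ ≤ t * ‖A y'‖ := by gcongr; exact hs.2.le
          calc ‖expGroup A s (A x) - A x‖ = ‖expGroup A s (A x - y) + expGroup A s (y - y') +
                (expGroup A s y' - y') - (y - y') - (A x - y)‖ := by
                rw [map_sub, map_sub]; congr 1; abel
            _ ≤ ‖expGroup A s (A x - y)‖ + ‖expGroup A s (y - y')‖ +
                ‖expGroup A s y' - y'‖ + ‖y - y'‖ + ‖A x - y‖ := by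
                refine (norm_sub_le _ _).trans ?_
                gcongr
                refine (norm_sub_le _ _).trans ?_
                gcongr
                exact norm_add₃_le
            _ ≤ _ := by linarith) t ⟨ht, le_rfl⟩
      simp only [expGroup_zero, Complex.ofReal_zero, zero_smul, sub_zero,
        one_apply_eq_self] at this
      calc _ = _ := by rw [sub_right_comm]
        _ ≤ _ := this
        _ = _ := mul_comm _ _
    have hl := (((hT t ht x).sub_const x).sub ((h.tendsto_yosida hxy).const_smul (t : ℂ))).norm
    have hr := ((((h.tendsto_yosida hyz).norm.const_mul t).const_add (2 * ‖y - y'‖)).add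
      (((h.tendsto_yosida hxy).sub_const y).norm.const_mul 2)).const_mul t
    have := le_of_tendsto_of_tendsto hl hr (Eventually.of_forall h1)
    simpa using this
  have hgen : ∀ x y, G x y → Tendsto (fun t : ℝ => ((t : ℂ)⁻¹) • (T t x - x)) (𝓝[>] 0) (𝓝 y) := by
    intro x y hxy
    rw [Metric.tendsto_nhdsWithin_nhds]
    intro ε hε
    obtain ⟨y', ⟨z', hyz⟩, hd⟩ := h.dense.exists_dist_lt y (show 0 < ε / 4 by positivity)
    refine ⟨ε / (4 * (‖z'‖ + 1)), by positivity, fun t ht htd => ?_⟩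
    have ht : 0 < t := ht
    rw [Real.dist_eq, sub_zero, abs_of_pos ht] at htd
    have htc : (t : ℂ) ≠ 0 := by exact_mod_cast ht.ne'
    have h1 := hmain x y y' z' hxy hyz t ht.le
    rw [dist_eq_norm] at hd ⊢
    have e : ((t : ℂ)⁻¹) • (T t x - x) - y = ((t : ℂ)⁻¹) • (T t x - x - (t : ℂ) • y) := by
      rw [smul_sub _ _ ((t : ℂ) • y), smul_smul, inv_mul_cancel₀ htc, one_smul]
    rw [e, norm_smul, norm_inv, Complex.norm_real, Real.norm_of_nonneg ht.le]
    calc t⁻¹ * ‖T t x - x - (t : ℂ) • y‖ ≤ t⁻¹ * (t * (2 * ‖y - y'‖ + t * ‖z'‖)) := by gcongr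
      _ = 2 * ‖y - y'‖ + t * ‖z'‖ := by field_simp
      _ ≤ 2 * ‖y - y'‖ + ε / (4 * (‖z'‖ + 1)) * (‖z'‖ + 1) := by gcongr; linarith
      _ = 2 * ‖y - y'‖ + ε / 4 := by field_simp
      _ < ε := by linarith
  -- A contraction semigroup cannot grow at rate `lam > 0`, so its generator has no positive
  -- eigenvalue. With surjectivity of `lam - G`, this shows that the generator is no larger than
  -- `G`.
  have hinj : ∀ (z : X) (lam : ℝ), 0 < lam →
      Tendsto (fun t : ℝ => ((t : ℂ)⁻¹) • (T t z - z)) (𝓝[>] 0) (𝓝 ((lam : ℂ) • z)) → z = 0 := by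
    intro z lam hl hz
    have h1 : ∀ᶠ t : ℝ in 𝓝[>] 0, lam * ‖z‖ ≤
        ‖((t : ℂ)⁻¹) • (T t z - z) - (lam : ℂ) • z‖ := by
      filter_upwards [self_mem_nhdsWithin] with t ht
      have ht : 0 < t := ht
      have htc : (t : ℂ) ≠ 0 := by exact_mod_cast ht.ne'
      have e : ((t : ℂ)⁻¹) • (T t z - z) - (lam : ℂ) • z =
          ((t : ℂ)⁻¹) • (T t z - ((1 + lam * t : ℝ) : ℂ) • z) := by
        rw [smul_sub, smul_sub, smul_smul]
        push_cast
        rw [mul_add, add_smul, mul_one, mul_comm (lam : ℂ), inv_mul_cancel_left₀ htc]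
        abel
      rw [e, norm_smul, norm_inv, Complex.norm_real, Real.norm_of_nonneg ht.le]
      have e2 : (1 + lam * t) * ‖z‖ - ‖z‖ ≤ ‖T t z - ((1 + lam * t : ℝ) : ℂ) • z‖ := by
        have := norm_sub_norm_le (((1 + lam * t : ℝ) : ℂ) • z) (T t z)
        rw [norm_smul, Complex.norm_real, Real.norm_of_nonneg (by positivity), norm_sub_rev] at this
        linarith [hnorm t ht.le z]
      calc lam * ‖z‖ = t⁻¹ * ((1 + lam * t) * ‖z‖ - ‖z‖) := by field_simp; ring
        _ ≤ _ := by gcongr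
    have h2 : Tendsto (fun t : ℝ => ‖((t : ℂ)⁻¹) • (T t z - z) - (lam : ℂ) • z‖) (𝓝[>] 0) (𝓝 0) := by
      simpa using (hz.sub_const ((lam : ℂ) • z)).norm
    have h3 := le_of_tendsto_of_tendsto tendsto_const_nhds h2 h1
    have : ‖z‖ ≤ 0 := by
      by_contra hc
      push Not at hc
      nlinarith [mul_pos hl hc]
    exact norm_le_zero_iff.1 this
  refine ⟨T, ?_, ?_, ?_, ?_⟩
  · ext x
    refine tendsto_nhds_unique (hT 0 le_rfl x) ?_
    simp [expGroup_zero]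
  · intro s t hs ht
    ext x
    refine tendsto_nhds_unique (hT (s + t) (add_nonneg hs ht) x) ?_
    have h1 : ∀ n, expGroup (yosida lam₀ R n) (s + t) x =
        expGroup (yosida lam₀ R n) s (expGroup (yosida lam₀ R n) t x - T t x) +
          expGroup (yosida lam₀ R n) s (T t x) := fun n => by
      rw [expGroup_add, map_sub, sub_add_cancel]
      rfl
    simp_rw [h1]
    rw [show (T s * T t) x = 0 + T s (T t x) by simp]
    refine Tendsto.add ?_ (hT s hs _)
    rw [tendsto_zero_iff_norm_tendsto_zero]
    have h2 : Tendsto (fun n => ‖expGroup (yosida lam₀ R n) t x - T t x‖) atTop (𝓝 0) := by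
      simpa using ((hT t ht x).sub_const (T t x)).norm
    exact squeeze_zero (fun _ => norm_nonneg _) (fun n => h.norm_exp_yosida_le n hs _) h2
  · intro x
    rw [Metric.tendsto_nhdsWithin_nhds]
    intro ε hε
    obtain ⟨y, ⟨z, hyz⟩, hd⟩ := h.dense.exists_dist_lt x (show 0 < ε / 4 by positivity)
    refine ⟨ε / (4 * (‖z‖ + 1)), by positivity, fun t ht htd => ?_⟩
    have ht : 0 < t := ht
    rw [Real.dist_eq, sub_zero, abs_of_pos ht] at htd
    rw [dist_eq_norm] at hd ⊢
    have e1 : ‖T t y - y‖ ≤ t * ‖z‖ :=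
      le_of_tendsto_of_tendsto ((hT t ht.le y).sub_const y).norm
        ((h.tendsto_yosida hyz).norm.const_mul t)
        (Eventually.of_forall fun n => hsub n t ht.le y)
    have e2 := hnorm t ht.le (x - y)
    have e3 : t * ‖z‖ ≤ ε / 4 :=
      calc t * ‖z‖ ≤ ε / (4 * (‖z‖ + 1)) * (‖z‖ + 1) := by gcongr; linarith
        _ = ε / 4 := by field_simp
    calc ‖T t x - x‖ = ‖T t (x - y) + (T t y - y) - (x - y)‖ := by
          rw [map_sub]; congr 1; abel
      _ ≤ ‖T t (x - y)‖ + ‖T t y - y‖ + ‖x - y‖ :=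
          (norm_sub_le _ _).trans (by gcongr; exact norm_add_le _ _)
      _ < ε := by linarith
  · intro x y
    refine ⟨hgen x y, fun hxy => ?_⟩
    have hl : lam₀ < lam₀ + 1 := by linarith
    set lam := lam₀ + 1
    -- This point of the domain has the same image as `x` under `lam` minus the generator, so `hinj`
    -- identifies the two.
    set x' := R lam ((lam : ℂ) • x - y) with hx'
    have h1 := h.graph_resolvent hl ((lam : ℂ) • x - y)
    rw [← hx'] at h1
    have h2 := hxy.sub (hgen _ _ h1)
    have h3 := hinj (x - x') lam (h.nonneg.trans_lt hl) (by
      convert h2 using 2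
      · rw [map_sub, ← smul_sub]
        congr 1
        abel
      · rw [smul_sub]
        abel)
    rw [sub_eq_zero] at h3
    rw [h.graph_iff lam hl]
    exact h3

end IsHilleYosida

end HilleYosida

/-! ### Strongly continuous semigroups: shifts, conjugation, continuity, right derivatives -/

namespace IsSemigroupGeneratedBy

variable {X : Type*} [NormedAddCommGroup X] [NormedSpace ℂ X]
  {T : ℝ → X →L[ℂ] X} {G : X → X → Prop}

theorem add_apply (h : IsSemigroupGeneratedBy T G) {s t : ℝ} (hs : 0 ≤ s) (ht : 0 ≤ t) (x : X) :
    T (s + t) x = T s (T t x) := by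
  rw [h.map_add s t hs ht]
  rfl

/-- The semigroup `e^{γt} T t` is generated by the shifted operator. -/
theorem exp_smul (h : IsSemigroupGeneratedBy T G) (γ : ℝ) :
    IsSemigroupGeneratedBy (fun t => ((Real.exp (γ * t) : ℝ) : ℂ) • T t)
      (fun x y => G x (y - (γ : ℂ) • x)) := by
  have hexp : Tendsto (fun t : ℝ => ((Real.exp (γ * t) : ℝ) : ℂ)) (𝓝[>] 0) (𝓝 1) := by
    have : Continuous fun t : ℝ => ((Real.exp (γ * t) : ℝ) : ℂ) := by fun_prop
    simpa using (this.tendsto 0).mono_left nhdsWithin_le_nhds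
  have hslope : Tendsto (fun t : ℝ => ((t : ℂ)⁻¹) * (((Real.exp (γ * t) : ℝ) : ℂ) - 1))
      (𝓝[>] 0) (𝓝 γ) := by
    have h1 : HasDerivAt (fun t : ℝ => ((Real.exp (γ * t) : ℝ) : ℂ)) (γ : ℂ) 0 := by
      have := ((hasDerivAt_id (0 : ℝ)).const_mul γ).exp.ofReal_comp
      simpa using this
    have h2 := (hasDerivAt_iff_tendsto_slope_zero.1 h1).mono_left
      (nhdsWithin_mono 0 (s := Set.Ioi 0) fun t (ht : (0 : ℝ) < t) => ht.ne')
    refine h2.congr fun t => ?_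
    simp
  have hzero : ∀ x, Tendsto (fun t : ℝ => (((Real.exp (γ * t) : ℝ) : ℂ) • T t) x) (𝓝[>] 0) (𝓝 x) := by
    intro x
    simpa using hexp.smul (h.tendsto_zero x)
  have hiff : ∀ x y, Tendsto (fun t : ℝ => ((t : ℂ)⁻¹) • (T t x - x)) (𝓝[>] 0) (𝓝 y) →
      Tendsto (fun t : ℝ => ((t : ℂ)⁻¹) • ((((Real.exp (γ * t) : ℝ) : ℂ) • T t) x - x))
        (𝓝[>] 0) (𝓝 (y + (γ : ℂ) • x)) := by
    intro x y hxy
    have := hxy.add (hslope.smul (hzero x))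
    have h2 := (hexp.smul hxy).add (hslope.smul (tendsto_const_nhds (x := x)))
    rw [one_smul] at h2
    refine h2.congr fun t => ?_
    change _ = ((t : ℂ)⁻¹) • (((Real.exp (γ * t) : ℝ) : ℂ) • T t x - x)
    module
  refine ⟨?_, ?_, hzero, fun x y => ?_⟩
  · simp [h.map_zero]
  · intro s t hs ht
    ext x
    change ((Real.exp (γ * (s + t)) : ℝ) : ℂ) • T (s + t) x =
      ((Real.exp (γ * s) : ℝ) : ℂ) • T s (((Real.exp (γ * t) : ℝ) : ℂ) • T t x)
    rw [h.add_apply hs ht, map_smul, smul_smul, mul_add, Real.exp_add, Complex.ofReal_mul]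
  · rw [h.generator]
    refine ⟨fun hx => by simpa using hiff x _ hx, fun hx => ?_⟩
    have hexp' : Tendsto (fun t : ℝ => ((Real.exp (γ * t) : ℝ) : ℂ)⁻¹) (𝓝[>] 0) (𝓝 1) := by
      simpa using hexp.inv₀ one_ne_zero
    have h1 := hexp'.smul (hx.sub (hslope.smul (tendsto_const_nhds (x := x))))
    rw [one_smul] at h1
    refine h1.congr fun t => ?_
    have he : ((Real.exp (γ * t) : ℝ) : ℂ) ≠ 0 := by exact_mod_cast (Real.exp_pos _).ne'
    change ((Real.exp (γ * t) : ℝ) : ℂ)⁻¹ • (((t : ℂ)⁻¹) •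
      (((Real.exp (γ * t) : ℝ) : ℂ) • T t x - x) - _) = _
    rw [show ((t : ℂ)⁻¹) • (((Real.exp (γ * t) : ℝ) : ℂ) • T t x - x) -
      (((t : ℂ)⁻¹) * (((Real.exp (γ * t) : ℝ) : ℂ) - 1)) • x =
      ((Real.exp (γ * t) : ℝ) : ℂ) • (((t : ℂ)⁻¹) • (T t x - x)) by module, smul_smul,
      inv_mul_cancel₀ he, one_smul]

/-- Transport of a semigroup along a linear homeomorphism. -/
theorem conj {Y : Type*} [NormedAddCommGroup Y] [NormedSpace ℂ Y]
    (h : IsSemigroupGeneratedBy T G) (S : Y ≃L[ℂ] X) :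
    IsSemigroupGeneratedBy (fun t => (S.symm : X →L[ℂ] Y) ∘L T t ∘L (S : Y →L[ℂ] X))
      (fun x y => G (S x) (S y)) := by
  refine ⟨?_, ?_, ?_, ?_⟩
  · ext x
    simp [h.map_zero]
  · intro s t hs ht
    ext x
    change S.symm (T (s + t) (S x)) = S.symm (T s (S (S.symm (T t (S x)))))
    rw [h.add_apply hs ht, S.apply_symm_apply]
  · intro x
    have := (S.symm.continuous.tendsto _).comp (h.tendsto_zero (S x))
    rw [S.symm_apply_apply] at this
    exact this
  · intro x y
    rw [h.generator]
    have e : ∀ t : ℝ, ((t : ℂ)⁻¹) • (((S.symm : X →L[ℂ] Y) ∘L T t ∘L (S : Y →L[ℂ] X)) x - x) =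
        S.symm (((t : ℂ)⁻¹) • (T t (S x) - S x)) := fun t => by
      rw [map_smul, map_sub, S.symm_apply_apply]
      rfl
    simp_rw [e]
    constructor
    · intro hx
      have := (S.symm.continuous.tendsto _).comp hx
      rw [S.symm_apply_apply] at this
      exact this
    · intro hx
      have := (S.continuous.tendsto _).comp hx
      refine this.congr fun t => ?_
      simp

/-- A strongly continuous semigroup is bounded near `0`. -/
theorem exists_bound_near_zero [CompleteSpace X] (h : IsSemigroupGeneratedBy T G) :
    ∃ δ > 0, ∃ M, ∀ t, 0 ≤ t → t ≤ δ → ‖T t‖ ≤ M := by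
  by_contra hc
  push Not at hc
  have hpos : ∀ n : ℕ, (0 : ℝ) < 1 / (n + 1) := fun n => Nat.one_div_pos_of_nat
  -- Exceeding `‖T 0‖` as well rules out `t n = 0`, so the times approach `0` from the right and
  -- strong continuity bounds each orbit, as Banach–Steinhaus requires.
  choose t ht0 ht1 ht2 using fun n : ℕ => hc (1 / (n + 1)) (hpos n) (max n ‖T 0‖)
  have htpos : ∀ n, 0 < t n := fun n => by
    refine lt_of_le_of_ne (ht0 n) fun h0 => ?_
    have := ht2 n
    rw [← h0] at this
    exact absurd (le_max_right _ _) (not_le.2 this)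
  have hlim : Tendsto t atTop (𝓝[>] 0) := by
    refine tendsto_nhdsWithin_iff.2 ⟨?_, Eventually.of_forall htpos⟩
    exact squeeze_zero ht0 ht1 tendsto_one_div_add_atTop_nhds_zero_nat
  obtain ⟨C, hC⟩ := banach_steinhaus (g := fun n => T (t n)) fun x => by
    obtain ⟨C, hC⟩ := (((h.tendsto_zero x).comp hlim).norm).bddAbove_range
    exact ⟨C, fun n => hC ⟨n, rfl⟩⟩
  obtain ⟨n, hn⟩ := exists_nat_gt C
  exact absurd ((hn.trans_le (le_max_left _ _)).trans (ht2 n)) (not_lt.2 (hC n))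

theorem exists_bound [CompleteSpace X] (h : IsSemigroupGeneratedBy T G) (b : ℝ) :
    ∃ M, ∀ t, 0 ≤ t → t ≤ b → ‖T t‖ ≤ M := by
  obtain ⟨δ, hδ, M, hM⟩ := h.exists_bound_near_zero
  have hM0 : 0 ≤ M := (norm_nonneg _).trans (hM 0 le_rfl hδ.le)
  have key : ∀ k : ℕ, ∃ K, ∀ t, 0 ≤ t → t ≤ k * δ → ‖T t‖ ≤ K := by
    intro k
    induction k with
    | zero => exact ⟨M, fun t h0 h1 => hM t h0 (by simp at h1; linarith)⟩
    | succ k ih =>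
      obtain ⟨K, hK⟩ := ih
      refine ⟨max M (M * K), fun t h0 h1 => ?_⟩
      by_cases htd : t ≤ δ
      · exact (hM t h0 htd).trans (le_max_left _ _)
      push Not at htd
      have e : t = δ + (t - δ) := by ring
      rw [e, h.map_add _ _ hδ.le (by linarith)]
      refine le_trans ?_ (le_max_right _ _)
      refine (norm_mul_le _ _).trans ?_
      push_cast at h1
      exact mul_le_mul (hM _ hδ.le le_rfl) (hK _ (by linarith) (by linarith)) (norm_nonneg _) hM0
  obtain ⟨k, hk⟩ := exists_nat_gt (b / δ)
  obtain ⟨K, hK⟩ := key k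
  rw [div_lt_iff₀ hδ] at hk
  exact ⟨K, fun t h0 h1 => hK t h0 (by linarith)⟩

theorem tendsto_zero_Ici (h : IsSemigroupGeneratedBy T G) (x : X) :
    Tendsto (fun t => T t x) (𝓝[≥] 0) (𝓝 x) := by
  have : ContinuousWithinAt (fun t => T t x) (Set.Ioi 0) 0 := by
    have := h.tendsto_zero x
    rwa [ContinuousWithinAt, h.map_zero, one_apply_eq_self]
  have h2 := continuousWithinAt_Ioi_iff_Ici.1 this
  rwa [ContinuousWithinAt, h.map_zero, one_apply_eq_self] at h2

/-- For `r ≤ u`, `T u x - T r x = T r (T (u - r) x - x)`. Right continuity at `0` and a local bound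
on `‖T r‖` then give continuity from both sides. -/
theorem continuousOn [CompleteSpace X] (h : IsSemigroupGeneratedBy T G) (x : X) :
    ContinuousOn (fun t => T t x) (Set.Ici 0) := by
  intro t ht
  have ht : 0 ≤ t := ht
  obtain ⟨M, hM⟩ := h.exists_bound (t + 1)
  have hM0 : 0 ≤ M := (norm_nonneg _).trans (hM 0 le_rfl (by linarith))
  have h0 := h.tendsto_zero_Ici x
  rw [Metric.tendsto_nhdsWithin_nhds] at h0
  rw [Metric.continuousWithinAt_iff]
  intro ε hε
  obtain ⟨δ, hδ, hd⟩ := h0 (ε / (M + 1)) (by positivity)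
  refine ⟨min δ 1, by positivity, fun {s} hs hst => ?_⟩
  have hs : 0 ≤ s := hs
  rw [Real.dist_eq] at hst
  have key : ∀ r u, 0 ≤ r → r ≤ u → r ≤ t + 1 → u - r < δ → dist (T u x) (T r x) < ε := by
    intro r u hr hru hrt hur
    have e : u = r + (u - r) := by ring
    rw [e, h.add_apply hr (by linarith), dist_eq_norm, ← map_sub]
    have h1 := hd (x := u - r) (by simpa using hru)
      (by rw [Real.dist_eq, sub_zero, abs_of_nonneg (by linarith)]; exact hur)
    rw [dist_eq_norm] at h1
    calc ‖T r (T (u - r) x - x)‖ ≤ M * ‖T (u - r) x - x‖ :=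
          ((T r).le_opNorm _).trans (by gcongr; exact hM r hr hrt)
      _ ≤ M * (ε / (M + 1)) := by gcongr
      _ < (M + 1) * (ε / (M + 1)) := by
          have : 0 < ε / (M + 1) := by positivity
          nlinarith
      _ = ε := by field_simp
  obtain ⟨h1, h2⟩ := abs_lt.1 hst
  have h3 := min_le_left δ 1
  have h4 := min_le_right δ 1
  rcases le_total s t with hle | hle
  · rw [dist_comm]
    exact key s t hs hle (by linarith) (by linarith)
  · exact key t s ht hle (by linarith) (by linarith)

theorem graph_apply (h : IsSemigroupGeneratedBy T G) {x y : X} (hxy : G x y) {t : ℝ}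
    (ht : 0 ≤ t) : G (T t x) (T t y) := by
  rw [h.generator] at *
  refine (((T t).continuous.tendsto _).comp hxy).congr' ?_
  filter_upwards [self_mem_nhdsWithin] with s hs
  have hs : 0 < s := hs
  change T t (((s : ℂ)⁻¹) • (T s x - x)) = _
  rw [map_smul, map_sub, ← h.add_apply ht hs.le, ← h.add_apply hs.le ht, add_comm]

/-- Only the right derivative is taken, which is immediate from the generator at `T t x`. Together
with continuity it suffices for the one-sided mean value inequalities used below. -/
theorem hasDerivWithinAt (h : IsSemigroupGeneratedBy T G) {x y : X} (hxy : G x y) {t : ℝ}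
    (ht : 0 ≤ t) : HasDerivWithinAt (fun s => T s x) (T t y) (Set.Ici t) t := by
  rw [hasDerivWithinAt_iff_tendsto_slope, Set.Ici_sdiff_left]
  have h1 := (h.generator _ _).1 (h.graph_apply hxy ht)
  have h2 : Tendsto (fun s => s - t) (𝓝[>] t) (𝓝[>] 0) := by
    refine tendsto_nhdsWithin_iff.2 ⟨?_, ?_⟩
    · have : Continuous fun s : ℝ => s - t := by fun_prop
      simpa using (this.tendsto t).mono_left nhdsWithin_le_nhds
    · filter_upwards [self_mem_nhdsWithin] with s hs
      exact sub_pos.2 (Set.mem_Ioi.1 hs)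
  refine (h1.comp h2).congr' ?_
  filter_upwards [self_mem_nhdsWithin] with s hs
  have hs : t < s := hs
  rw [slope_def_module]
  change (((s - t : ℝ) : ℂ)⁻¹) • (T (s - t) (T t x) - T t x) = _
  rw [← h.add_apply (by linarith) ht, sub_add_cancel, ← Complex.ofReal_inv, Complex.coe_smul]

end IsSemigroupGeneratedBy

/-! ### Legendre polynomials: recurrences and the differential equation -/

section Legendre

open Polynomial

/-- The derivative `(d/ds)^m P_n` of the Legendre polynomial. -/
def legendreDeriv (n m : ℕ) : ℝ[X] := derivative^[m] (legendre n)

theorem derivative_legendreDeriv (n m : ℕ) :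
    derivative (legendreDeriv n m) = legendreDeriv n (m + 1) :=
  (Function.iterate_succ_apply' _ _ _).symm

/-- Rodrigues' formula cleared of its denominator; the recurrences reduce to Leibniz' rule applied
to powers of `s² - 1`. -/
theorem iterate_derivative_mul_legendre (n k : ℕ) :
    C (2 ^ n * (n ! : ℝ)) * legendreDeriv n k =
      derivative^[n + k] ((X ^ 2 - 1 : ℝ[X]) ^ n) := by
  have h : (2 ^ n * (n ! : ℝ)) ≠ 0 := by positivity
  rw [legendreDeriv, legendre, iterate_derivative_C_mul, ← mul_assoc, ← C_mul,
    mul_one_div_cancel h, C_1, one_mul, ← Function.iterate_add_apply, add_comm]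

theorem iterate_derivative_X_mul_succ (k : ℕ) (p : ℝ[X]) :
    derivative^[k + 1] (X * p) = X * derivative^[k + 1] p + C ((k : ℝ) + 1) * derivative^[k] p := by
  induction k with
  | zero => simp [add_comm]
  | succ k ih =>
    rw [Function.iterate_succ_apply', ih, derivative_add, derivative_mul, derivative_mul,
      derivative_X, derivative_C, ← Function.iterate_succ_apply' derivative,
      ← Function.iterate_succ_apply' derivative]
    simp only [C_add, C_1, Nat.cast_add, Nat.cast_one, Nat.succ_eq_add_one]
    ring

theorem iterate_derivative_X_sq_sub_one_mul (k : ℕ) (p : ℝ[X]) :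
    derivative^[k + 2] ((X ^ 2 - 1) * p) = (X ^ 2 - 1) * derivative^[k + 2] p +
      C (2 * ((k : ℝ) + 2)) * X * derivative^[k + 1] p +
      C (((k : ℝ) + 2) * (k + 1)) * derivative^[k] p := by
  have h : (X ^ 2 - 1) * p = X * (X * p) - p := by ring
  rw [h, iterate_derivative_sub, iterate_derivative_X_mul_succ, iterate_derivative_X_mul_succ,
    iterate_derivative_X_mul_succ]
  simp only [C_add, C_mul, C_1, C_ofNat, Nat.cast_add, Nat.cast_one, map_natCast]
  ring

theorem derivative_X_sq_sub_one_pow (n : ℕ) :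
    derivative ((X ^ 2 - 1 : ℝ[X]) ^ (n + 1)) =
      C (2 * ((n : ℝ) + 1)) * (X * (X ^ 2 - 1) ^ n) := by
  rw [derivative_pow]
  simp only [derivative_sub, derivative_X_pow, derivative_one, C_add, C_mul, C_1, C_ofNat,
    Nat.cast_add, Nat.cast_one, Nat.add_sub_cancel, map_natCast, Nat.cast_ofNat]
  ring

theorem legendre_normalization_ne_zero (n : ℕ) : (C (2 ^ n * (n ! : ℝ)) : ℝ[X]) ≠ 0 := by
  rw [Ne, C_eq_zero]
  positivity

theorem normalization_succ (n : ℕ) :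
    (C (2 ^ (n + 1) * ((n + 1)! : ℝ)) : ℝ[X]) = C (2 * ((n : ℝ) + 1)) * C (2 ^ n * (n ! : ℝ)) := by
  rw [← C_mul, Nat.factorial_succ]
  congr 1
  push_cast
  ring

/-- `P_{n+1}' = s P_n' + (n+1) P_n`. -/
theorem legendreDeriv_succ_one (n : ℕ) :
    legendreDeriv (n + 1) 1 = X * legendreDeriv n 1 + C ((n : ℝ) + 1) * legendreDeriv n 0 := by
  refine mul_left_cancel₀ (legendre_normalization_ne_zero (n + 1)) ?_
  rw [iterate_derivative_mul_legendre, Function.iterate_succ_apply, derivative_X_sq_sub_one_pow,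
    iterate_derivative_C_mul, iterate_derivative_X_mul_succ, normalization_succ]
  have h1 := iterate_derivative_mul_legendre n 1
  have h0 := iterate_derivative_mul_legendre n 0
  rw [← h1]
  rw [add_zero] at h0
  rw [← h0]
  ring

theorem legendre_zero : legendreDeriv 0 0 = 1 := by
  simp [legendreDeriv, legendre]

theorem legendreDeriv_eq_zero {n m : ℕ} (h : n < m) : legendreDeriv n m = 0 := by
  refine iterate_derivative_eq_zero (lt_of_le_of_lt ?_ h)
  unfold legendre
  refine (natDegree_C_mul_le _ _).trans ((natDegree_iterate_derivative _ _).trans ?_)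
  have : ((X ^ 2 - 1 : ℝ[X]) ^ n).natDegree ≤ 2 * n := by
    refine natDegree_pow_le.trans ?_
    rw [mul_comm]
    gcongr
    compute_degree
  omega

theorem legendre_one : legendreDeriv 1 0 = X := by
  simp [legendreDeriv, legendre]
  have : (C (2⁻¹ : ℝ)) * (2 : ℝ[X]) = 1 := by
    rw [← C_ofNat, ← C_mul]
    norm_num
  linear_combination X * this

/-- `(s² - 1) P_n' = (n+1) (P_{n+1} - s P_n)`. -/
theorem X_sq_sub_one_mul_legendreDeriv_one (n : ℕ) :
    (X ^ 2 - 1) * legendreDeriv n 1 =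
      C ((n : ℝ) + 1) * (legendreDeriv (n + 1) 0 - X * legendreDeriv n 0) := by
  cases n with
  | zero => rw [legendreDeriv_eq_zero zero_lt_one, legendre_one, legendre_zero]; simp
  | succ k =>
    refine mul_left_cancel₀ (legendre_normalization_ne_zero (k + 1 + 1)) ?_
    have hA := iterate_derivative_mul_legendre (k + 1) 1
    have hB := iterate_derivative_mul_legendre (k + 1) 0
    have hC := iterate_derivative_mul_legendre (k + 1 + 1) 0
    rw [add_zero] at hB hC
    rw [Function.iterate_succ_apply, derivative_X_sq_sub_one_pow, iterate_derivative_C_mul,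
      iterate_derivative_X_mul_succ, ← hB] at hC
    -- With `w = (s² - 1)^(k+1)`, differentiate `(s² - 1) w' = 2(k+1) s w` another `k + 1` times.
    -- The terms in the derivative of order `k + 1` cancel, leaving `key2`.
    have key : derivative^[k + 1] ((X ^ 2 - 1) * derivative ((X ^ 2 - 1 : ℝ[X]) ^ (k + 1))) =
        derivative^[k + 1] (C (2 * ((k : ℝ) + 1)) * (X * (X ^ 2 - 1) ^ (k + 1))) := by
      rw [derivative_X_sq_sub_one_pow]
      congr 1
      ring
    have key2 : (X ^ 2 - 1) * derivative^[k + 2] ((X ^ 2 - 1 : ℝ[X]) ^ (k + 1)) =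
        C (((k : ℝ) + 1) * (k + 2)) * derivative^[k] ((X ^ 2 - 1 : ℝ[X]) ^ (k + 1)) := by
      rw [iterate_derivative_C_mul, iterate_derivative_X_mul_succ] at key
      cases k with
      | zero =>
        simp only [zero_add, Function.iterate_zero, id_eq, pow_one,
          Function.iterate_succ_apply, Nat.cast_zero, C_1, derivative_mul] at key ⊢
        simp only [derivative_sub, derivative_X_pow, derivative_one, derivative_mul, C_ofNat, C_mul,
          derivative_X, Nat.cast_ofNat, derivative_ofNat, pow_one, C_1, derivative_zero,
          Nat.add_one_sub_one]
        ring
      | succ j =>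
        rw [iterate_derivative_X_sq_sub_one_mul] at key
        simp only [← Function.iterate_succ_apply] at key
        simp only [C_add, C_mul, C_1, C_ofNat, Nat.cast_add, Nat.cast_one, map_natCast] at key ⊢
        linear_combination key
    have hA' : derivative^[k + 2] ((X ^ 2 - 1 : ℝ[X]) ^ (k + 1)) =
      C (2 ^ (k + 1) * ((k + 1)! : ℝ)) * legendreDeriv (k + 1) 1 := hA.symm
    rw [hA'] at key2
    rw [normalization_succ] at hC ⊢
    simp only [C_add, C_mul, C_1, C_ofNat, Nat.cast_add, Nat.cast_one, map_natCast] at key2 hC ⊢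
    linear_combination (2 * ((k : ℝ[X]) + 1 + 1)) * key2 - ((k : ℝ[X]) + 2) * hC

/-- Bonnet's recursion. -/
theorem bonnet (n : ℕ) :
    C ((n : ℝ) + 2) * legendreDeriv (n + 2) 0 =
      C (2 * (n : ℝ) + 3) * X * legendreDeriv (n + 1) 0 - C ((n : ℝ) + 1) * legendreDeriv n 0 := by
  have h1 := X_sq_sub_one_mul_legendreDeriv_one n
  have h2 := X_sq_sub_one_mul_legendreDeriv_one (n + 1)
  have h3 := legendreDeriv_succ_one n
  simp only [C_add, C_mul, C_1, C_ofNat, Nat.cast_add, Nat.cast_one, map_natCast] at *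
  linear_combination (-1 : ℝ[X]) * h2 + (X ^ 2 - 1) * h3 + X * h1

/-- `P_{n+2}' - P_n' = (2n+3) P_{n+1}`. -/
theorem legendreDeriv_sub (n : ℕ) :
    legendreDeriv (n + 2) 1 - legendreDeriv n 1 = C (2 * (n : ℝ) + 3) * legendreDeriv (n + 1) 0 := by
  have h1 := X_sq_sub_one_mul_legendreDeriv_one n
  have h3 := legendreDeriv_succ_one n
  have h4 := legendreDeriv_succ_one (n + 1)
  simp only [C_add, C_mul, C_1, C_ofNat, Nat.cast_add, Nat.cast_one, map_natCast] at *
  linear_combination h4 + X * h3 + h1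

/-- Legendre's equation, differentiated `m` times. -/
theorem legendre_ode (n m : ℕ) :
    (1 - X ^ 2) * legendreDeriv n (m + 2) - C (2 * ((m : ℝ) + 1)) * X * legendreDeriv n (m + 1) +
      C ((n : ℝ) * (n + 1) - m * (m + 1)) * legendreDeriv n m = 0 := by
  induction m with
  | zero =>
    have h := congrArg derivative (X_sq_sub_one_mul_legendreDeriv_one n)
    have h3 := legendreDeriv_succ_one n
    simp only [derivative_mul, derivative_sub, derivative_C, derivative_X, derivative_X_pow,
      derivative_one, derivative_legendreDeriv] at h
    simp only [C_add, C_sub, C_mul, C_1, C_ofNat, map_natCast,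
      Nat.cast_zero, C_0, Nat.cast_ofNat, zero_add] at *
    linear_combination (-1 : ℝ[X]) * h - ((n : ℝ[X]) + 1) * h3
  | succ m ih =>
    have h := congrArg derivative ih
    simp only [derivative_mul, derivative_sub, derivative_add, derivative_C, derivative_X,
      derivative_X_pow, derivative_one, derivative_legendreDeriv, derivative_zero] at h
    simp only [C_add, C_sub, C_mul, C_1, C_ofNat, Nat.cast_add, Nat.cast_one, map_natCast,
      Nat.cast_ofNat] at *
    linear_combination h

theorem derivative_bonnet (n m : ℕ) :
    C ((n : ℝ) + 2) * legendreDeriv (n + 2) (m + 1) =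
      C (2 * (n : ℝ) + 3) * (X * legendreDeriv (n + 1) (m + 1) + C ((m : ℝ) + 1) *
        legendreDeriv (n + 1) m) - C ((n : ℝ) + 1) * legendreDeriv n (m + 1) := by
  induction m with
  | zero =>
    have h := congrArg derivative (bonnet n)
    simp only [derivative_mul, derivative_sub, derivative_C, derivative_X,
      derivative_legendreDeriv] at h
    simp only [C_add, C_mul, C_1, C_ofNat, Nat.cast_zero, zero_add] at *
    linear_combination h
  | succ m ih =>
    have h := congrArg derivative ih
    simp only [derivative_mul, derivative_sub, derivative_add, derivative_C, derivative_X,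
      derivative_legendreDeriv] at h
    simp only [C_add, C_mul, C_1, C_ofNat, Nat.cast_add, Nat.cast_one, map_natCast] at *
    linear_combination h

/-- Needed to eliminate the derivative of lower order from `derivative_bonnet`, which yields the
three-term recurrence at a fixed order `m`. -/
theorem legendreDeriv_sub' (n m : ℕ) :
    legendreDeriv (n + 2) (m + 1) - legendreDeriv n (m + 1) =
      C (2 * (n : ℝ) + 3) * legendreDeriv (n + 1) m := by
  induction m with
  | zero => exact legendreDeriv_sub n
  | succ m ih =>
    have h := congrArg derivative ih
    simpa only [derivative_mul, derivative_sub, derivative_C, derivative_legendreDeriv, zero_mul,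
      zero_add] using h

/-- `(n+2-m) P_{n+2}^{(m)} = (2n+3) s P_{n+1}^{(m)} - (n+1+m) P_n^{(m)}`. -/
theorem legendreDeriv_recurrence (n m : ℕ) :
    C ((n : ℝ) + 2 - m) * legendreDeriv (n + 2) m =
      C (2 * (n : ℝ) + 3) * X * legendreDeriv (n + 1) m -
        C ((n : ℝ) + 1 + m) * legendreDeriv n m := by
  cases m with
  | zero => simpa using bonnet n
  | succ m =>
    have h1 := derivative_bonnet n m
    have h2 := legendreDeriv_sub' n m
    simp only [C_add, C_sub, C_mul, C_1, C_ofNat, Nat.cast_add, Nat.cast_one, map_natCast] at *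
    linear_combination h1 - ((m : ℝ[X]) + 1) * h2

/-- `P_n^{(n)}` is a non-zero constant. -/
theorem legendreDeriv_self (n : ℕ) : ∃ c : ℝ, c ≠ 0 ∧ legendreDeriv n n = C c := by
  induction n with
  | zero => exact ⟨1, one_ne_zero, by rw [legendre_zero, C_1]⟩
  | succ n ih =>
    obtain ⟨c, hc, hn⟩ := ih
    have key : legendreDeriv (n + 1) (n + 1) = C (2 * (n : ℝ) + 1) * legendreDeriv n n := by
      cases n with
      | zero =>
        have := legendreDeriv_succ_one 0
        rw [legendreDeriv_eq_zero zero_lt_one] at this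
        simpa using this
      | succ k =>
        have := legendreDeriv_sub' k (k + 1)
        rw [legendreDeriv_eq_zero (show k < k + 1 + 1 by omega), sub_zero] at this
        rw [this]
        congr 2
        push_cast
        ring
    refine ⟨(2 * n + 1) * c, by positivity, ?_⟩
    rw [key, hn, C_mul]

end Legendre

/-! ### Rotations of the sphere and integration by parts -/

section Rotation

/-- The rotation by the angle `t` about the `i`-th coordinate axis. -/
def rotFun (i : Fin 3) (t : ℝ) (x : E3) : E3 :=
  ![!₂[x 0, Real.cos t * x 1 - Real.sin t * x 2, Real.sin t * x 1 + Real.cos t * x 2],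
    !₂[Real.cos t * x 0 + Real.sin t * x 2, x 1, -(Real.sin t * x 0) + Real.cos t * x 2],
    !₂[Real.cos t * x 0 - Real.sin t * x 1, Real.sin t * x 0 + Real.cos t * x 1, x 2]] i

theorem norm_rotFun (i : Fin 3) (t : ℝ) (x : E3) : ‖rotFun i t x‖ = ‖x‖ := by
  rw [← sq_eq_sq₀ (norm_nonneg _) (norm_nonneg _), EuclideanSpace.norm_sq_eq,
    EuclideanSpace.norm_sq_eq]
  have h := Real.sin_sq_add_cos_sq t
  fin_cases i <;> simp [rotFun, Fin.sum_univ_three]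
  · linear_combination (x.1 1 ^ 2 + x.1 2 ^ 2) * h
  · linear_combination (x.1 0 ^ 2 + x.1 2 ^ 2) * h
  · linear_combination (x.1 0 ^ 2 + x.1 1 ^ 2) * h

/-- The rotation by the angle `t` about the `i`-th coordinate axis, as a linear isometry. -/
def rotation (i : Fin 3) (t : ℝ) : E3 ≃ₗᵢ[ℝ] E3 :=
  LinearIsometry.toLinearIsometryEquiv
    { toFun := rotFun i t
      map_add' := fun x y => by
        ext j
        fin_cases i <;> fin_cases j <;> simp [rotFun] <;> ring
      map_smul' := fun c x => by
        ext j
        fin_cases i <;> fin_cases j <;> simp [rotFun] <;> ring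
      norm_map' := norm_rotFun i t } rfl

theorem rotFun_zero (i : Fin 3) (x : E3) : rotFun i 0 x = x := by
  ext j
  fin_cases i <;> fin_cases j <;> simp [rotFun]

theorem hasDerivAt_rotFun (i : Fin 3) (x : E3) (t : ℝ) :
    HasDerivAt (fun s => rotFun i s x) (rotField i (rotFun i t x)) t := by
  have hs := Real.hasDerivAt_sin t
  have hc := Real.hasDerivAt_cos t
  rw [hasDerivAt_iff_hasFDerivAt, ← hasFDerivWithinAt_univ, hasFDerivWithinAt_euclidean]
  intro j
  rw [hasFDerivWithinAt_univ, hasFDerivAt_iff_hasDerivAt]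
  have key : ∀ a b c : ℝ, HasDerivAt (fun s => Real.cos s * a + Real.sin s * b + c)
      (-Real.sin t * a + Real.cos t * b) t := fun a b c =>
    ((hc.mul_const a).add (hs.mul_const b)).add_const c
  fin_cases i <;> fin_cases j <;> simp [rotFun, rotField]
  · exact hasDerivAt_const _ _
  · refine ((key (x.1 1) (-x.1 2) 0).congr_deriv (by ring)).congr_of_eventuallyEq
      (Eventually.of_forall fun s => ?_)
    change _ = _ + 0
    ring
  · refine ((key (x.1 2) (x.1 1) 0).congr_deriv (by ring)).congr_of_eventuallyEq
      (Eventually.of_forall fun s => ?_)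
    change _ = _ + 0
    ring
  · refine ((key (x.1 0) (x.1 2) 0).congr_deriv (by ring)).congr_of_eventuallyEq
      (Eventually.of_forall fun s => ?_)
    change _ = _ + 0
    ring
  · exact hasDerivAt_const _ _
  · refine ((key (x.1 2) (-x.1 0) 0).congr_deriv (by ring)).congr_of_eventuallyEq
      (Eventually.of_forall fun s => ?_)
    change _ = _ + 0
    ring
  · refine ((key (x.1 0) (-x.1 1) 0).congr_deriv (by ring)).congr_of_eventuallyEq
      (Eventually.of_forall fun s => ?_)
    change _ = _ + 0
    ring
  · refine ((key (x.1 1) (x.1 0) 0).congr_deriv (by ring)).congr_of_eventuallyEq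
      (Eventually.of_forall fun s => ?_)
    change _ = _ + 0
    ring
  · exact hasDerivAt_const _ _

/-- The action of a linear isometry on the sphere. -/
def sphereMap (L : E3 ≃ₗᵢ[ℝ] E3) (x : S2) : S2 :=
  ⟨L x.1, by rw [mem_sphere_zero_iff_norm, L.norm_map]; exact mem_sphere_zero_iff_norm.1 x.2⟩

theorem continuous_sphereMap (L : E3 ≃ₗᵢ[ℝ] E3) : Continuous (sphereMap L) :=
  (L.continuous.comp continuous_subtype_val).subtype_mk _

/-- The surface measure is invariant under linear isometries. -/
theorem measurePreserving_sphereMap (L : E3 ≃ₗᵢ[ℝ] E3) :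
    MeasurePreserving (sphereMap L) surf surf := by
  refine ⟨(continuous_sphereMap L).measurable, ?_⟩
  ext s hs
  have hm := (continuous_sphereMap L).measurable
  rw [Measure.map_apply hm hs, surf, Measure.toSphere_apply' _ (hm hs),
    Measure.toSphere_apply' _ hs]
  congr 1
  -- The surface measure of a set is a multiple of the volume of the cone over it, and a linear
  -- isometry maps cones to cones and preserves volume.
  have hL : MeasurePreserving (L : E3 → E3) volume volume := L.measurePreserving
  refine Eq.trans ?_ (MeasurePreserving.measure_preimage_equiv
    (f := L.toHomeomorph.toMeasurableEquiv) hL _)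
  congr 1
  ext x
  simp only [Set.mem_smul, Set.mem_image, Set.mem_preimage]
  constructor
  · rintro ⟨r, hr, _, ⟨y, hy, rfl⟩, rfl⟩
    exact ⟨r, hr, _, ⟨_, hy, rfl⟩, (L.map_smul r y.1).symm⟩
  · rintro ⟨r, hr, _, ⟨y, hy, rfl⟩, hx⟩
    have hx : r • y.1 = L x := hx
    have e : sphereMap L (sphereMap L.symm y) = y := Subtype.ext (L.apply_symm_apply y.1)
    refine ⟨r, hr, _, ⟨sphereMap L.symm y, by rw [e]; exact hy, rfl⟩, ?_⟩
    apply L.injective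
    rw [L.map_smul]
    change r • L (L.symm y.1) = _
    rw [L.apply_symm_apply]
    exact hx

theorem integral_comp_rotation (i : Fin 3) (t : ℝ) (f : E3 → ℂ) (hf : Continuous f) :
    ∫ x : S2, f (rotFun i t x.1) ∂surf = ∫ x : S2, f x.1 ∂surf := by
  have h := measurePreserving_sphereMap (rotation i t)
  have hc : Continuous fun x : S2 => f x.1 := hf.comp continuous_subtype_val
  rw [← h.map_eq, integral_map h.measurable.aemeasurable hc.aestronglyMeasurable, h.map_eq]
  rfl

/-- The derivative along the field `e_i × x`. -/
def rotD (i : Fin 3) (ψ : E3 → ℂ) (x : E3) : ℂ := fderiv ℝ ψ x (rotField i x)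

theorem continuous_rotField (i : Fin 3) : Continuous (rotField i) := by
  unfold rotField
  fin_cases i <;> simp <;> fun_prop

theorem continuous_rotD (i : Fin 3) {ψ : E3 → ℂ} (hψ : ContDiff ℝ 1 ψ) :
    Continuous (rotD i ψ) :=
  (hψ.continuous_fderiv one_ne_zero).clm_apply (continuous_rotField i)

theorem hasDerivAt_comp_rotFun (i : Fin 3) {ψ : E3 → ℂ} (hψ : Differentiable ℝ ψ) (x : E3) (t : ℝ) :
    HasDerivAt (fun s => ψ (rotFun i s x)) (rotD i ψ (rotFun i t x)) t :=
  (hψ _).hasFDerivAt.comp_hasDerivAt t (hasDerivAt_rotFun i x t)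

theorem integrable_of_continuous {f : S2 → ℂ} (hf : Continuous f) : Integrable f surf := by
  rw [← integrableOn_univ]
  exact hf.continuousOn.integrableOn_compact isCompact_univ

theorem exists_bound_sphere {f : E3 → ℂ} (hf : Continuous f) : ∃ K, ∀ x : S2, ‖f x.1‖ ≤ K := by
  obtain ⟨K, hK⟩ := (isCompact_sphere (0 : E3) 1).exists_bound_of_continuousOn hf.continuousOn
  exact ⟨K, fun x => hK x.1 x.2⟩

/-- By rotation invariance `t ↦ ∫ ψ(R_t x)` is constant. Differentiating under the integral at `t =
0` produces the derivative along the field. -/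
theorem integral_rotD (i : Fin 3) {ψ : E3 → ℂ} (hψ : ContDiff ℝ 1 ψ) :
    ∫ x : S2, rotD i ψ x.1 ∂surf = 0 := by
  have hd := hψ.differentiable one_ne_zero
  obtain ⟨K, hK⟩ := exists_bound_sphere (continuous_rotD i hψ)
  have hrc : ∀ t, Continuous fun x : S2 => rotFun i t x.1 := fun t =>
    (rotation i t).continuous.comp continuous_subtype_val
  have h := (hasDerivAt_integral_of_dominated_loc_of_deriv_le (μ := surf)
    (F := fun (t : ℝ) (x : S2) => ψ (rotFun i t x.1)) (F' := fun t x => rotD i ψ (rotFun i t x.1))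
    (x₀ := (0 : ℝ)) (bound := fun _ => K) (s := Set.univ) Filter.univ_mem
    (Eventually.of_forall fun t => (hψ.continuous.comp (hrc t)).aestronglyMeasurable)
    (integrable_of_continuous (hψ.continuous.comp (hrc 0)))
    ((continuous_rotD i hψ).comp (hrc 0)).aestronglyMeasurable
    (Eventually.of_forall fun x t _ => hK (sphereMap (rotation i t) x))
    (integrable_const K)
    (Eventually.of_forall fun x t _ => hasDerivAt_comp_rotFun i hd x.1 t)).2
  have h2 : (fun t : ℝ => ∫ x : S2, ψ (rotFun i t x.1) ∂surf) =
      fun _ => ∫ x : S2, ψ x.1 ∂surf :=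
    funext fun t => integral_comp_rotation i t ψ hψ.continuous
  simp only [rotFun_zero] at h
  rw [h2] at h
  exact h.unique (hasDerivAt_const _ _)

theorem rotD_mul (i : Fin 3) {ψ χ : E3 → ℂ} (hψ : Differentiable ℝ ψ) (hχ : Differentiable ℝ χ)
    (x : E3) : rotD i (fun y => ψ y * χ y) x = ψ x * rotD i χ x + rotD i ψ x * χ x := by
  unfold rotD
  rw [fderiv_fun_mul (hψ x) (hχ x)]
  simp [mul_comm]

/-- Integration by parts on the sphere. -/
theorem integral_mul_rotD (i : Fin 3) {ψ χ : E3 → ℂ} (hψ : ContDiff ℝ 1 ψ) (hχ : ContDiff ℝ 1 χ) :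
    ∫ x : S2, ψ x.1 * rotD i χ x.1 ∂surf = -∫ x : S2, rotD i ψ x.1 * χ x.1 ∂surf := by
  have h := integral_rotD i (hψ.mul hχ)
  have hd := hψ.differentiable one_ne_zero
  have hd' := hχ.differentiable one_ne_zero
  simp_rw [rotD_mul i hd hd'] at h
  rw [integral_add] at h
  · exact eq_neg_of_add_eq_zero_left h
  · exact integrable_of_continuous ((hψ.continuous.mul (continuous_rotD i hχ)).comp
      continuous_subtype_val)
  · exact integrable_of_continuous (((continuous_rotD i hψ).mul hχ.continuous).comp
      continuous_subtype_val)

theorem surf_univ : surf.real Set.univ = 4 * Real.pi := by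
  rw [surf, Measure.toSphere_real_apply_univ, measureReal_def, EuclideanSpace.volume_ball_fin_three]
  have : 0 ≤ Real.pi * 4 / 3 := by positivity
  simp only [ENNReal.ofReal_one, one_pow, one_mul, ENNReal.toReal_ofReal this]
  simp
  ring

end Rotation

/-! ### Spherical harmonics as restricted polynomials, and their algebra -/

section Harmonics

open Polynomial (X C derivative)
open scoped ComplexConjugate

/-- The function `x₁ + i x₂`. -/
def zeta (x : E3) : ℂ := (x 0 : ℂ) + Complex.I * (x 1 : ℂ)

/-- The normalization constant of `Y_n^k`, `k ≥ 0`. -/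
def harmNorm (n k : ℕ) : ℝ :=
  Real.sqrt ((2 * n + 1) / (4 * Real.pi) * (((n - k)! : ℝ) / ((n + k)! : ℝ)))

/-- A polynomial on `ℝ³` that restricts to `(-1)^k Y_n^k`. -/
def solidNat (n k : ℕ) (x : E3) : ℂ :=
  (harmNorm n k : ℂ) * (zeta x ^ k * (((legendreDeriv n k).eval (x 2) : ℝ) : ℂ))

/-- A polynomial on `ℝ³` that restricts to `Y_n^m`. -/
def solid (n : ℕ) (m : ℤ) (x : E3) : ℂ :=
  if 0 ≤ m then (-1) ^ m.natAbs * solidNat n m.natAbs x else conj (solidNat n m.natAbs x)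

theorem solid_natCast (n k : ℕ) (x : E3) : solid n k x = (-1) ^ k * solidNat n k x := by
  simp [solid]

theorem solid_neg_natCast (n k : ℕ) (x : E3) : solid n (-k) x = conj (solidNat n k x) := by
  cases k with
  | zero => simp [solid, solidNat]
  | succ k =>
    have : ¬ (0 : ℤ) ≤ -((k + 1 : ℕ) : ℤ) := by omega
    rw [solid, if_neg this, Int.natAbs_neg, Int.natAbs_natCast]

theorem solidNat_eq_zero {n k : ℕ} (h : n < k) (x : E3) : solidNat n k x = 0 := by
  simp [solidNat, legendreDeriv_eq_zero h]

theorem solid_eq_zero {n : ℕ} {m : ℤ} (h : (n : ℤ) < |m|) (x : E3) : solid n m x = 0 := by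
  rw [Int.abs_eq_natAbs] at h
  have : n < m.natAbs := by omega
  simp [solid, solidNat_eq_zero this]

theorem sphere_sq (x : S2) : x.1 0 ^ 2 + x.1 1 ^ 2 + x.1 2 ^ 2 = 1 := by
  have h := mem_sphere_zero_iff_norm.1 x.2
  have h2 := EuclideanSpace.norm_sq_eq x.1
  rw [h, Fin.sum_univ_three] at h2
  simpa using h2.symm

theorem zeta_eq (x : S2) : zeta x.1 =
    (Real.sqrt (1 - x.1 2 ^ 2) : ℝ) * Complex.exp (Complex.I * (longitude x : ℝ)) := by
  have h := Complex.norm_mul_exp_arg_mul_I ⟨x.1 0, x.1 1⟩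
  have hn : ‖(⟨x.1 0, x.1 1⟩ : ℂ)‖ = Real.sqrt (1 - x.1 2 ^ 2) := by
    rw [Complex.norm_eq_sqrt_sq_add_sq]
    congr 1
    linarith [sphere_sq x]
  rw [hn] at h
  rw [longitude, mul_comm Complex.I, h, Complex.mk_eq_add_mul_I, zeta, mul_comm Complex.I]

theorem zeta_mul_conj (x : S2) : zeta x.1 * conj (zeta x.1) = ((1 - x.1 2 ^ 2 : ℝ) : ℂ) := by
  have h : (1 - x.1 2 ^ 2 : ℝ) = x.1 0 ^ 2 + x.1 1 ^ 2 := by linarith [sphere_sq x]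
  rw [h, zeta]
  simp only [map_add, map_mul, Complex.conj_ofReal, Complex.conj_I]
  push_cast
  linear_combination (-(x.1 1 : ℂ) ^ 2) * Complex.I_sq

theorem assocLegendreNat_mul_exp (n k : ℕ) (x : S2) :
    (assocLegendreNat n k (x.1 2) : ℂ) * Complex.exp (Complex.I * k * (longitude x : ℝ)) =
      (-1) ^ k * (zeta x.1 ^ k * (((legendreDeriv n k).eval (x.1 2) : ℝ) : ℂ)) := by
  rw [zeta_eq, mul_pow, ← Complex.exp_nat_mul, assocLegendreNat, legendreDeriv]
  push_cast
  rw [show (k : ℂ) * (Complex.I * (longitude x : ℂ)) = Complex.I * k * (longitude x : ℂ) by ring]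
  ring

theorem harmNorm_mul_factorial {n k : ℕ} :
    Real.sqrt ((2 * n + 1) / (4 * Real.pi) * (((n + k)! : ℝ) / ((n - k)! : ℝ))) *
      (((n - k)! : ℝ) / ((n + k)! : ℝ)) = harmNorm n k := by
  have h1 : (0 : ℝ) < (n - k)! := by positivity
  have h2 : (0 : ℝ) < (n + k)! := by positivity
  have h3 : (0 : ℝ) ≤ ((n - k)! : ℝ) / ((n + k)! : ℝ) := by positivity
  have hpi := Real.pi_pos
  rw [harmNorm]
  conv_lhs => rw [← Real.sqrt_sq h3]
  rw [← Real.sqrt_mul (by positivity)]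
  congr 1
  field_simp

/-- On the sphere `ζ = (1 - s²)^{1/2} e^{iφ}`, so the square root and the longitude combine into a
power of `ζ` or of its conjugate. This removes the discontinuous longitude and allows
differentiation in `ℝ³`. For negative `m` the factorials in `P_n^{-m}` turn the normalization into
that of `|m|`. -/
theorem sphHarmFun_eq_solid (n : ℕ) (m : ℤ) (x : S2) : sphHarmFun n m x = solid n m x.1 := by
  obtain ⟨k, rfl | rfl⟩ := m.eq_nat_or_neg
  · rw [solid_natCast, sphHarmFun, assocLegendre, if_pos (Int.natCast_nonneg k),
      Int.natAbs_natCast, mul_assoc, Int.cast_natCast, assocLegendreNat_mul_exp, solidNat, harmNorm,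
      Int.toNat_sub, ← Nat.cast_add, Int.toNat_natCast]
    ring
  · rcases Nat.eq_zero_or_pos k with rfl | hk
    · have := assocLegendreNat_mul_exp n 0 x
      simp only [Nat.cast_zero, mul_zero, zero_mul, pow_zero, one_mul, Complex.exp_zero] at this
      simp [solid, sphHarmFun, assocLegendre, solidNat, harmNorm]
      left
      rw [mul_one] at this
      exact_mod_cast this
    · have hneg : ¬ (0 : ℤ) ≤ -(k : ℤ) := by omega
      rw [solid_neg_natCast, sphHarmFun, assocLegendre, if_neg hneg, Int.natAbs_neg,
        Int.natAbs_natCast, sub_neg_eq_add, ← Nat.cast_add, Int.toNat_natCast, ← sub_eq_add_neg,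
        Int.toNat_sub, solidNat, ← harmNorm_mul_factorial]
      have h := congrArg conj (assocLegendreNat_mul_exp n k x)
      have e : conj (Complex.exp (Complex.I * k * (longitude x : ℝ))) =
          Complex.exp (Complex.I * ((-(k : ℤ) : ℤ) : ℂ) * (longitude x : ℝ)) := by
        rw [← Complex.exp_conj]
        congr 1
        simp
      rw [map_mul, e, Complex.conj_ofReal] at h
      have hsgn : ((-1 : ℂ) ^ k) * (-1) ^ k = 1 := by
        rw [← mul_pow]; simp
      simp only [map_mul, map_pow, map_neg, map_one, Complex.conj_ofReal] at h ⊢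
      set E := Complex.exp (Complex.I * ((-(k : ℤ) : ℤ) : ℂ) * (longitude x : ℝ))
      push_cast
      set S : ℂ := ((Real.sqrt ((2 * n + 1) / (4 * Real.pi) * (((n + k)! : ℝ) / ((n - k)! : ℝ))) : ℝ) : ℂ)
      linear_combination (S * (-1) ^ k * (((n - k)! : ℂ) / ((n + k)! : ℂ))) * h +
        S * (((n - k)! : ℂ) / ((n + k)! : ℂ)) * (conj (zeta x.1) ^ k *
          (((legendreDeriv n k).eval (x.1 2) : ℝ) : ℂ)) * hsgn

/-! ### The constants -/

/-- `α_n^m = ((n² - m²) / (4n² - 1))^{1/2}`. -/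
def alpha (n : ℕ) (m : ℤ) : ℝ := Real.sqrt (((n : ℝ) ^ 2 - (m : ℝ) ^ 2) / (4 * (n : ℝ) ^ 2 - 1))

/-- `κ_n^m = ((n - m)(n + m + 1))^{1/2}`. -/
def kappa (n : ℕ) (m : ℤ) : ℝ := Real.sqrt (((n : ℝ) - m) * (n + m + 1))

theorem alpha_nonneg (n : ℕ) (m : ℤ) : 0 ≤ alpha n m := Real.sqrt_nonneg _

theorem kappa_nonneg (n : ℕ) (m : ℤ) : 0 ≤ kappa n m := Real.sqrt_nonneg _

theorem harmNorm_pos (n k : ℕ) : 0 < harmNorm n k := by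
  have := Real.pi_pos
  unfold harmNorm
  positivity

theorem kappa_sq {n k : ℕ} (h : k ≤ n) : kappa n k ^ 2 = (n : ℝ) * (n + 1) - k * (k + 1) := by
  have h' : (k : ℝ) ≤ n := by exact_mod_cast h
  rw [kappa, Real.sq_sqrt]
  · push_cast; ring
  · push_cast
    have : (0 : ℝ) ≤ (n : ℝ) - k := by linarith
    positivity

/-- The symmetry behind conjugation of harmonics: raising from `m` mirrors lowering from `-m`. -/
theorem kappa_neg (n : ℕ) (m : ℤ) : kappa n (-m - 1) = kappa n m := by
  unfold kappa
  congr 1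
  push_cast
  ring

theorem kappa_self (n : ℕ) : kappa n n = 0 := by
  simp [kappa]

theorem harmNorm_eq_kappa_mul {n k : ℕ} (h : k < n) :
    harmNorm n k = kappa n k * harmNorm n (k + 1) := by
  obtain ⟨j, rfl⟩ := Nat.exists_eq_add_of_lt h
  have hpi := Real.pi_pos
  rw [harmNorm, harmNorm, kappa, ← Real.sqrt_mul]
  · congr 1
    rw [show k + j + 1 - k = j + 1 by omega, show k + j + 1 - (k + 1) = j by omega,
      show k + j + 1 + (k + 1) = (k + j + 1 + k) + 1 by omega, Nat.factorial_succ,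
      Nat.factorial_succ (k + j + 1 + k)]
    have h2 : (0 : ℝ) < (k + j + 1 + k)! := by positivity
    have h3 : (0 : ℝ) < (k : ℝ) + j + 1 + k + 1 := by positivity
    push_cast
    field_simp
    ring
  · push_cast
    have : (k : ℝ) + j + 1 - k = j + 1 := by ring
    rw [this]
    positivity

/-- With `harmNorm_mul_add`, this converts the rational coefficients of the Legendre recurrence into
the symmetric coefficients `alpha` of the normalized harmonics. Both sides are nonnegative, so their
squares are compared. -/
theorem harmNorm_mul_sub {n k : ℕ} (h : k ≤ n) :
    harmNorm n k * ((n : ℝ) + 1 - k) = (2 * n + 1) * (alpha (n + 1) k * harmNorm (n + 1) k) := by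
  obtain ⟨j, rfl⟩ := Nat.exists_eq_add_of_le h
  have hpi := Real.pi_pos
  have h1 : (0 : ℝ) ≤ ((k + j : ℕ) : ℝ) + 1 - k := by push_cast; linarith [(j.cast_nonneg : (0:ℝ) ≤ j)]
  have e1 : ((((k + j + 1 : ℕ) : ℝ)) ^ 2 - (((k : ℕ) : ℤ) : ℝ) ^ 2) = (j + 1) * (2 * k + j + 1) := by
    push_cast; ring
  have e2 : (4 * (((k + j + 1 : ℕ) : ℝ)) ^ 2 - 1) = (2 * (k + j) + 1) * (2 * (k + j) + 3) := by
    push_cast; ring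
  rw [← sq_eq_sq₀ (mul_nonneg (harmNorm_pos _ _).le h1)
    (mul_nonneg (by positivity) (mul_nonneg (alpha_nonneg _ _) (harmNorm_pos _ _).le)),
    mul_pow, mul_pow, mul_pow, alpha, e1, e2, harmNorm, harmNorm, Real.sq_sqrt (by positivity),
    Real.sq_sqrt (by positivity), Real.sq_sqrt (by positivity),
    show k + j - k = j by omega, show k + j + 1 - k = j + 1 by omega,
    show k + j + 1 + k = k + j + k + 1 by omega, Nat.factorial_succ, Nat.factorial_succ (k + j + k)]
  have h2 : (0 : ℝ) < (k + j + k)! := by positivity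
  have h4 : (0 : ℝ) < (k + j + k : ℝ) + 1 := by positivity
  push_cast
  field_simp
  ring

theorem harmNorm_mul_add {n k : ℕ} (h : k ≤ n) :
    harmNorm (n + 1) k * ((n : ℝ) + 1 + k) = (2 * n + 3) * (alpha (n + 1) k * harmNorm n k) := by
  obtain ⟨j, rfl⟩ := Nat.exists_eq_add_of_le h
  have hpi := Real.pi_pos
  have e1 : ((((k + j + 1 : ℕ) : ℝ)) ^ 2 - (((k : ℕ) : ℤ) : ℝ) ^ 2) = (j + 1) * (2 * k + j + 1) := by
    push_cast; ring
  have e2 : (4 * (((k + j + 1 : ℕ) : ℝ)) ^ 2 - 1) = (2 * (k + j) + 1) * (2 * (k + j) + 3) := by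
    push_cast; ring
  rw [← sq_eq_sq₀ (mul_nonneg (harmNorm_pos _ _).le (by positivity))
    (mul_nonneg (by positivity) (mul_nonneg (alpha_nonneg _ _) (harmNorm_pos _ _).le)),
    mul_pow, mul_pow, mul_pow, alpha, e1, e2, harmNorm, harmNorm, Real.sq_sqrt (by positivity),
    Real.sq_sqrt (by positivity), Real.sq_sqrt (by positivity),
    show k + j - k = j by omega, show k + j + 1 - k = j + 1 by omega,
    show k + j + 1 + k = k + j + k + 1 by omega, Nat.factorial_succ, Nat.factorial_succ (k + j + k)]
  have h2 : (0 : ℝ) < (k + j + k)! := by positivity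
  have h4 : (0 : ℝ) < (k + j + k : ℝ) + 1 := by positivity
  push_cast
  field_simp
  ring

/-! ### Multiplication by the third coordinate -/

/-- The normalized form of `legendreDeriv_recurrence`. Beyond the diagonal the harmonics vanish; at
`k = n + 2` the surviving harmonic on the right is killed by `alpha (n + 2) (n + 2) = 0`. -/
theorem mul_solidNat_succ (n k : ℕ) (x : E3) :
    (x 2 : ℂ) * solidNat (n + 1) k x =
      alpha (n + 2) k * solidNat (n + 2) k x + alpha (n + 1) k * solidNat n k x := by
  rcases lt_trichotomy (n + 1) k with hk | rfl | hk
  · rw [solidNat_eq_zero hk, solidNat_eq_zero (show n < k by omega)]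
    rcases eq_or_lt_of_le (show n + 2 ≤ k by omega) with rfl | hk'
    · simp [alpha]
    · rw [solidNat_eq_zero hk']
      simp
  · have hr := congrArg (fun p => (Polynomial.eval (x 2) p : ℝ)) (legendreDeriv_recurrence n (n + 1))
    rw [legendreDeriv_eq_zero (show n < n + 1 by omega)] at hr
    have h1 := harmNorm_mul_sub (le_refl (n + 1))
    rw [solidNat_eq_zero (show n < n + 1 by omega)]
    simp only [Polynomial.eval_mul, Polynomial.eval_C, Polynomial.eval_X,
      mul_zero, sub_zero] at hr
    have hr' := congrArg (fun r : ℝ => (r : ℂ)) hr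
    have h1' := congrArg (fun r : ℝ => (r : ℂ)) h1
    push_cast at hr' h1'
    have hne : (2 * (n : ℂ) + 3) ≠ 0 := by exact_mod_cast (show 2 * n + 3 ≠ 0 by omega)
    refine mul_left_cancel₀ hne ?_
    rw [mul_zero, add_zero, solidNat, solidNat]
    push_cast
    set p := (((legendreDeriv (n + 2) (n + 1)).eval (x 2) : ℝ) : ℂ)
    linear_combination (-(harmNorm (n + 1) (n + 1) : ℂ) * zeta x ^ (n + 1)) * hr' +
      (zeta x ^ (n + 1) * p) * h1'
  · have hr := congrArg (fun p => (Polynomial.eval (x 2) p : ℝ)) (legendreDeriv_recurrence n k)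
    have h1 := harmNorm_mul_sub (show k ≤ n + 1 by omega)
    have h2 := harmNorm_mul_add (show k ≤ n by omega)
    simp only [Polynomial.eval_mul, Polynomial.eval_sub, Polynomial.eval_C, Polynomial.eval_X] at hr
    have hr' := congrArg (fun r : ℝ => (r : ℂ)) hr
    have h1' := congrArg (fun r : ℝ => (r : ℂ)) h1
    have h2' := congrArg (fun r : ℝ => (r : ℂ)) h2
    push_cast at hr' h1' h2'
    have hne : (2 * (n : ℂ) + 3) ≠ 0 := by exact_mod_cast (show 2 * n + 3 ≠ 0 by omega)
    refine mul_left_cancel₀ hne ?_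
    rw [solidNat, solidNat, solidNat]
    set p := (((legendreDeriv (n + 2) k).eval (x 2) : ℝ) : ℂ)
    set q := (((legendreDeriv n k).eval (x 2) : ℝ) : ℂ)
    linear_combination (-(harmNorm (n + 1) k : ℂ) * zeta x ^ k) * hr' +
      (zeta x ^ k * p) * h1' + (zeta x ^ k * q) * h2'

theorem mul_solidNat_zero (k : ℕ) (x : E3) :
    (x 2 : ℂ) * solidNat 0 k x = alpha 1 k * solidNat 1 k x := by
  rcases Nat.eq_zero_or_pos k with rfl | hk
  · have h1 := harmNorm_mul_sub (le_refl 0)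
    have h1' := congrArg (fun r : ℝ => (r : ℂ)) h1
    push_cast at h1'
    simp only [zero_add, sub_zero, mul_one, mul_zero, one_mul] at h1'
    rw [solidNat, solidNat, h1', legendre_zero, legendre_one]
    simp
    ring
  · rw [solidNat_eq_zero hk]
    rcases eq_or_lt_of_le (show 1 ≤ k from hk) with rfl | hk'
    · simp [alpha]
    · rw [solidNat_eq_zero hk']
      simp

/-- Truncated subtraction at `n = 0` is harmless: `alpha 0 0 = 0`, and for `k > 0` the harmonic of
degree zero vanishes. -/
theorem mul_solidNat (n k : ℕ) (x : E3) :
    (x 2 : ℂ) * solidNat n k x =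
      alpha (n + 1) k * solidNat (n + 1) k x + alpha n k * solidNat (n - 1) k x := by
  cases n with
  | zero =>
    rw [mul_solidNat_zero]
    rcases Nat.eq_zero_or_pos k with rfl | hk
    · simp [alpha]
    · rw [solidNat_eq_zero (n := 0 - 1) (by omega)]
      simp
  | succ n => exact mul_solidNat_succ n k x

theorem alpha_neg (n : ℕ) (m : ℤ) : alpha n (-m) = alpha n m := by
  simp [alpha]

/-- `cos θ Y_n^m = α_{n+1}^m Y_{n+1}^m + α_n^m Y_{n-1}^m`. -/
theorem mul_solid (n : ℕ) (m : ℤ) (x : E3) :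
    (x 2 : ℂ) * solid n m x =
      alpha (n + 1) m * solid (n + 1) m x + alpha n m * solid (n - 1) m x := by
  obtain ⟨k, rfl | rfl⟩ := m.eq_nat_or_neg
  · simp only [solid_natCast]
    linear_combination (-1 : ℂ) ^ k * mul_solidNat n k x
  · simp only [solid_neg_natCast, alpha_neg]
    have h := congrArg conj (mul_solidNat n k x)
    simpa only [map_mul, map_add, Complex.conj_ofReal] using h

/-! ### The ladder operators -/

theorem hasDerivAt_rotFun_apply (i j : Fin 3) (x : E3) :
    HasDerivAt (fun s => ((rotFun i s x) j : ℂ)) ((rotField i x) j : ℂ) 0 := by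
  have h := hasDerivAt_rotFun i x 0
  rw [hasDerivAt_iff_hasFDerivAt, ← hasFDerivWithinAt_univ, hasFDerivWithinAt_euclidean] at h
  have h2 := h j
  rw [hasFDerivWithinAt_univ, hasFDerivAt_iff_hasDerivAt] at h2
  simp only [rotFun_zero] at h2
  simpa using h2.ofReal_comp

theorem contDiff_coord (j : Fin 3) {n : WithTop ℕ∞} : ContDiff ℝ n fun x : E3 => (x j : ℂ) :=
  Complex.ofRealCLM.contDiff.comp (contDiff_euclidean.1 contDiff_id j)

theorem contDiff_zeta {n : WithTop ℕ∞} : ContDiff ℝ n zeta :=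
  (contDiff_coord 0).add (contDiff_const.mul (contDiff_coord 1))

theorem contDiff_eval (p : Polynomial ℝ) {n : WithTop ℕ∞} :
    ContDiff ℝ n fun x : E3 => ((p.eval (x 2) : ℝ) : ℂ) :=
  Complex.ofRealCLM.contDiff.comp ((by simpa using p.contDiff_aeval (𝕜 := ℝ) n :
    ContDiff ℝ n fun s : ℝ => p.eval s).comp (contDiff_euclidean.1 contDiff_id 2))

theorem contDiff_solidNat (n k : ℕ) {r : WithTop ℕ∞} : ContDiff ℝ r (solidNat n k) :=
  contDiff_const.mul ((contDiff_zeta.pow k).mul (contDiff_eval _))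

theorem contDiff_conj {r : WithTop ℕ∞} {ψ : E3 → ℂ} (h : ContDiff ℝ r ψ) :
    ContDiff ℝ r fun x => conj (ψ x) :=
  Complex.conjCLE.contDiff.comp h

theorem contDiff_solid (n : ℕ) (m : ℤ) {r : WithTop ℕ∞} : ContDiff ℝ r (solid n m) := by
  unfold solid
  split_ifs
  · exact contDiff_const.mul (contDiff_solidNat _ _)
  · exact contDiff_conj (contDiff_solidNat _ _)

theorem rotD_const_mul (i : Fin 3) (c : ℂ) {ψ : E3 → ℂ} (h : Differentiable ℝ ψ) (x : E3) :
    rotD i (fun y => c * ψ y) x = c * rotD i ψ x := by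
  unfold rotD
  rw [fderiv_const_mul (h x)]
  rfl

theorem rotD_conj (i : Fin 3) {ψ : E3 → ℂ} (h : Differentiable ℝ ψ) (x : E3) :
    rotD i (fun y => conj (ψ y)) x = conj (rotD i ψ x) := by
  have := (Complex.conjCLE.hasFDerivAt.comp x (h x).hasFDerivAt).fderiv
  unfold rotD
  erw [this]
  rfl

/-- Computed by differentiating along the rotation through `x`, where each factor is a function of
one real variable. -/
theorem rotD_zeta_pow_mul (i : Fin 3) (k : ℕ) (p : Polynomial ℝ) (x : E3) :
    rotD i (fun y => zeta y ^ k * ((p.eval (y 2) : ℝ) : ℂ)) x =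
      k * zeta x ^ (k - 1) * zeta (rotField i x) * ((p.eval (x 2) : ℝ) : ℂ) +
        zeta x ^ k * (((derivative p).eval (x 2) : ℝ) * (rotField i x 2 : ℝ)) := by
  have hd : Differentiable ℝ fun y : E3 => zeta y ^ k * ((p.eval (y 2) : ℝ) : ℂ) :=
    ((contDiff_zeta (n := 1).pow k).mul (contDiff_eval p)).differentiable one_ne_zero
  have h1 := hasDerivAt_comp_rotFun i hd x 0
  rw [rotFun_zero] at h1
  have h0 := hasDerivAt_rotFun_apply i 0 x
  have h2 := hasDerivAt_rotFun_apply i 1 x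
  have h3 : HasDerivAt (fun s => (((p.eval (rotFun i s x 2) : ℝ)) : ℂ))
      ((((derivative p).eval (x 2) * rotField i x 2 : ℝ)) : ℂ) 0 := by
    have h := hasDerivAt_rotFun i x 0
    rw [hasDerivAt_iff_hasFDerivAt, ← hasFDerivWithinAt_univ, hasFDerivWithinAt_euclidean] at h
    have h2 := h 2
    rw [hasFDerivWithinAt_univ, hasFDerivAt_iff_hasDerivAt] at h2
    have h3 := ((p.hasDerivAt (rotFun i 0 x 2)).comp 0 h2).ofReal_comp
    simpa [rotFun_zero] using h3
  have hz : HasDerivAt (fun s => zeta (rotFun i s x)) (zeta (rotField i x)) 0 :=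
    h0.add (h2.const_mul Complex.I)
  have h4 := (hz.pow k).mul h3
  refine (h1.unique h4).trans ?_
  simp only [rotFun_zero, Pi.pow_apply]
  push_cast
  ring

theorem rotD_solidNat_two (n k : ℕ) (x : E3) :
    rotD 2 (solidNat n k) x = Complex.I * k * solidNat n k x := by
  unfold solidNat
  rw [rotD_const_mul _ _ (((contDiff_zeta (n := 1).pow k).mul (contDiff_eval _)).differentiable
    one_ne_zero), rotD_zeta_pow_mul]
  have e1 : zeta (rotField 2 x) = Complex.I * zeta x := by
    simp [rotField, zeta]
    linear_combination (-(x 1 : ℂ)) * Complex.I_sq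
  have e2 : rotField 2 x 2 = 0 := by simp [rotField]
  rw [e1, e2]
  cases k with
  | zero => simp
  | succ k =>
    rw [Nat.add_sub_cancel]
    push_cast
    ring

/-- The combination annihilates `ζ`, so it acts only on the polynomial in `x₃` and raises the order
of the Legendre derivative. The identity holds on all of `ℝ³`. -/
theorem rotD_solidNat_add (n k : ℕ) (x : E3) :
    rotD 0 (solidNat n k) x + Complex.I * rotD 1 (solidNat n k) x =
      -Complex.I * kappa n k * solidNat n (k + 1) x := by
  unfold solidNat
  have hd : Differentiable ℝ fun y : E3 =>
      zeta y ^ k * (((legendreDeriv n k).eval (y 2) : ℝ) : ℂ) :=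
    ((contDiff_zeta (n := 1).pow k).mul (contDiff_eval _)).differentiable one_ne_zero
  rw [rotD_const_mul _ _ hd, rotD_const_mul _ _ hd, rotD_zeta_pow_mul, rotD_zeta_pow_mul,
    derivative_legendreDeriv]
  have e1 : zeta (rotField 0 x) = -Complex.I * x 2 := by simp [rotField, zeta]
  have e2 : zeta (rotField 1 x) = x 2 := by simp [rotField, zeta]
  have e3 : rotField 0 x 2 = x 1 := by simp [rotField]
  have e4 : rotField 1 x 2 = -x 0 := by simp [rotField]
  have e5 : (x 1 : ℂ) - Complex.I * x 0 = -Complex.I * zeta x := by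
    rw [zeta]
    linear_combination (x 1 : ℂ) * Complex.I_sq
  rw [e1, e2, e3, e4]
  rcases lt_or_ge k n with hk | hk
  · rw [harmNorm_eq_kappa_mul hk]
    push_cast
    linear_combination (kappa n k * harmNorm n (k + 1) * zeta x ^ k *
      (((legendreDeriv n (k + 1)).eval (x 2) : ℝ) : ℂ)) * e5
  · rw [legendreDeriv_eq_zero (show n < k + 1 by omega)]
    simp
    ring

/-- Lowering produces `|ζ|²`. Only on the sphere can it be replaced by `1 - s²`, after which
Legendre's equation, differentiated `k` times, closes the computation. -/
theorem rotD_solidNat_sub (n k : ℕ) (x : S2) :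
    rotD 0 (solidNat n (k + 1)) x.1 - Complex.I * rotD 1 (solidNat n (k + 1)) x.1 =
      -Complex.I * kappa n k * solidNat n k x.1 := by
  rcases lt_or_ge k n with hk | hk
  · unfold solidNat
    have hd : Differentiable ℝ fun y : E3 =>
        zeta y ^ (k + 1) * (((legendreDeriv n (k + 1)).eval (y 2) : ℝ) : ℂ) :=
      ((contDiff_zeta (n := 1).pow (k + 1)).mul (contDiff_eval _)).differentiable one_ne_zero
    rw [rotD_const_mul _ _ hd, rotD_const_mul _ _ hd, rotD_zeta_pow_mul, rotD_zeta_pow_mul,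
      derivative_legendreDeriv, Nat.add_sub_cancel]
    have e1 : zeta (rotField 0 x.1) = -Complex.I * x.1 2 := by simp [rotField, zeta]
    have e2 : zeta (rotField 1 x.1) = x.1 2 := by simp [rotField, zeta]
    have e3 : rotField 0 x.1 2 = x.1 1 := by simp [rotField]
    have e4 : rotField 1 x.1 2 = -x.1 0 := by simp [rotField]
    have e5 : (x.1 1 : ℂ) + Complex.I * x.1 0 = Complex.I * conj (zeta x.1) := by
      rw [zeta]
      simp only [map_add, map_mul, Complex.conj_ofReal, Complex.conj_I]
      linear_combination (x.1 1 : ℂ) * Complex.I_sq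
    have e6 := zeta_mul_conj x
    have hode := congrArg (fun p => (Polynomial.eval (x.1 2) p : ℝ)) (legendre_ode n k)
    simp only [Polynomial.eval_mul, Polynomial.eval_sub, Polynomial.eval_C, Polynomial.eval_X,
      Polynomial.eval_zero, Polynomial.eval_add, Polynomial.eval_one, Polynomial.eval_pow] at hode
    rw [← kappa_sq hk.le] at hode
    have hode' := congrArg (fun r : ℝ => (r : ℂ)) hode
    rw [e1, e2, e3, e4, harmNorm_eq_kappa_mul hk]
    push_cast at hode' e6 ⊢
    set p2 := (((legendreDeriv n (k + 2)).eval (x.1 2) : ℝ) : ℂ)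
    linear_combination ((harmNorm n (k + 1)) * zeta x.1 ^ (k + 1) * p2) * e5 +
      ((harmNorm n (k + 1)) * zeta x.1 ^ k * p2 * Complex.I) * e6 +
      ((harmNorm n (k + 1)) * zeta x.1 ^ k * Complex.I) * hode'
  · have h0 : solidNat n (k + 1) = fun _ => 0 := funext fun y =>
      solidNat_eq_zero (show n < k + 1 by omega) y
    rw [h0]
    rcases eq_or_lt_of_le hk with rfl | hk'
    · simp [rotD, kappa_self]
    · simp [rotD, solidNat_eq_zero hk']

theorem solid_natCast_fun (n k : ℕ) : solid n k = fun x => (-1) ^ k * solidNat n k x :=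
  funext fun x => solid_natCast n k x

theorem solid_neg_natCast_fun (n k : ℕ) : solid n (-k) = fun x => conj (solidNat n k x) :=
  funext fun x => solid_neg_natCast n k x

theorem differentiable_solidNat (n k : ℕ) : Differentiable ℝ (solidNat n k) :=
  (contDiff_solidNat n k (r := 1)).differentiable one_ne_zero

/-- `∂_φ Y_n^m = i m Y_n^m`. -/
theorem rotD_solid_two (n : ℕ) (m : ℤ) (x : E3) :
    rotD 2 (solid n m) x = Complex.I * m * solid n m x := by
  obtain ⟨k, rfl | rfl⟩ := m.eq_nat_or_neg
  · rw [solid_natCast_fun, rotD_const_mul _ _ (differentiable_solidNat n k), rotD_solidNat_two]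
    push_cast
    ring
  · rw [solid_neg_natCast_fun, rotD_conj _ (differentiable_solidNat n k), rotD_solidNat_two]
    simp

/-- The raising operator. -/
theorem rotD_solid_add (n : ℕ) (m : ℤ) (x : S2) :
    rotD 0 (solid n m) x.1 + Complex.I * rotD 1 (solid n m) x.1 =
      Complex.I * kappa n m * solid n (m + 1) x.1 := by
  rcases le_or_gt 0 m with hm | hm
  · lift m to ℕ using hm with k
    rw [show (k : ℤ) + 1 = (k + 1 : ℕ) by push_cast; rfl, solid_natCast_fun, solid_natCast,
      rotD_const_mul _ _ (differentiable_solidNat n k),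
      rotD_const_mul _ _ (differentiable_solidNat n k)]
    linear_combination (-1) ^ k * rotD_solidNat_add n k x.1
  · obtain ⟨k, rfl⟩ : ∃ k : ℕ, m = -((k + 1 : ℕ) : ℤ) := ⟨(-m - 1).toNat, by omega⟩
    have e : -((k + 1 : ℕ) : ℤ) + 1 = -(k : ℤ) := by push_cast; ring
    have e2 : kappa n (-((k + 1 : ℕ) : ℤ)) = kappa n k := by
      rw [← kappa_neg]; congr 1; push_cast; ring
    rw [e, e2, solid_neg_natCast_fun, solid_neg_natCast,
      rotD_conj _ (differentiable_solidNat n (k + 1)),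
      rotD_conj _ (differentiable_solidNat n (k + 1))]
    have h := congrArg conj (rotD_solidNat_sub n k x)
    simp only [map_sub, map_mul, map_neg, Complex.conj_I, Complex.conj_ofReal] at h
    linear_combination h

/-- The lowering operator. -/
theorem rotD_solid_sub (n : ℕ) (m : ℤ) (x : S2) :
    rotD 0 (solid n m) x.1 - Complex.I * rotD 1 (solid n m) x.1 =
      Complex.I * kappa n (m - 1) * solid n (m - 1) x.1 := by
  rcases le_or_gt m 0 with hm | hm
  · obtain ⟨k, rfl⟩ : ∃ k : ℕ, m = -(k : ℤ) := ⟨(-m).toNat, by omega⟩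
    have e : -(k : ℤ) - 1 = -((k + 1 : ℕ) : ℤ) := by push_cast; ring
    rw [kappa_neg, e, solid_neg_natCast_fun, solid_neg_natCast,
      rotD_conj _ (differentiable_solidNat n k), rotD_conj _ (differentiable_solidNat n k)]
    have h := congrArg conj (rotD_solidNat_add n k x.1)
    simp only [map_add, map_mul, map_neg, Complex.conj_I, Complex.conj_ofReal] at h
    linear_combination h
  · obtain ⟨k, rfl⟩ : ∃ k : ℕ, m = ((k + 1 : ℕ) : ℤ) := ⟨(m - 1).toNat, by omega⟩
    have e : ((k + 1 : ℕ) : ℤ) - 1 = (k : ℤ) := by push_cast; ring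
    rw [e, solid_natCast_fun, solid_natCast, rotD_const_mul _ _ (differentiable_solidNat n (k + 1)),
      rotD_const_mul _ _ (differentiable_solidNat n (k + 1))]
    linear_combination (-1) ^ (k + 1) * rotD_solidNat_sub n k x

end Harmonics

/-! ### Coefficients, weak derivatives of harmonics, and orthonormality -/

section Coefficients

open scoped ComplexConjugate ContDiff

theorem continuous_solid (n : ℕ) (m : ℤ) : Continuous (solid n m) :=
  (contDiff_solid n m (r := 0)).continuous

theorem coeFn_sphHarm (n : ℕ) (m : ℤ) : sphHarm n m =ᵐ[surf] fun x => solid n m x.1 := by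
  refine (memLp_sphHarmFun n m).coeFn_toLp.trans (Eventually.of_forall fun x => ?_)
  exact sphHarmFun_eq_solid n m x

theorem sphHarm_eq_zero {n : ℕ} {m : ℤ} (h : (n : ℤ) < |m|) : sphHarm n m = 0 := by
  refine Lp.ext ((coeFn_sphHarm n m).trans ?_)
  have h0 : (fun x : S2 => solid n m x.1) = 0 := funext fun x => solid_eq_zero h x.1
  rw [h0]
  exact (Lp.coeFn_zero ℂ 2 surf).symm

theorem integrable_LTwo (u : LTwo) : Integrable u surf :=
  (Lp.memLp u).integrable one_le_two

theorem integrable_LTwo_mul (u : LTwo) {f : E3 → ℂ} (hf : Continuous f) :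
    Integrable (fun x : S2 => u x * f x.1) surf := by
  obtain ⟨K, hK⟩ := exists_bound_sphere hf
  exact (integrable_LTwo u).mul_bdd (hf.comp continuous_subtype_val).aestronglyMeasurable
    (Eventually.of_forall hK)

theorem integrable_LTwo_mul_conj (u : LTwo) {f : E3 → ℂ} (hf : Continuous f) :
    Integrable (fun x : S2 => u x * conj (f x.1)) surf :=
  integrable_LTwo_mul u (Complex.continuous_conj.comp hf)

theorem coeff_eq_integral (u : LTwo) (n : ℕ) (m : ℤ) :
    coeff u n m = ∫ x : S2, u x * conj (solid n m x.1) ∂surf := by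
  rw [coeff, L2.inner_def]
  refine integral_congr_ae ?_
  filter_upwards [coeFn_sphHarm n m] with x hx
  rw [hx]
  rfl

theorem coeff_add (u v : LTwo) (n : ℕ) (m : ℤ) : coeff (u + v) n m = coeff u n m + coeff v n m :=
  inner_add_right _ _ _

theorem coeff_sub (u v : LTwo) (n : ℕ) (m : ℤ) : coeff (u - v) n m = coeff u n m - coeff v n m :=
  inner_sub_right _ _ _

theorem coeff_smul (c : ℂ) (u : LTwo) (n : ℕ) (m : ℤ) : coeff (c • u) n m = c * coeff u n m :=
  inner_smul_right _ _ _

theorem coeff_zero (n : ℕ) (m : ℤ) : coeff 0 n m = 0 := inner_zero_right _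

theorem coeff_sum {ι : Type*} (s : Finset ι) (f : ι → LTwo) (n : ℕ) (m : ℤ) :
    coeff (∑ i ∈ s, f i) n m = ∑ i ∈ s, coeff (f i) n m :=
  inner_sum _ _ _

theorem coeff_eq_zero (u : LTwo) {n : ℕ} {m : ℤ} (h : (n : ℤ) < |m|) : coeff u n m = 0 := by
  rw [coeff, sphHarm_eq_zero h, inner_zero_left]

theorem continuous_coeff (n : ℕ) (m : ℤ) : Continuous fun u : LTwo => coeff u n m :=
  continuous_const.inner continuous_id

/-! ### Weak derivatives -/

theorem IsWeakRotDeriv.coeff_conj_rotD {i : Fin 3} {u v : LTwo} (h : IsWeakRotDeriv i u v) (n : ℕ)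
    (m : ℤ) : ∫ x : S2, u x * conj (rotD i (solid n m) x.1) ∂surf = -coeff v n m := by
  have h1 := h (fun x => conj (solid n m x)) (contDiff_conj (contDiff_solid n m))
  rw [coeff_eq_integral, ← h1]
  refine integral_congr_ae (Eventually.of_forall fun x => ?_)
  change _ = u x * rotD i (fun x => conj (solid n m x)) x.1
  rw [rotD_conj i ((contDiff_solid n m (r := 1)).differentiable one_ne_zero)]

theorem continuous_rotD_solid (i : Fin 3) (n : ℕ) (m : ℤ) : Continuous (rotD i (solid n m)) :=
  continuous_rotD i (contDiff_solid n m)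

theorem coeff_of_isWeakRotDeriv_two {u v : LTwo} (h : IsWeakRotDeriv 2 u v) (n : ℕ) (m : ℤ) :
    coeff v n m = Complex.I * m * coeff u n m := by
  have h1 := h.coeff_conj_rotD n m
  rw [← neg_eq_iff_eq_neg] at h1
  rw [← h1, coeff_eq_integral, ← integral_const_mul, ← integral_neg]
  refine integral_congr_ae (Eventually.of_forall fun x => ?_)
  simp only [rotD_solid_two, map_mul, Complex.conj_I, map_intCast]
  ring

theorem coeff_sub_of_isWeakRotDeriv {u v w : LTwo} (hv : IsWeakRotDeriv 0 u v)
    (hw : IsWeakRotDeriv 1 u w) (n : ℕ) (m : ℤ) :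
    coeff v n m - Complex.I * coeff w n m = Complex.I * kappa n m * coeff u n (m + 1) := by
  have h1 := hv.coeff_conj_rotD n m
  have h2 := hw.coeff_conj_rotD n m
  rw [← neg_eq_iff_eq_neg] at h1 h2
  have i1 := integrable_LTwo_mul_conj u (continuous_rotD_solid 0 n m)
  have i2 := integrable_LTwo_mul_conj u (continuous_rotD_solid 1 n m)
  rw [← h1, ← h2, coeff_eq_integral, ← integral_const_mul, mul_neg, sub_neg_eq_add,
    neg_add_eq_sub, ← integral_const_mul, ← integral_sub (i2.const_mul _) i1]
  refine integral_congr_ae (Eventually.of_forall fun x => ?_)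
  have h := congrArg conj (rotD_solid_add n m x)
  simp only [map_add, map_mul, Complex.conj_I, Complex.conj_ofReal] at h
  linear_combination (-u x) * h

/-- The image of `Y_n^m` under the derivative along the `i`-th rotation field. -/
def rotHarm (i : Fin 3) (n : ℕ) (m : ℤ) : LTwo :=
  ![(Complex.I / 2 * kappa n m) • sphHarm n (m + 1) +
      (Complex.I / 2 * kappa n (m - 1)) • sphHarm n (m - 1),
    ((1 : ℂ) / 2 * kappa n m) • sphHarm n (m + 1) -
      ((1 : ℂ) / 2 * kappa n (m - 1)) • sphHarm n (m - 1),
    (Complex.I * m) • sphHarm n m] i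

theorem coeFn_smul_sphHarm (c : ℂ) (n : ℕ) (m : ℤ) :
    (c • sphHarm n m : LTwo) =ᵐ[surf] fun x => c * solid n m x.1 := by
  filter_upwards [Lp.coeFn_smul c (sphHarm n m), coeFn_sphHarm n m] with x h1 h2
  rw [h1, Pi.smul_apply, h2, smul_eq_mul]

theorem coeFn_rotHarm (i : Fin 3) (n : ℕ) (m : ℤ) :
    rotHarm i n m =ᵐ[surf] fun x => rotD i (solid n m) x.1 := by
  fin_cases i
  · filter_upwards [Lp.coeFn_add ((Complex.I / 2 * kappa n m) • sphHarm n (m + 1))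
      ((Complex.I / 2 * kappa n (m - 1)) • sphHarm n (m - 1)),
      coeFn_smul_sphHarm (Complex.I / 2 * kappa n m) n (m + 1),
      coeFn_smul_sphHarm (Complex.I / 2 * kappa n (m - 1)) n (m - 1)] with x h1 h2 h3
    refine h1.trans ?_
    rw [Pi.add_apply, h2, h3]
    change _ = rotD 0 (solid n m) x.1
    linear_combination (-(1 : ℂ) / 2) * rotD_solid_add n m x - (1 : ℂ) / 2 * rotD_solid_sub n m x
  · filter_upwards [Lp.coeFn_sub (((1 : ℂ) / 2 * kappa n m) • sphHarm n (m + 1))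
      (((1 : ℂ) / 2 * kappa n (m - 1)) • sphHarm n (m - 1)),
      coeFn_smul_sphHarm ((1 : ℂ) / 2 * kappa n m) n (m + 1),
      coeFn_smul_sphHarm ((1 : ℂ) / 2 * kappa n (m - 1)) n (m - 1)] with x h1 h2 h3
    refine h1.trans ?_
    rw [Pi.sub_apply, h2, h3]
    change _ = rotD 1 (solid n m) x.1
    linear_combination (Complex.I / 2) * rotD_solid_add n m x -
      Complex.I / 2 * rotD_solid_sub n m x + (-rotD 1 (solid n m) x.1 -
      (1 : ℂ) / 2 * kappa n (m - 1) * solid n (m - 1) x.1 +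
      (1 : ℂ) / 2 * kappa n m * solid n (m + 1) x.1) * Complex.I_sq
  · filter_upwards [coeFn_smul_sphHarm (Complex.I * m) n m] with x h1
    exact h1.trans (rotD_solid_two n m x.1).symm

/-- Integration by parts against the polynomial representative `solid`, whose derivative is given by
the ladder relations. -/
theorem isWeakRotDeriv_sphHarm (i : Fin 3) (n : ℕ) (m : ℤ) :
    IsWeakRotDeriv i (sphHarm n m) (rotHarm i n m) := by
  intro ψ hψ
  have h := integral_mul_rotD i (contDiff_solid n m (r := 1)) (hψ.of_le (by exact_mod_cast le_top))
  calc _ = ∫ x : S2, solid n m x.1 * rotD i ψ x.1 ∂surf := by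
        refine integral_congr_ae ?_
        filter_upwards [coeFn_sphHarm n m] with x hx
        rw [hx]
        rfl
    _ = _ := h
    _ = _ := by
        congr 1
        refine integral_congr_ae ?_
        filter_upwards [coeFn_rotHarm i n m] with x hx
        rw [hx]

/-! ### Multiplication by `cos θ` -/

theorem norm_coord_le (x : S2) (j : Fin 3) : ‖((x.1 j : ℝ) : ℂ)‖ ≤ 1 := by
  rw [Complex.norm_real]
  exact (PiLp.norm_apply_le x.1 j).trans_eq (mem_sphere_zero_iff_norm.1 x.2)

theorem memLp_mulCos (u : LTwo) : MemLp (fun x : S2 => ((x.1 2 : ℝ) : ℂ) * u x) 2 surf := by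
  have hc : Continuous fun x : S2 => ((x.1 2 : ℝ) : ℂ) :=
    (contDiff_coord 2 (n := 0)).continuous.comp continuous_subtype_val
  refine (Lp.memLp u).mono (hc.aestronglyMeasurable.mul (Lp.aestronglyMeasurable u))
    (Eventually.of_forall fun x => ?_)
  rw [norm_mul]
  exact mul_le_of_le_one_left (norm_nonneg _) (norm_coord_le x 2)

/-- Multiplication by `cos θ` on `L²(S²)`. -/
def mulCos : LTwo →L[ℂ] LTwo :=
  LinearMap.mkContinuous
    { toFun := fun u => (memLp_mulCos u).toLp
      map_add' := fun u v => by
        refine Lp.ext ?_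
        filter_upwards [(memLp_mulCos (u + v)).coeFn_toLp, (memLp_mulCos u).coeFn_toLp,
          (memLp_mulCos v).coeFn_toLp, Lp.coeFn_add u v,
          Lp.coeFn_add (memLp_mulCos u).toLp (memLp_mulCos v).toLp] with x h1 h2 h3 h4 h5
        rw [h1, h5, Pi.add_apply, h2, h3, h4, Pi.add_apply]
        ring
      map_smul' := fun c u => by
        refine Lp.ext ?_
        filter_upwards [(memLp_mulCos (c • u)).coeFn_toLp, (memLp_mulCos u).coeFn_toLp,
          Lp.coeFn_smul c u, Lp.coeFn_smul c (memLp_mulCos u).toLp] with x h1 h2 h3 h4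
        rw [h1, RingHom.id_apply, h4, Pi.smul_apply, h2, h3, Pi.smul_apply, smul_eq_mul,
          smul_eq_mul]
        ring }
    1 fun u => by
      rw [one_mul]
      refine Lp.norm_le_norm_of_ae_le ?_
      filter_upwards [(memLp_mulCos u).coeFn_toLp] with x h1
      refine (congrArg norm h1).le.trans ?_
      rw [norm_mul]
      exact mul_le_of_le_one_left (norm_nonneg _) (norm_coord_le x 2)

theorem coeFn_mulCos (u : LTwo) : mulCos u =ᵐ[surf] fun x : S2 => ((x.1 2 : ℝ) : ℂ) * u x :=
  (memLp_mulCos u).coeFn_toLp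

theorem coeff_mulCos (u : LTwo) (n : ℕ) (m : ℤ) :
    coeff (mulCos u) n m =
      alpha (n + 1) m * coeff u (n + 1) m + alpha n m * coeff u (n - 1) m := by
  have i1 := integrable_LTwo_mul_conj u (continuous_solid (n + 1) m)
  have i2 := integrable_LTwo_mul_conj u (continuous_solid (n - 1) m)
  rw [coeff_eq_integral, coeff_eq_integral, coeff_eq_integral, ← integral_const_mul,
    ← integral_const_mul, ← integral_add (i1.const_mul _) (i2.const_mul _)]
  refine integral_congr_ae ?_
  filter_upwards [coeFn_mulCos u] with x hx
  rw [hx]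
  have h := congrArg conj (mul_solid n m x.1)
  simp only [map_add, map_mul, Complex.conj_ofReal] at h
  linear_combination u x * h

theorem inner_mulCos (u v : LTwo) : inner ℂ (mulCos u) v = inner ℂ u (mulCos v) := by
  rw [L2.inner_def, L2.inner_def]
  refine integral_congr_ae ?_
  filter_upwards [coeFn_mulCos u, coeFn_mulCos v] with x h1 h2
  rw [h1, h2]
  change _ * conj (_) = _ * conj (_)
  rw [map_mul, Complex.conj_ofReal]
  ring

/-! ### Orthonormality -/

/-- The longitude derivative is skew with distinct eigenvalues `im` and `il` on the two harmonics.
-/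
theorem coeff_sphHarm_of_ne {n k : ℕ} {m l : ℤ} (h : m ≠ l) : coeff (sphHarm k l) n m = 0 := by
  have h1 := coeff_of_isWeakRotDeriv_two (isWeakRotDeriv_sphHarm 2 k l) n m
  have h2 : coeff (rotHarm 2 k l) n m = Complex.I * l * coeff (sphHarm k l) n m := coeff_smul _ _ _ _
  have h3 : Complex.I * ((m : ℂ) - l) * coeff (sphHarm k l) n m = 0 := by
    linear_combination h2 - h1
  have h4 : (m : ℂ) - l ≠ 0 := by
    rw [sub_ne_zero]
    exact_mod_cast h
  exact (mul_eq_zero.1 h3).resolve_left (mul_ne_zero Complex.I_ne_zero h4)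

/-- Moves a ladder operator from one harmonic to the other in the inner product. It transfers both
vanishing and normalization between consecutive orders. -/
theorem kappa_mul_coeff_sphHarm (n k : ℕ) (l : ℤ) :
    (kappa k l : ℂ) * coeff (sphHarm k l) n l =
      kappa n l * coeff (sphHarm k (l + 1)) n (l + 1) := by
  have h := coeff_sub_of_isWeakRotDeriv (isWeakRotDeriv_sphHarm 0 k (l + 1))
    (isWeakRotDeriv_sphHarm 1 k (l + 1)) n l
  have e0 : coeff (rotHarm 0 k (l + 1)) n l = Complex.I / 2 * kappa k (l + 1) *
      coeff (sphHarm k (l + 1 + 1)) n l + Complex.I / 2 * kappa k (l + 1 - 1) *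
      coeff (sphHarm k (l + 1 - 1)) n l := by
    rw [← coeff_smul, ← coeff_smul, ← coeff_add]
    rfl
  have e1 : coeff (rotHarm 1 k (l + 1)) n l = (1 : ℂ) / 2 * kappa k (l + 1) *
      coeff (sphHarm k (l + 1 + 1)) n l - (1 : ℂ) / 2 * kappa k (l + 1 - 1) *
      coeff (sphHarm k (l + 1 - 1)) n l := by
    rw [← coeff_smul, ← coeff_smul, ← coeff_sub]
    rfl
  rw [add_sub_cancel_right] at e0 e1
  rw [e0, e1] at h
  refine mul_left_cancel₀ Complex.I_ne_zero ?_
  linear_combination h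

theorem kappa_pos {n : ℕ} {m : ℤ} (h1 : -(n : ℤ) ≤ m) (h2 : m < n) : 0 < kappa n m := by
  refine Real.sqrt_pos.2 (mul_pos ?_ ?_)
  · have : (m : ℝ) < n := by exact_mod_cast h2
    linarith
  · have : -(n : ℝ) ≤ m := by exact_mod_cast h1
    linarith

/-- Descend from order `n + 1`, where the harmonic of degree `n` is zero. The factor `kappa k l` to
be cancelled is positive at every step because `n < k`. -/
theorem coeff_sphHarm_of_lt {n k : ℕ} (h : n < k) (l : ℤ) (hl : |l| ≤ n) :
    coeff (sphHarm k l) n l = 0 := by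
  have key : ∀ j : ℕ, -(n : ℤ) ≤ (n : ℤ) + 1 - j →
      coeff (sphHarm k ((n : ℤ) + 1 - j)) n ((n : ℤ) + 1 - j) = 0 := by
    intro j
    induction j with
    | zero =>
      intro _
      exact coeff_eq_zero _ (by rw [abs_of_nonneg] <;> omega)
    | succ j ih =>
      intro hj
      push_cast at hj ⊢
      have h1 := ih (by omega)
      have h2 := kappa_mul_coeff_sphHarm n k ((n : ℤ) + 1 - (j + 1))
      rw [show (n : ℤ) + 1 - (j + 1) + 1 = n + 1 - j by ring, h1, mul_zero] at h2
      have h3 : (0 : ℝ) < kappa k ((n : ℤ) + 1 - (j + 1)) := kappa_pos (by omega) (by omega)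
      exact (mul_eq_zero.1 h2).resolve_left (by exact_mod_cast h3.ne')
  have h' := abs_le.1 hl
  have := key ((n : ℤ) + 1 - l).toNat
  rw [Int.toNat_of_nonneg (by omega), sub_sub_cancel] at this
  exact this (by omega)

theorem coeff_sphHarm_of_ne_degree {n k : ℕ} (h : n ≠ k) (l : ℤ) : coeff (sphHarm k l) n l = 0 := by
  by_cases hl : |l| ≤ n
  · rcases lt_or_gt_of_ne h with h | h
    · exact coeff_sphHarm_of_lt h l hl
    · by_cases hl' : |l| ≤ k
      · have := coeff_sphHarm_of_lt h l hl'
        rw [coeff] at this ⊢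
        rw [← inner_conj_symm, this, map_zero]
      · rw [sphHarm_eq_zero (by omega), coeff_zero]
  · exact coeff_eq_zero _ (by omega)

theorem mulCos_sphHarm (n : ℕ) (m : ℤ) : mulCos (sphHarm n m) =
    (alpha (n + 1) m : ℂ) • sphHarm (n + 1) m + (alpha n m : ℂ) • sphHarm (n - 1) m := by
  refine Lp.ext ?_
  filter_upwards [coeFn_mulCos (sphHarm n m), coeFn_sphHarm n m,
    coeFn_smul_sphHarm (alpha (n + 1) m) (n + 1) m, coeFn_smul_sphHarm (alpha n m) (n - 1) m,
    Lp.coeFn_add ((alpha (n + 1) m : ℂ) • sphHarm (n + 1) m) ((alpha n m : ℂ) • sphHarm (n - 1) m)]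
    with x h1 h2 h3 h4 h5
  rw [h1, h2, h5, Pi.add_apply, h3, h4]
  exact mul_solid n m x.1

theorem solid_zero_zero (x : E3) : solid 0 0 x = ((1 / Real.sqrt (4 * Real.pi) : ℝ) : ℂ) := by
  have := legendre_zero
  simp [solid, solidNat, this, harmNorm]

/-- In degree zero this is the area `4π`. Computing the coefficient of degree `n + 1` of `cos θ
Y_n^0` in two ways passes the value to the next degree, so no integral of squared Legendre
polynomials is needed. -/
theorem coeff_sphHarm_zero (n : ℕ) : coeff (sphHarm n 0) n 0 = 1 := by
  induction n with
  | zero =>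
    have hpi := Real.pi_pos
    rw [coeff_eq_integral]
    calc _ = ∫ x : S2, ((1 / (4 * Real.pi) : ℝ) : ℂ) ∂surf := by
          refine integral_congr_ae ?_
          filter_upwards [coeFn_sphHarm 0 0] with x hx
          rw [hx, solid_zero_zero, Complex.conj_ofReal, ← Complex.ofReal_mul, div_mul_div_comm,
            Real.mul_self_sqrt (by positivity), one_mul]
      _ = 1 := by
          rw [integral_const, surf_univ, Complex.real_smul, ← Complex.ofReal_mul,
            mul_one_div_cancel (by positivity), Complex.ofReal_one]
  | succ n ih =>
    have h := coeff_mulCos (sphHarm n 0) (n + 1) 0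
    rw [mulCos_sphHarm, coeff_add, coeff_smul, coeff_smul, Nat.add_sub_cancel, ih,
      coeff_sphHarm_of_ne_degree (show n + 1 ≠ n - 1 by omega),
      coeff_sphHarm_of_ne_degree (show n + 1 + 1 ≠ n by omega), mul_zero, mul_zero, add_zero,
      zero_add] at h
    have h3 : (0 : ℝ) < alpha (n + 1) 0 := by
      refine Real.sqrt_pos.2 ?_
      push_cast
      have : (0 : ℝ) ≤ n := n.cast_nonneg
      refine div_pos ?_ ?_ <;> nlinarith
    exact mul_left_cancel₀ (by exact_mod_cast h3.ne') h

theorem coeff_sphHarm_self {n : ℕ} {m : ℤ} (h : |m| ≤ n) : coeff (sphHarm n m) n m = 1 := by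
  have step : ∀ l : ℤ, -(n : ℤ) ≤ l → l < n →
      coeff (sphHarm n l) n l = coeff (sphHarm n (l + 1)) n (l + 1) := fun l h1 h2 => by
    have := kappa_mul_coeff_sphHarm n n l
    exact mul_left_cancel₀ (by exact_mod_cast (kappa_pos h1 h2).ne') this
  have hup : ∀ j : ℕ, j ≤ n → coeff (sphHarm n (j : ℤ)) n j = 1 := by
    intro j
    induction j with
    | zero => intro _; exact coeff_sphHarm_zero n
    | succ j ih =>
      intro hj
      have := step j (by omega) (by omega)
      rw [ih (by omega)] at this
      push_cast
      exact this.symm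
  have hdown : ∀ j : ℕ, j ≤ n → coeff (sphHarm n (-(j : ℤ))) n (-(j : ℤ)) = 1 := by
    intro j
    induction j with
    | zero => intro _; exact coeff_sphHarm_zero n
    | succ j ih =>
      intro hj
      have := step (-((j + 1 : ℕ) : ℤ)) (by omega) (by omega)
      rw [show -((j + 1 : ℕ) : ℤ) + 1 = -(j : ℤ) by push_cast; ring, ih (by omega)] at this
      exact this
  have h' := abs_le.1 h
  obtain ⟨j, rfl | rfl⟩ := m.eq_nat_or_neg
  · exact hup j (by omega)
  · exact hdown j (by omega)

theorem coeff_sphHarm (k : ℕ) (l : ℤ) (n : ℕ) (m : ℤ) :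
    coeff (sphHarm k l) n m = if n = k ∧ m = l ∧ |l| ≤ k then 1 else 0 := by
  split_ifs with h
  · obtain ⟨rfl, rfl, h⟩ := h
    exact coeff_sphHarm_self h
  · by_cases hl : |l| ≤ k
    · by_cases hm : m = l
      · subst hm
        exact coeff_sphHarm_of_ne_degree (fun hn => h ⟨hn, rfl, hl⟩) _
      · exact coeff_sphHarm_of_ne hm
    · rw [sphHarm_eq_zero (by omega), coeff_zero]

end Coefficients

/-! ### Completeness of the harmonics and Parseval's identity -/

section Completeness

open scoped ComplexConjugate
open Polynomial (X)

/-- The three-term recurrence makes the span stable under multiplication by `X`, and the derivative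
of order `k` of `P_k` is a nonzero constant in it. -/
theorem span_legendreDeriv (k : ℕ) :
    Submodule.span ℝ (Set.range fun n => legendreDeriv n k) = ⊤ := by
  set M := Submodule.span ℝ (Set.range fun n => legendreDeriv n k)
  have hmem : ∀ n, legendreDeriv n k ∈ M := fun n => Submodule.subset_span ⟨n, rfl⟩
  have hX : ∀ p ∈ M, X * p ∈ M := by
    intro p hp
    induction hp using Submodule.span_induction with
    | zero => rw [mul_zero]; exact M.zero_mem
    | add p q _ _ hp hq => rw [mul_add]; exact M.add_mem hp hq
    | smul c p _ hp => rw [mul_smul_comm]; exact M.smul_mem c hp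
    | mem p hp =>
      obtain ⟨n, rfl⟩ := hp
      cases n with
      | zero =>
        rcases Nat.eq_zero_or_pos k with rfl | hk
        · have := hmem 1
          rw [legendre_one] at this
          simpa [legendre_zero] using this
        · simp [legendreDeriv_eq_zero hk]
      | succ n =>
        have h := legendreDeriv_recurrence n k
        have hne : (2 * (n : ℝ) + 3) ≠ 0 := by positivity
        have e : X * legendreDeriv (n + 1) k = (2 * (n : ℝ) + 3)⁻¹ •
            (((n : ℝ) + 2 - k) • legendreDeriv (n + 2) k +
              ((n : ℝ) + 1 + k) • legendreDeriv n k) := by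
          rw [← (smul_right_injective _ hne).eq_iff]
          simp only [smul_smul, mul_inv_cancel₀ hne, one_smul]
          simp only [Polynomial.smul_eq_C_mul]
          linear_combination -h
        change X * legendreDeriv (n + 1) k ∈ M
        rw [e]
        exact M.smul_mem _ (M.add_mem (M.smul_mem _ (hmem _)) (M.smul_mem _ (hmem _)))
  have h1 : (1 : Polynomial ℝ) ∈ M := by
    obtain ⟨c, hc, h⟩ := legendreDeriv_self k
    have := M.smul_mem c⁻¹ (hmem k)
    rwa [h, Polynomial.smul_C, smul_eq_mul, inv_mul_cancel₀ hc, Polynomial.C_1] at this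
  rw [eq_top_iff]
  rintro p -
  induction p using Polynomial.induction_on' with
  | add p q hp hq => exact M.add_mem hp hq
  | monomial n a =>
    rw [← Polynomial.C_mul_X_pow_eq_monomial, ← Polynomial.smul_eq_C_mul]
    refine M.smul_mem a ?_
    induction n with
    | zero => simpa using h1
    | succ n ih => rw [pow_succ']; exact hX _ ih

/-- The function `ζ^k p(cos θ)` on the sphere. -/
def zonal (k : ℕ) (p : Polynomial ℝ) : C(S2, ℂ) where
  toFun x := zeta x.1 ^ k * ((p.eval (x.1 2) : ℝ) : ℂ)
  continuous_toFun := ((contDiff_zeta (n := 0).pow k).mul (contDiff_eval p)).continuous.comp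
    continuous_subtype_val

/-- The functions `ζ^k p(cos θ)` and their conjugates. -/
def zonalSet : Set C(S2, ℂ) :=
  Set.range (fun q : ℕ × Polynomial ℝ => zonal q.1 q.2) ∪
    Set.range (fun q : ℕ × Polynomial ℝ => star (zonal q.1 q.2))

theorem zonal_mul (k l : ℕ) (p q : Polynomial ℝ) :
    zonal k p * zonal l q = zonal (k + l) (p * q) := by
  ext x
  simp only [zonal, ContinuousMap.mul_apply, ContinuousMap.coe_mk, Polynomial.eval_mul]
  push_cast
  ring

theorem zonal_mul_star (k j : ℕ) (p q : Polynomial ℝ) :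
    zonal (k + j) p * star (zonal j q) = zonal k ((1 - X ^ 2) ^ j * (p * q)) := by
  ext x
  simp only [zonal, ContinuousMap.mul_apply, ContinuousMap.coe_mk, Polynomial.eval_mul,
    ContinuousMap.star_apply, Polynomial.eval_pow, Polynomial.eval_sub, Polynomial.eval_one,
    Polynomial.eval_X, RCLike.star_def, map_mul, map_pow, Complex.conj_ofReal]
  have h := zeta_mul_conj x
  rw [pow_add]
  push_cast at h ⊢
  rw [← h, mul_pow]
  ring

/-- Paired powers of `ζ` and its conjugate become powers of `1 - s²`, leaving a pure power of one of
the two. Hence the linear span is already an algebra. -/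
theorem mul_mem_zonalSet {f g : C(S2, ℂ)} (hf : f ∈ zonalSet) (hg : g ∈ zonalSet) :
    f * g ∈ zonalSet := by
  have key : ∀ (k l : ℕ) (p q : Polynomial ℝ), zonal k p * star (zonal l q) ∈ zonalSet := by
    intro k l p q
    rcases le_total l k with h | h
    · obtain ⟨j, rfl⟩ := Nat.exists_eq_add_of_le' h
      rw [zonal_mul_star]
      exact Or.inl ⟨(_, _), rfl⟩
    · obtain ⟨j, rfl⟩ := Nat.exists_eq_add_of_le' h
      have : zonal k p * star (zonal (j + k) q) = star (zonal (j + k) q * star (zonal k p)) := by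
        rw [star_mul, star_star]
      rw [this, zonal_mul_star]
      exact Or.inr ⟨(_, _), rfl⟩
  rcases hf with ⟨⟨k, p⟩, rfl⟩ | ⟨⟨k, p⟩, rfl⟩ <;> rcases hg with ⟨⟨l, q⟩, rfl⟩ | ⟨⟨l, q⟩, rfl⟩
  · exact Or.inl ⟨(k + l, p * q), (zonal_mul _ _ _ _).symm⟩
  · exact key _ _ _ _
  · rw [mul_comm]
    exact key _ _ _ _
  · refine Or.inr ⟨(l + k, q * p), ?_⟩
    change star (zonal (l + k) (q * p)) = star (zonal k p) * star (zonal l q)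
    rw [← zonal_mul, star_mul]

/-- The star subalgebra of the polynomial functions on the sphere. -/
def zonalAlgebra : StarSubalgebra ℂ C(S2, ℂ) where
  carrier := Submodule.span ℂ zonalSet
  zero_mem' := Submodule.zero_mem _
  add_mem' := fun h h' => Submodule.add_mem _ h h'
  mul_mem' := by
    intro f g hf hg
    have h := Submodule.mul_mem_mul hf hg
    rw [Submodule.span_mul_span] at h
    refine Submodule.span_mono ?_ h
    rintro _ ⟨f, hf, g, hg, rfl⟩
    exact mul_mem_zonalSet hf hg
  algebraMap_mem' := by
    intro c
    have h1 : (1 : C(S2, ℂ)) = zonal 0 1 := by ext x; simp [zonal]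
    rw [Algebra.algebraMap_eq_smul_one, h1]
    exact Submodule.smul_mem _ _ (Submodule.subset_span (Or.inl ⟨(0, 1), rfl⟩))
  star_mem' := by
    intro f hf
    change f ∈ Submodule.span ℂ zonalSet at hf
    change star f ∈ Submodule.span ℂ zonalSet
    induction hf using Submodule.span_induction with
    | zero => rw [star_zero]; exact Submodule.zero_mem _
    | add p q _ _ hp hq => rw [star_add]; exact Submodule.add_mem _ hp hq
    | smul c p _ hp => rw [star_smul]; exact Submodule.smul_mem _ _ hp
    | mem f hf =>
      refine Submodule.subset_span ?_
      rcases hf with ⟨q, rfl⟩ | ⟨q, rfl⟩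
      · exact Or.inr ⟨q, rfl⟩
      · exact Or.inl ⟨q, (star_star _).symm⟩

theorem zonalAlgebra_separatesPoints : zonalAlgebra.SeparatesPoints := by
  intro x y hxy
  have hz : zonal 0 X ∈ zonalAlgebra := Submodule.subset_span (Or.inl ⟨(0, X), rfl⟩)
  have hzeta : zonal 1 1 ∈ zonalAlgebra := Submodule.subset_span (Or.inl ⟨(1, 1), rfl⟩)
  by_contra hc
  push Not at hc
  have h1 := hc _ ⟨_, hz, rfl⟩
  have h2 := hc _ ⟨_, hzeta, rfl⟩
  simp only [zonal, ContinuousMap.coe_mk, pow_zero, one_mul, Polynomial.eval_X,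
    Complex.ofReal_inj, pow_one, Polynomial.eval_one, Complex.ofReal_one, mul_one, zeta] at h1 h2
  have h3 := congrArg Complex.re h2
  have h4 := congrArg Complex.im h2
  simp at h3 h4
  refine hxy (Subtype.ext ?_)
  ext j
  fin_cases j
  · exact h3
  · exact h4
  · exact h1

theorem toLp_zonal_mem_span (k : ℕ) (p : Polynomial ℝ) :
    ContinuousMap.toLp (E := ℂ) 2 surf ℂ (zonal k p) ∈
        Submodule.span ℂ (Set.range fun q : ℕ × ℤ => sphHarm q.1 q.2) ∧
      ContinuousMap.toLp (E := ℂ) 2 surf ℂ (star (zonal k p)) ∈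
        Submodule.span ℂ (Set.range fun q : ℕ × ℤ => sphHarm q.1 q.2) := by
  set V := Submodule.span ℂ (Set.range fun q : ℕ × ℤ => sphHarm q.1 q.2)
  have hadd : ∀ p q : Polynomial ℝ, zonal k (p + q) = zonal k p + zonal k q := fun p q => by
    ext x
    simp [zonal, mul_add]
  have hsmul : ∀ (c : ℝ) (p : Polynomial ℝ), zonal k (c • p) = (c : ℂ) • zonal k p := fun c p => by
    ext x
    simp [zonal]
    ring
  have hp : p ∈ Submodule.span ℝ (Set.range fun n => legendreDeriv n k) := by
    rw [span_legendreDeriv]; trivial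
  induction hp using Submodule.span_induction with
  | zero =>
    have h0 : zonal k 0 = 0 := by ext x; simp [zonal]
    rw [h0, star_zero, map_zero]
    exact ⟨V.zero_mem, V.zero_mem⟩
  | add p q _ _ hp hq =>
    rw [hadd, star_add, map_add, map_add]
    exact ⟨V.add_mem hp.1 hq.1, V.add_mem hp.2 hq.2⟩
  | smul c p _ hp =>
    rw [hsmul, star_smul, map_smul, map_smul]
    exact ⟨V.smul_mem _ hp.1, V.smul_mem _ hp.2⟩
  | mem p hp =>
    obtain ⟨n, rfl⟩ := hp
    have hN : (harmNorm n k : ℂ) ≠ 0 := by exact_mod_cast (harmNorm_pos n k).ne'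
    have hs : ((-1 : ℂ) ^ k) * (-1) ^ k = 1 := by rw [← mul_pow]; simp
    constructor
    · have e : ContinuousMap.toLp (E := ℂ) 2 surf ℂ (zonal k (legendreDeriv n k)) =
          ((harmNorm n k : ℂ)⁻¹ * (-1) ^ k) • sphHarm n k := by
        refine Lp.ext ?_
        filter_upwards [ContinuousMap.coeFn_toLp (p := 2) (𝕜 := ℂ) surf
          (zonal k (legendreDeriv n k)),
          coeFn_smul_sphHarm ((harmNorm n k : ℂ)⁻¹ * (-1) ^ k) n k] with x h1 h2
        rw [h1, h2, solid_natCast, solidNat]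
        simp only [zonal, ContinuousMap.coe_mk]
        field_simp
        linear_combination (-(zeta x.1 ^ k * (((legendreDeriv n k).eval (x.1 2) : ℝ) : ℂ))) * hs
      change ContinuousMap.toLp (E := ℂ) 2 surf ℂ (zonal k (legendreDeriv n k)) ∈ V
      rw [e]
      exact V.smul_mem _ (Submodule.subset_span ⟨(n, k), rfl⟩)
    · have e : ContinuousMap.toLp (E := ℂ) 2 surf ℂ (star (zonal k (legendreDeriv n k))) =
          ((harmNorm n k : ℂ)⁻¹) • sphHarm n (-k) := by
        refine Lp.ext ?_
        filter_upwards [ContinuousMap.coeFn_toLp (p := 2) (𝕜 := ℂ) surf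
          (star (zonal k (legendreDeriv n k))),
          coeFn_smul_sphHarm ((harmNorm n k : ℂ)⁻¹) n (-k)] with x h1 h2
        rw [h1, h2, solid_neg_natCast, solidNat]
        simp only [zonal, ContinuousMap.coe_mk, ContinuousMap.star_apply, RCLike.star_def, map_mul,
          Complex.conj_ofReal]
        field_simp
      change ContinuousMap.toLp (E := ℂ) 2 surf ℂ (star (zonal k (legendreDeriv n k))) ∈ V
      rw [e]
      exact V.smul_mem _ (Submodule.subset_span ⟨(n, -(k : ℤ)), rfl⟩)

/-- The spherical harmonics span a dense subspace of `L²(S²)`. -/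
theorem span_sphHarm_dense :
    (Submodule.span ℂ (Set.range fun q : ℕ × ℤ => sphHarm q.1 q.2)).topologicalClosure = ⊤ := by
  set V := Submodule.span ℂ (Set.range fun q : ℕ × ℤ => sphHarm q.1 q.2)
  set L := ContinuousMap.toLp (E := ℂ) 2 surf ℂ
  have h1 : ∀ f ∈ zonalAlgebra, L f ∈ V := by
    intro f hf
    change f ∈ Submodule.span ℂ zonalSet at hf
    induction hf using Submodule.span_induction with
    | zero => rw [map_zero]; exact V.zero_mem
    | add p q _ _ hp hq => rw [map_add]; exact V.add_mem hp hq
    | smul c p _ hp => rw [map_smul]; exact V.smul_mem _ hp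
    | mem f hf =>
      rcases hf with ⟨q, rfl⟩ | ⟨q, rfl⟩
      · exact (toLp_zonal_mem_span q.1 q.2).1
      · exact (toLp_zonal_mem_span q.1 q.2).2
  -- Stone–Weierstrass gives uniform density, which implies density in `L²` because continuous
  -- functions are dense there.
  have h2 := ContinuousMap.starSubalgebra_topologicalClosure_eq_top_of_separatesPoints
    zonalAlgebra zonalAlgebra_separatesPoints
  have h3 : ∀ f : C(S2, ℂ), L f ∈ V.topologicalClosure := by
    intro f
    have hf : f ∈ closure (zonalAlgebra : Set C(S2, ℂ)) := by
      rw [← StarSubalgebra.topologicalClosure_coe, h2]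
      trivial
    exact map_mem_closure L.continuous hf h1
  have h4 : DenseRange L := ContinuousMap.toLp_denseRange ℂ surf ℂ (by simp)
  rw [eq_top_iff]
  rintro u -
  exact V.isClosed_topologicalClosure.closure_subset_iff.2 (by rintro _ ⟨f, rfl⟩; exact h3 f) (h4 u)

/-- The index set of the spherical harmonics. -/
abbrev HarmIndex : Type := {q : ℕ × ℤ // |q.2| ≤ q.1}

theorem orthonormal_sphHarm : Orthonormal ℂ fun q : HarmIndex => sphHarm q.1.1 q.1.2 := by
  rw [orthonormal_iff_ite]
  intro p q
  have h := coeff_sphHarm q.1.1 q.1.2 p.1.1 p.1.2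
  rw [coeff] at h
  rw [h]
  congr 1
  rw [eq_iff_iff]
  constructor
  · rintro ⟨h1, h2, -⟩
    exact Subtype.ext (Prod.ext h1 h2)
  · rintro rfl
    exact ⟨rfl, rfl, p.2⟩

/-- The spherical harmonics as a Hilbert basis of `L²(S²)`. -/
def harmBasis : HilbertBasis HarmIndex ℂ LTwo :=
  HilbertBasis.mk orthonormal_sphHarm (by
    rw [← span_sphHarm_dense]
    refine Submodule.topologicalClosure_mono (Submodule.span_le.2 ?_)
    rintro _ ⟨q, rfl⟩
    by_cases h : |q.2| ≤ q.1
    · exact Submodule.subset_span ⟨⟨q, h⟩, rfl⟩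
    · change sphHarm q.1 q.2 ∈ _
      rw [sphHarm_eq_zero (by omega)]
      exact Submodule.zero_mem _)

theorem harmBasis_apply (q : HarmIndex) : harmBasis q = sphHarm q.1.1 q.1.2 := by
  rw [harmBasis, HilbertBasis.coe_mk]

theorem harmBasis_repr (u : LTwo) (q : HarmIndex) : harmBasis.repr u q = coeff u q.1.1 q.1.2 := by
  rw [HilbertBasis.repr_apply_apply, harmBasis_apply]
  rfl

theorem ext_coeff {u v : LTwo} (h : ∀ n m, coeff u n m = coeff v n m) : u = v := by
  refine harmBasis.repr.injective ?_
  ext q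
  rw [harmBasis_repr, harmBasis_repr, h]

/-- Harmonics and coefficients vanish for `|m| > n`, so sums may run over all of `ℕ × ℤ`, where
shifts of `m` are bijections. -/
theorem hasSum_prod_of_hasSum_index {E : Type*} [AddCommGroup E] [TopologicalSpace E]
    {f : ℕ × ℤ → E} (hf : ∀ q : ℕ × ℤ, (q.1 : ℤ) < |q.2| → f q = 0) {s : E} :
    HasSum (fun q : HarmIndex => f q.1) s ↔ HasSum f s := by
  refine hasSum_subtype_iff_of_support_subset (s := {q : ℕ × ℤ | |q.2| ≤ q.1}) fun q hq => ?_
  by_contra hc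
  exact hq (hf q (not_le.1 hc))

/-- The expansion of `u` in spherical harmonics. -/
theorem hasSum_sphHarm (u : LTwo) :
    HasSum (fun q : ℕ × ℤ => coeff u q.1 q.2 • sphHarm q.1 q.2) u := by
  refine (hasSum_prod_of_hasSum_index fun q hq => ?_).1 ?_
  · rw [sphHarm_eq_zero hq, smul_zero]
  · have h := harmBasis.hasSum_repr u
    simp_rw [harmBasis_repr, harmBasis_apply] at h
    exact h

/-- **Parseval's identity** for inner products. -/
theorem hasSum_inner_coeff (u v : LTwo) :
    HasSum (fun q : ℕ × ℤ => conj (coeff u q.1 q.2) * coeff v q.1 q.2) (inner ℂ u v) := by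
  refine (hasSum_prod_of_hasSum_index fun q hq => ?_).1 ?_
  · rw [coeff_eq_zero _ hq, coeff_eq_zero _ hq, mul_zero]
  · have h := harmBasis.hasSum_inner_mul_inner u v
    simp_rw [harmBasis_apply] at h
    refine h.congr_fun fun q => ?_
    rw [coeff, coeff, inner_conj_symm]

/-- **Parseval's identity**. -/
theorem hasSum_norm_sq_coeff (u : LTwo) :
    HasSum (fun q : ℕ × ℤ => ‖coeff u q.1 q.2‖ ^ 2) (‖u‖ ^ 2) := by
  have h := Complex.hasSum_re (hasSum_inner_coeff u u)
  have e : (inner ℂ u u : ℂ).re = ‖u‖ ^ 2 := (norm_sq_eq_re_inner (𝕜 := ℂ) u).symm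
  rw [e] at h
  refine h.congr_fun fun q => ?_
  rw [mul_comm, Complex.mul_conj, Complex.ofReal_re, Complex.normSq_eq_norm_sq]

/-- Square-summable coefficients are those of a function in `L²(S²)`. -/
theorem exists_coeff_eq {c : ℕ → ℤ → ℂ} (h0 : ∀ (n : ℕ) (m : ℤ), (n : ℤ) < |m| → c n m = 0)
    (hc : Summable fun q : ℕ × ℤ => ‖c q.1 q.2‖ ^ 2) : ∃ u : LTwo, ∀ n m, coeff u n m = c n m := by
  have hmem : Memℓp (fun q : HarmIndex => c q.1.1 q.1.2) 2 := by
    refine memℓp_gen ?_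
    have := hc.subtype {q : ℕ × ℤ | |q.2| ≤ q.1}
    simp only [ENNReal.toReal_ofNat, Real.rpow_ofNat]
    exact this
  refine ⟨harmBasis.repr.symm ⟨_, hmem⟩, fun n m => ?_⟩
  by_cases h : |m| ≤ n
  · rw [← harmBasis_repr _ ⟨(n, m), h⟩, LinearIsometryEquiv.apply_symm_apply]
  · rw [coeff_eq_zero _ (not_le.1 h), h0 _ _ (not_le.1 h)]

end Completeness

/-! ### Weak derivatives and the Laplacian in terms of coefficients -/

section WeakDerivatives

open scoped ComplexConjugate ContDiff

theorem hasSum_degPart (u : LTwo) : HasSum (fun n => degPart n u) u := by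
  refine (hasSum_sphHarm u).prod_fiberwise fun n => ?_
  refine hasSum_sum_of_ne_finset_zero fun m hm => ?_
  have : (n : ℤ) < |m| := by
    rw [Finset.mem_Icc, ← abs_le] at hm
    exact not_le.1 hm
  simp only
  rw [sphHarm_eq_zero this, smul_zero]

theorem coeff_degPart (k : ℕ) (u : LTwo) (n : ℕ) (m : ℤ) :
    coeff (degPart k u) n m = if n = k then coeff u n m else 0 := by
  rw [degPart, coeff_sum]
  simp_rw [coeff_smul, coeff_sphHarm]
  split_ifs with h
  · subst h
    by_cases hm : |m| ≤ n
    · rw [Finset.sum_eq_single m]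
      · simp [hm]
      · intro l _ hl
        rw [if_neg (fun h => hl h.2.1.symm), mul_zero]
      · intro h
        rw [Finset.mem_Icc, ← abs_le] at h
        exact absurd hm h
    · rw [coeff_eq_zero u (not_le.1 hm)]
      refine Finset.sum_eq_zero fun l _ => ?_
      rw [if_neg, mul_zero]
      rintro ⟨-, rfl, h⟩
      exact hm h
  · refine Finset.sum_eq_zero fun l _ => ?_
    rw [if_neg (fun h' => h h'.1), mul_zero]

theorem hasSum_tailPart (N : ℕ) (u : LTwo) : HasSum (fun k => degPart (N + k) u) (tailPart N u) := by
  refine Summable.hasSum ?_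
  have h := (summable_nat_add_iff N).2 (hasSum_degPart u).summable
  simpa only [add_comm] using h

theorem coeff_tailPart (N : ℕ) (u : LTwo) (n : ℕ) (m : ℤ) :
    coeff (tailPart N u) n m = if N ≤ n then coeff u n m else 0 := by
  have h := ((innerSL ℂ (sphHarm n m)).hasSum (hasSum_tailPart N u))
  change HasSum (fun k => coeff (degPart (N + k) u) n m) (coeff (tailPart N u) n m) at h
  simp_rw [coeff_degPart] at h
  refine h.unique ?_
  split_ifs with hN
  · have h2 := hasSum_ite_eq (n - N) (coeff u n m)
    refine h2.congr_fun fun k => ?_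
    congr 1
    rw [eq_iff_iff]
    omega
  · have : ∀ k, (if n = N + k then coeff u n m else 0) = 0 := fun k => if_neg (by omega)
    simp_rw [this]
    exact hasSum_zero

/-- The test function `conj ψ` as an element of `L²(S²)`. -/
def testLp (ψ : E3 → ℂ) (hψ : Continuous ψ) : LTwo :=
  ContinuousMap.toLp (E := ℂ) 2 surf ℂ
    ⟨fun x : S2 => conj (ψ x.1), Complex.continuous_conj.comp (hψ.comp continuous_subtype_val)⟩

theorem inner_testLp {ψ : E3 → ℂ} (hψ : Continuous ψ) (u : LTwo) :
    inner ℂ (testLp ψ hψ) u = ∫ x : S2, u x * ψ x.1 ∂surf := by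
  rw [L2.inner_def]
  refine integral_congr_ae ?_
  filter_upwards [ContinuousMap.coeFn_toLp (p := 2) (𝕜 := ℂ) surf (⟨fun x : S2 => conj (ψ x.1),
    Complex.continuous_conj.comp (hψ.comp continuous_subtype_val)⟩ : C(S2, ℂ))] with x hx
  rw [testLp, hx]
  change _ * conj (conj (ψ x.1)) = _
  rw [Complex.conj_conj]

theorem isWeakRotDeriv_iff_inner {i : Fin 3} {u v : LTwo} : IsWeakRotDeriv i u v ↔
    ∀ (ψ : E3 → ℂ) (hψ : ContDiff ℝ ∞ ψ),
      inner ℂ (testLp (rotD i ψ) (continuous_rotD i (hψ.of_le (by exact_mod_cast le_top)))) u =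
        -inner ℂ (testLp ψ hψ.continuous) v := by
  simp_rw [inner_testLp]
  rfl

/-- For a fixed test function the definition equates two continuous functionals of `u` and `v`, so
it survives convergent sums. -/
theorem IsWeakRotDeriv.of_hasSum {ι : Type*} {i : Fin 3} {f g : ι → LTwo} {u v : LTwo}
    (hu : HasSum f u) (hv : HasSum g v) (h : ∀ j, IsWeakRotDeriv i (f j) (g j)) :
    IsWeakRotDeriv i u v := by
  simp_rw [isWeakRotDeriv_iff_inner] at h ⊢
  intro ψ hψ
  have h1 := (innerSL ℂ (testLp (rotD i ψ)
    (continuous_rotD i (hψ.of_le (by exact_mod_cast le_top))))).hasSum hu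
  have h2 := ((innerSL ℂ (testLp ψ hψ.continuous)).hasSum hv).neg
  refine h1.unique (h2.congr_fun fun j => ?_)
  exact h j ψ hψ

theorem IsWeakRotDeriv.smul {i : Fin 3} {u v : LTwo} (h : IsWeakRotDeriv i u v) (c : ℂ) :
    IsWeakRotDeriv i (c • u : LTwo) (c • v : LTwo) := by
  rw [isWeakRotDeriv_iff_inner] at h ⊢
  intro ψ hψ
  rw [inner_smul_right, inner_smul_right, h ψ hψ, mul_neg]

theorem IsWeakRotDeriv.sum {ι : Type*} (s : Finset ι) {i : Fin 3} {f g : ι → LTwo}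
    (h : ∀ j, IsWeakRotDeriv i (f j) (g j)) :
    IsWeakRotDeriv i (∑ j ∈ s, f j : LTwo) (∑ j ∈ s, g j : LTwo) := by
  simp_rw [isWeakRotDeriv_iff_inner] at h ⊢
  intro ψ hψ
  rw [inner_sum, inner_sum, ← Finset.sum_neg_distrib]
  exact Finset.sum_congr rfl fun j _ => h j ψ hψ

/-- The action of the rotation fields on coefficients. -/
def rotCoeff (i : Fin 3) (c : ℕ → ℤ → ℂ) (n : ℕ) (m : ℤ) : ℂ :=
  ![Complex.I / 2 * (kappa n (m - 1) * c n (m - 1) + kappa n m * c n (m + 1)),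
    1 / 2 * (kappa n (m - 1) * c n (m - 1) - kappa n m * c n (m + 1)),
    Complex.I * m * c n m] i

theorem rotCoeff_degPart (i : Fin 3) (k : ℕ) (u : LTwo) (n : ℕ) (m : ℤ) :
    rotCoeff i (coeff (degPart k u)) n m = if n = k then rotCoeff i (coeff u) n m else 0 := by
  simp only [rotCoeff, coeff_degPart]
  split_ifs
  · rfl
  · fin_cases i <;> simp

theorem coeff_of_isWeakRotDeriv {i : Fin 3} {u v : LTwo} (h : IsWeakRotDeriv i u v) (n : ℕ) (m : ℤ) :
    coeff v n m = rotCoeff i (coeff u) n m := by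
  have h1 := h.coeff_conj_rotD n m
  have h2 : inner ℂ (rotHarm i n m) u = ∫ x : S2, u x * conj (rotD i (solid n m) x.1) ∂surf := by
    rw [L2.inner_def]
    refine integral_congr_ae ?_
    filter_upwards [coeFn_rotHarm i n m] with x hx
    rw [hx]
    rfl
  rw [← h2, ← neg_eq_iff_eq_neg] at h1
  rw [← h1]
  fin_cases i
  · change -inner ℂ ((Complex.I / 2 * kappa n m) • sphHarm n (m + 1) +
      (Complex.I / 2 * kappa n (m - 1)) • sphHarm n (m - 1)) u = _
    rw [inner_add_left, inner_smul_left, inner_smul_left]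
    change -(_ * coeff u n (m + 1) + _ * coeff u n (m - 1)) = _
    simp [rotCoeff, map_ofNat]
    ring
  · change -inner ℂ (((1 : ℂ) / 2 * kappa n m) • sphHarm n (m + 1) -
      ((1 : ℂ) / 2 * kappa n (m - 1)) • sphHarm n (m - 1)) u = _
    rw [inner_sub_left, inner_smul_left, inner_smul_left]
    change -(_ * coeff u n (m + 1) - _ * coeff u n (m - 1)) = _
    simp [rotCoeff, map_ofNat]
    ring
  · change -inner ℂ ((Complex.I * m) • sphHarm n m) u = _
    rw [inner_smul_left]
    change -(_ * coeff u n m) = _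
    simp [rotCoeff]

/-- The rotation fields preserve the degree. Each `degPart` is a finite sum of harmonics with an
explicit derivative, and the series over degrees converge for both functions. -/
theorem isWeakRotDeriv_of_coeff {i : Fin 3} {u v : LTwo}
    (h : ∀ n m, coeff v n m = rotCoeff i (coeff u) n m) : IsWeakRotDeriv i u v := by
  refine IsWeakRotDeriv.of_hasSum (hasSum_degPart u) (hasSum_degPart v) fun k => ?_
  have h1 : IsWeakRotDeriv i (degPart k u)
      (∑ m ∈ Finset.Icc (-(k : ℤ)) k, coeff u k m • rotHarm i k m : LTwo) :=
    IsWeakRotDeriv.sum _ fun m => (isWeakRotDeriv_sphHarm i k m).smul _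
  have h2 := coeff_of_isWeakRotDeriv h1
  have e : degPart k v = ∑ m ∈ Finset.Icc (-(k : ℤ)) k, coeff u k m • rotHarm i k m := by
    refine ext_coeff fun n m => ?_
    rw [h2, coeff_degPart, h]
    exact (rotCoeff_degPart i k u n m).symm
  rw [e]
  exact h1

theorem IsWeakRotDeriv.congr_ae {i : Fin 3} {f g : S2 → ℂ} {v : S2 → ℂ} (h : f =ᵐ[surf] g) :
    IsWeakRotDeriv i f v ↔ IsWeakRotDeriv i g v := by
  have : ∀ ψ : E3 → ℂ, ∫ x : S2, f x * fderiv ℝ ψ x.1 (rotField i x.1) ∂surf =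
      ∫ x : S2, g x * fderiv ℝ ψ x.1 (rotField i x.1) ∂surf := fun ψ =>
    integral_congr_ae (by filter_upwards [h] with x hx; rw [hx])
  simp only [IsWeakRotDeriv, this]

/-! ### The Laplacian -/

theorem kappa_sq_add {n : ℕ} {m : ℤ} (h : |m| ≤ n) :
    (kappa n (m - 1) : ℂ) ^ 2 + (kappa n m : ℂ) ^ 2 = 2 * ((n : ℂ) * (n + 1) - m ^ 2) := by
  have h' := abs_le.1 h
  have h1 : (m : ℝ) ≤ n := by exact_mod_cast h'.2
  have h2 : -(n : ℝ) ≤ m := by exact_mod_cast h'.1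
  have e : kappa n (m - 1) ^ 2 + kappa n m ^ 2 = 2 * ((n : ℝ) * (n + 1) - m ^ 2) := by
    rw [kappa, kappa, Real.sq_sqrt, Real.sq_sqrt]
    · push_cast; ring
    · exact mul_nonneg (by linarith) (by linarith)
    · push_cast
      exact mul_nonneg (by linarith) (by linarith)
  exact_mod_cast e

/-- The Casimir identity: in the first two squares the terms shifting `m` by `±2` cancel, and what
remains is `kappa_sq_add` together with `m²`. -/
theorem sum_rotCoeff_rotCoeff {c : ℕ → ℤ → ℂ} (h0 : ∀ (n : ℕ) (m : ℤ), (n : ℤ) < |m| → c n m = 0)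
    (n : ℕ) (m : ℤ) : ∑ i, rotCoeff i (rotCoeff i c) n m = -((n : ℂ) * (n + 1)) * c n m := by
  rw [Fin.sum_univ_three]
  simp only [rotCoeff, Matrix.cons_val_zero, Matrix.cons_val_one, Matrix.cons_val, sub_add_cancel,
    add_sub_cancel_right]
  by_cases h : |m| ≤ n
  · have hk := kappa_sq_add h
    linear_combination (-(1 : ℂ) / 2 * c n m) * hk + (1 / 4 * (kappa n (m - 1) *
      (kappa n (m - 1 - 1) * c n (m - 1 - 1) + kappa n (m - 1) * c n m) + kappa n m *
      (kappa n m * c n m + kappa n (m + 1) * c n (m + 1 + 1))) + (m : ℂ) ^ 2 * c n m) * Complex.I_sq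
  · have hm := not_le.1 h
    rw [h0 n m hm]
    linear_combination (1 / 4 * (kappa n (m - 1) *
      (kappa n (m - 1 - 1) * c n (m - 1 - 1)) + kappa n m *
      (kappa n (m + 1) * c n (m + 1 + 1)))) * Complex.I_sq

/-- At the two ends of the ladder a nonzero coefficient is adjacent to the forbidden range, but
there `kappa` vanishes. -/
theorem rotCoeff_eq_zero (i : Fin 3) {c : ℕ → ℤ → ℂ}
    (h0 : ∀ (n : ℕ) (m : ℤ), (n : ℤ) < |m| → c n m = 0) (n : ℕ) (m : ℤ) (h : (n : ℤ) < |m|) :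
    rotCoeff i c n m = 0 := by
  have h1 : (kappa n (m - 1) : ℂ) * c n (m - 1) = 0 := by
    rcases eq_or_ne m (n + 1) with rfl | hm
    · rw [add_sub_cancel_right, kappa_self]
      simp
    · rw [h0 n (m - 1), mul_zero]
      rw [Int.abs_eq_natAbs] at h ⊢
      omega
  have h2 : (kappa n m : ℂ) * c n (m + 1) = 0 := by
    rcases eq_or_ne m (-(n : ℤ) - 1) with rfl | hm
    · rw [kappa_neg, kappa_self]
      simp
    · rw [h0 n (m + 1), mul_zero]
      rw [Int.abs_eq_natAbs] at h ⊢
      omega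
  fin_cases i <;> simp [rotCoeff, h1, h2, h0 n m h]

theorem kappa_le (n : ℕ) (m : ℤ) : kappa n m ≤ n + 1 := by
  refine Real.sqrt_le_iff.2 ⟨by positivity, ?_⟩
  nlinarith [sq_nonneg ((m : ℝ) + 1 / 2), (n.cast_nonneg : (0 : ℝ) ≤ n)]

/-- One derivative costs one factor `n + 1`, because `kappa n m ≤ n + 1` and `|m| ≤ n`. -/
theorem summable_rotCoeff (i : Fin 3) {c : ℕ → ℤ → ℂ}
    (h0 : ∀ (n : ℕ) (m : ℤ), (n : ℤ) < |m| → c n m = 0)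
    (hc : Summable fun q : ℕ × ℤ => ‖((q.1 : ℂ) + 1) * c q.1 q.2‖ ^ 2) :
    Summable fun q : ℕ × ℤ => ‖rotCoeff i c q.1 q.2‖ ^ 2 := by
  have hn : ∀ n : ℕ, ‖((n : ℂ) + 1)‖ = n + 1 := fun n => by
    have : ((n : ℂ) + 1) = ((n + 1 : ℝ) : ℂ) := by push_cast; ring
    rw [this, Complex.norm_real, Real.norm_of_nonneg (by positivity)]
  have hshift : ∀ k : ℤ, Summable fun q : ℕ × ℤ => ‖((q.1 : ℂ) + 1) * c q.1 (q.2 + k)‖ ^ 2 :=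
    fun k => (Equiv.summable_iff ((Equiv.refl ℕ).prodCongr (Equiv.addRight k))).2 hc
  have hk : ∀ (n : ℕ) (m l : ℤ), ‖(kappa n m : ℂ) * c n l‖ ≤ ‖((n : ℂ) + 1) * c n l‖ := by
    intro n m l
    rw [norm_mul, norm_mul, hn, Complex.norm_real, Real.norm_of_nonneg (kappa_nonneg n m)]
    gcongr
    exact kappa_le n m
  have hhalf : ∀ (n : ℕ) (m : ℤ) (z : ℂ), ‖z‖ ≤ 1 / 2 * (‖((n : ℂ) + 1) * c n (m - 1)‖ +
      ‖((n : ℂ) + 1) * c n (m + 1)‖) → ‖z‖ ^ 2 ≤ ‖((n : ℂ) + 1) * c n (m + -1)‖ ^ 2 +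
      ‖((n : ℂ) + 1) * c n (m + 1)‖ ^ 2 := by
    intro n m z hz
    rw [← sub_eq_add_neg]
    have := pow_le_pow_left₀ (norm_nonneg z) hz 2
    nlinarith [sq_nonneg (‖((n : ℂ) + 1) * c n (m - 1)‖ - ‖((n : ℂ) + 1) * c n (m + 1)‖),
      sq_nonneg ‖((n : ℂ) + 1) * c n (m - 1)‖, sq_nonneg ‖((n : ℂ) + 1) * c n (m + 1)‖]
  fin_cases i
  · refine Summable.of_nonneg_of_le (fun q => by positivity) (fun q => hhalf q.1 q.2 _ ?_)
      ((hshift (-1)).add (hshift 1))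
    change ‖Complex.I / 2 * (_ + _)‖ ≤ _
    rw [norm_mul, norm_div, Complex.norm_I, Complex.norm_ofNat]
    gcongr
    exact (norm_add_le _ _).trans (add_le_add (hk _ _ _) (hk _ _ _))
  · refine Summable.of_nonneg_of_le (fun q => by positivity) (fun q => hhalf q.1 q.2 _ ?_)
      ((hshift (-1)).add (hshift 1))
    change ‖1 / 2 * (_ - _)‖ ≤ _
    rw [norm_mul, norm_div, norm_one, Complex.norm_ofNat]
    gcongr
    exact (norm_sub_le _ _).trans (add_le_add (hk _ _ _) (hk _ _ _))
  · refine Summable.of_nonneg_of_le (fun q => by positivity) (fun q => ?_) hc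
    change ‖Complex.I * q.2 * c q.1 q.2‖ ^ 2 ≤ _
    by_cases h : |q.2| ≤ q.1
    · have h1 : (|q.2| : ℝ) ≤ q.1 := by exact_mod_cast h
      rw [norm_mul, norm_mul, Complex.norm_I, one_mul, Complex.norm_intCast, norm_mul, hn]
      gcongr
      linarith
    · rw [h0 _ _ (not_le.1 h)]
      simp

theorem rotCoeff_mul (i : Fin 3) (d : ℕ → ℂ) (c : ℕ → ℤ → ℂ) (n : ℕ) (m : ℤ) :
    rotCoeff i (fun n m => d n * c n m) n m = d n * rotCoeff i c n m := by
  fin_cases i <;> simp [rotCoeff] <;> ring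

/-- `u ∈ H²(S²)` and `Δ u = f`, in terms of coefficients. -/
theorem hasLaplacian_iff {u f : LTwo} : HasLaplacian u f ↔
    ∀ n m, coeff f n m = -((n : ℂ) * (n + 1)) * coeff u n m := by
  have hz : ∀ (u : LTwo) (n : ℕ) (m : ℤ), (n : ℤ) < |m| → coeff u n m = 0 :=
    fun u n m h => coeff_eq_zero u h
  constructor
  · rintro ⟨v, w, hv, hw, rfl⟩ n m
    rw [coeff_sum, ← sum_rotCoeff_rotCoeff (hz u)]
    refine Finset.sum_congr rfl fun i _ => ?_
    rw [coeff_of_isWeakRotDeriv (hw i i)]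
    congr 1
    ext n m
    exact coeff_of_isWeakRotDeriv (hv i) n m
  · intro h
    -- For `n ≥ 1`, `(n+1)² ≤ 4n(n+1)`, whence the factor `16` after squaring. Degree zero, where
    -- the Laplacian carries no information, is covered by the coefficient of `u` itself.
    have hs : Summable fun q : ℕ × ℤ =>
        ‖((q.1 : ℂ) + 1) * (((q.1 : ℂ) + 1) * coeff u q.1 q.2)‖ ^ 2 := by
      refine Summable.of_nonneg_of_le (fun q => by positivity) (fun q => ?_)
        (((hasSum_norm_sq_coeff f).summable.mul_left 16).add (hasSum_norm_sq_coeff u).summable)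
      have e1 : ∀ r : ℝ, ∀ z : ℂ, 0 ≤ r → ‖(r : ℂ) * z‖ = r * ‖z‖ := fun r z hr => by
        rw [norm_mul, Complex.norm_real, Real.norm_of_nonneg hr]
      have e2 : ((q.1 : ℂ) + 1) * (((q.1 : ℂ) + 1) * coeff u q.1 q.2) =
          (((q.1 + 1) * (q.1 + 1) : ℝ) : ℂ) * coeff u q.1 q.2 := by push_cast; ring
      have e3 : -((q.1 : ℂ) * (q.1 + 1)) * coeff u q.1 q.2 =
          -((((q.1 * (q.1 + 1)) : ℝ) : ℂ) * coeff u q.1 q.2) := by push_cast; ring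
      rw [h, e3, norm_neg, e2, e1 _ _ (by positivity), e1 _ _ (by positivity)]
      rcases Nat.eq_zero_or_pos q.1 with h0 | hpos
      · rw [h0]
        simp
      · have h1 : (1 : ℝ) ≤ q.1 := by exact_mod_cast hpos
        have h2 : ((q.1 : ℝ) + 1) * (q.1 + 1) ≤ 4 * (q.1 * (q.1 + 1)) := by nlinarith
        have h3 := mul_le_mul_of_nonneg_right h2 (norm_nonneg (coeff u q.1 q.2))
        have h4 := pow_le_pow_left₀ (by positivity) h3 2
        nlinarith [sq_nonneg ‖coeff u q.1 q.2‖]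
    have hs1 : Summable fun q : ℕ × ℤ => ‖((q.1 : ℂ) + 1) * coeff u q.1 q.2‖ ^ 2 := by
      refine Summable.of_nonneg_of_le (fun q => by positivity) (fun q => ?_) hs
      have : (1 : ℝ) ≤ ‖((q.1 : ℂ) + 1)‖ := by
        have : ((q.1 : ℂ) + 1) = ((q.1 + 1 : ℝ) : ℂ) := by push_cast; ring
        rw [this, Complex.norm_real, Real.norm_of_nonneg (by positivity)]
        linarith [(q.1.cast_nonneg : (0 : ℝ) ≤ q.1)]
      rw [norm_mul ((q.1 : ℂ) + 1) (((q.1 : ℂ) + 1) * coeff u q.1 q.2)]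
      gcongr
      exact le_mul_of_one_le_left (norm_nonneg _) this
    have hv : ∀ i, ∃ v : LTwo, ∀ n m, coeff v n m = rotCoeff i (coeff u) n m := fun i =>
      exists_coeff_eq (rotCoeff_eq_zero i (hz u)) (summable_rotCoeff i (hz u) hs1)
    choose v hv using hv
    have hw : ∀ i j, ∃ w : LTwo, ∀ n m, coeff w n m = rotCoeff j (coeff (v i)) n m := by
      intro i j
      refine exists_coeff_eq (rotCoeff_eq_zero j (hz (v i))) (summable_rotCoeff j (hz (v i)) ?_)
      have := summable_rotCoeff i (c := fun n m => ((n : ℂ) + 1) * coeff u n m)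
        (fun n m h => by rw [hz u n m h, mul_zero]) hs
      refine this.congr fun q => ?_
      rw [hv, rotCoeff_mul i (fun n => (n : ℂ) + 1)]
    choose w hw using hw
    refine ⟨v, w, fun i => isWeakRotDeriv_of_coeff (hv i),
      fun i j => isWeakRotDeriv_of_coeff (hw i j), ext_coeff fun n m => ?_⟩
    rw [h, coeff_sum, ← sum_rotCoeff_rotCoeff (hz u)]
    refine Finset.sum_congr rfl fun i _ => ?_
    rw [hw]
    congr 1
    ext n m
    exact (hv i n m).symm

end WeakDerivatives

/-! ### Functions of zero mean, diagonal operators, and the generator in coefficients -/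

section MeanZero

open scoped ComplexConjugate

theorem mem_LTwoZero_iff (u : LTwo) : u ∈ LTwoZero ↔ coeff u 0 0 = 0 := by
  have hpi := Real.pi_pos
  have h : coeff u 0 0 = ((1 / Real.sqrt (4 * Real.pi) : ℝ) : ℂ) * ∫ x, u x ∂surf := by
    rw [coeff_eq_integral, ← integral_const_mul]
    refine integral_congr_ae (Eventually.of_forall fun x => ?_)
    simp only [solid_zero_zero, Complex.conj_ofReal]
    ring
  have hne : ((1 / Real.sqrt (4 * Real.pi) : ℝ) : ℂ) ≠ 0 := by
    have : (1 / Real.sqrt (4 * Real.pi) : ℝ) ≠ 0 := by positivity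
    exact_mod_cast this
  rw [h, mul_eq_zero, or_iff_right hne]
  rfl

theorem coeff_zero_zero (u : LTwoZero) : coeff u 0 0 = 0 := (mem_LTwoZero_iff u.1).1 u.2

theorem coeff_degree_zero (u : LTwoZero) (m : ℤ) : coeff u 0 m = 0 := by
  rcases eq_or_ne m 0 with rfl | h
  · exact coeff_zero_zero u
  · refine coeff_eq_zero _ ?_
    have := abs_pos.2 h
    simpa using this

instance : CompleteSpace LTwoZero := by
  have : IsClosed (LTwoZero : Set LTwo) := by
    have h : (LTwoZero : Set LTwo) = (fun u => coeff u 0 0) ⁻¹' {0} := by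
      ext u
      exact mem_LTwoZero_iff u
    rw [h]
    exact isClosed_singleton.preimage (continuous_coeff 0 0)
  exact this.completeSpace_coe

theorem ext_coeff_zero {u v : LTwoZero}
    (h : ∀ (n : ℕ) (m : ℤ), 1 ≤ n → |m| ≤ n → coeff u n m = coeff v n m) : u = v := by
  refine Subtype.ext (ext_coeff fun n m => ?_)
  rcases Nat.eq_zero_or_pos n with rfl | hn
  · rw [coeff_degree_zero, coeff_degree_zero]
  · by_cases hm : |m| ≤ n
    · exact h n m hn hm
    · rw [coeff_eq_zero _ (not_le.1 hm), coeff_eq_zero _ (not_le.1 hm)]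

/-- Boundedness of a multiplier on the index set of `L²₀`. -/
def IsMultiplier (d : ℕ → ℤ → ℂ) (K : ℝ) : Prop := ∀ (n : ℕ) (m : ℤ), 1 ≤ n → |m| ≤ n → ‖d n m‖ ≤ K

theorem exists_diag {d : ℕ → ℤ → ℂ} {K : ℝ} (hd : IsMultiplier d K) (u : LTwoZero) :
    ∃ v : LTwoZero, ∀ n m, coeff v n m = d n m * coeff u n m := by
  have hle : ∀ n m, ‖d n m * coeff u n m‖ ≤ K * ‖coeff u n m‖ := by
    intro n m
    rcases Nat.eq_zero_or_pos n with rfl | hn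
    · rw [coeff_degree_zero]; simp
    · by_cases hm : |m| ≤ n
      · rw [norm_mul]
        gcongr
        exact hd n m hn hm
      · rw [coeff_eq_zero _ (not_le.1 hm)]; simp
  obtain ⟨v, hv⟩ := exists_coeff_eq (c := fun n m => d n m * coeff u n m)
    (fun n m h => by rw [coeff_eq_zero _ h, mul_zero])
    (Summable.of_nonneg_of_le (fun q => by positivity)
      (fun q => (pow_le_pow_left₀ (norm_nonneg _) (hle q.1 q.2) 2).trans_eq (mul_pow _ _ _))
      ((hasSum_norm_sq_coeff (u : LTwo)).summable.mul_left (K ^ 2)))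
  exact ⟨⟨v, by rw [mem_LTwoZero_iff, hv, coeff_zero_zero, mul_zero]⟩, hv⟩

/-- The diagonal operator with the bounded multiplier `d`. -/
def diagOp (d : ℕ → ℤ → ℂ) {K : ℝ} (hd : IsMultiplier d K) : LTwoZero →L[ℂ] LTwoZero :=
  LinearMap.mkContinuous
    { toFun := fun u => (exists_diag hd u).choose
      map_add' := fun u v => by
        refine ext_coeff_zero fun n m _ _ => ?_
        rw [(exists_diag hd (u + v)).choose_spec, Submodule.coe_add, Submodule.coe_add, coeff_add,
          coeff_add, (exists_diag hd u).choose_spec, (exists_diag hd v).choose_spec, mul_add]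
      map_smul' := fun c u => by
        refine ext_coeff_zero fun n m _ _ => ?_
        rw [(exists_diag hd (c • u)).choose_spec, RingHom.id_apply, Submodule.coe_smul,
          Submodule.coe_smul, coeff_smul, coeff_smul, (exists_diag hd u).choose_spec]
        ring } K fun u => by
      have hK : 0 ≤ K := (norm_nonneg _).trans (hd 1 0 le_rfl (by simp))
      refine le_of_sq_le_sq ?_ (by positivity)
      rw [mul_pow]
      refine hasSum_le (fun q => ?_) (hasSum_norm_sq_coeff ((exists_diag hd u).choose : LTwo))
        ((hasSum_norm_sq_coeff (u : LTwo)).mul_left (K ^ 2))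
      rw [(exists_diag hd u).choose_spec, norm_mul, mul_pow]
      rcases Nat.eq_zero_or_pos q.1 with hn | hn
      · rw [hn, coeff_degree_zero]; simp
      · by_cases hm : |q.2| ≤ q.1
        · gcongr
          exact hd _ _ hn hm
        · rw [coeff_eq_zero _ (not_le.1 hm)]; simp

theorem coeff_diagOp {d : ℕ → ℤ → ℂ} {K : ℝ} (hd : IsMultiplier d K) (u : LTwoZero) (n : ℕ) (m : ℤ) :
    coeff (diagOp d hd u : LTwo) n m = d n m * coeff u n m :=
  (exists_diag hd u).choose_spec n m

theorem norm_diagOp_le {d : ℕ → ℤ → ℂ} {K : ℝ} (hd : IsMultiplier d K) : ‖diagOp d hd‖ ≤ K :=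
  LinearMap.mkContinuous_norm_le _ ((norm_nonneg _).trans (hd 1 0 le_rfl (by simp))) _

/-- Multiplication by `cos θ`, compressed to `L²₀(S²)`. -/
def cosOp : LTwoZero →L[ℂ] LTwoZero :=
  ContinuousLinearMap.codRestrict
    ((mulCos - (innerSL ℂ (sphHarm 0 0) ∘L mulCos).smulRight (sphHarm 0 0)) ∘L LTwoZero.subtypeL)
    LTwoZero fun u => by
      rw [mem_LTwoZero_iff]
      change coeff (mulCos u - coeff (mulCos u) 0 0 • sphHarm 0 0) 0 0 = 0
      rw [coeff_sub, coeff_smul, coeff_sphHarm]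
      simp

theorem coe_cosOp (u : LTwoZero) :
    (cosOp u : LTwo) = mulCos u - coeff (mulCos u) 0 0 • sphHarm 0 0 := rfl

theorem coeff_cosOp_of_pos (u : LTwoZero) {n : ℕ} (hn : 1 ≤ n) (m : ℤ) :
    coeff (cosOp u : LTwo) n m = coeff (mulCos u) n m := by
  rw [coe_cosOp, coeff_sub, coeff_smul, coeff_sphHarm, if_neg (by omega), mul_zero, sub_zero]

theorem coeff_cosOp (u : LTwoZero) {n : ℕ} (hn : 1 ≤ n) (m : ℤ) :
    coeff (cosOp u : LTwo) n m =
      alpha (n + 1) m * coeff u (n + 1) m + alpha n m * coeff u (n - 1) m := by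
  rw [coeff_cosOp_of_pos u hn, coeff_mulCos]

theorem inner_sphHarm_zero (u : LTwoZero) : inner ℂ (sphHarm 0 0) (u : LTwo) = 0 :=
  coeff_zero_zero u

/-- A compression of the symmetric operator `mulCos`: the subtracted constant is orthogonal to
functions of zero mean. -/
theorem inner_cosOp (u v : LTwoZero) : inner ℂ (cosOp u) v = inner ℂ u (cosOp v) := by
  rw [Submodule.coe_inner, Submodule.coe_inner, coe_cosOp, coe_cosOp, inner_sub_left,
    inner_sub_right, inner_smul_left, inner_smul_right, inner_sphHarm_zero, inner_mulCos,
    ← inner_conj_symm (u : LTwo) (sphHarm 0 0), inner_sphHarm_zero, map_zero, mul_zero, mul_zero]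

theorem inner_diagOp {d : ℕ → ℤ → ℂ} {K : ℝ} (hd : IsMultiplier d K) (hr : ∀ n m, conj (d n m) = d n m)
    (u v : LTwoZero) : inner ℂ (diagOp d hd u) v = inner ℂ u (diagOp d hd v) := by
  rw [Submodule.coe_inner, Submodule.coe_inner]
  refine (hasSum_inner_coeff _ _).unique ((hasSum_inner_coeff _ _).congr_fun fun q => ?_)
  rw [coeff_diagOp, coeff_diagOp, map_mul, hr]
  ring

/-! ### The operators in terms of coefficients -/

/-- The eigenvalue `1 - 6/(n(n+1))` of `I + 6 Δ⁻¹`. -/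
def gap (n : ℕ) : ℝ := 1 - 6 / ((n : ℝ) * (n + 1))

theorem abs_gap_le (n : ℕ) : |gap n| ≤ 2 := by
  rcases Nat.eq_zero_or_pos n with rfl | hn
  · simp [gap]
  · have h1 : (1 : ℝ) ≤ n := by exact_mod_cast hn
    have h2 : 6 / ((n : ℝ) * (n + 1)) ≤ 3 := by
      rw [div_le_iff₀ (by positivity)]
      nlinarith
    have h3 : 0 ≤ 6 / ((n : ℝ) * (n + 1)) := by positivity
    rw [gap, abs_le]
    constructor <;> linarith

theorem isMultiplier_gap : IsMultiplier (fun n _ => (gap n : ℂ)) 2 := fun n m _ _ => by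
  rw [Complex.norm_real]
  exact abs_gap_le n

/-- The operator `I + 6 Δ⁻¹`. -/
def gapOp : LTwoZero →L[ℂ] LTwoZero := diagOp _ isMultiplier_gap

theorem coeff_gapOp (u : LTwoZero) (n : ℕ) (m : ℤ) : coeff (gapOp u : LTwo) n m = gap n * coeff u n m :=
  coeff_diagOp _ _ _ _

theorem isMultiplier_ratio : IsMultiplier (fun n m => (m : ℂ) / ((n : ℂ) * (n + 1))) 1 := by
  intro n m hn hm
  change ‖(m : ℂ) / ((n : ℂ) * (n + 1))‖ ≤ 1
  have e : (m : ℂ) / ((n : ℂ) * (n + 1)) = (((m : ℝ) / (n * (n + 1)) : ℝ) : ℂ) := by push_cast; rfl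
  have h1 : (1 : ℝ) ≤ n := by exact_mod_cast hn
  have h2 : |(m : ℝ)| ≤ n := by exact_mod_cast hm
  rw [e, Complex.norm_real, Real.norm_eq_abs, abs_div, abs_of_pos (by positivity : (0 : ℝ) < n * (n + 1)),
    div_le_one (by positivity)]
  nlinarith

theorem isMultiplier_invLaplacian : IsMultiplier (fun n _ => -1 / ((n : ℂ) * (n + 1))) 1 := by
  intro n m hn hm
  change ‖-1 / ((n : ℂ) * (n + 1))‖ ≤ 1
  have e : -1 / ((n : ℂ) * (n + 1)) = ((-1 / (n * (n + 1)) : ℝ) : ℂ) := by push_cast; rfl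
  have h1 : (1 : ℝ) ≤ n := by exact_mod_cast hn
  rw [e, Complex.norm_real, Real.norm_eq_abs, abs_div, abs_of_pos (by positivity : (0 : ℝ) < n * (n + 1)),
    div_le_one (by positivity)]
  norm_num
  nlinarith

/-- The graph of `𝓛^{ν,a}` in terms of coefficients. -/
def SpecGraph (ν a : ℝ) (u f : LTwoZero) : Prop :=
  ∃ k : LTwoZero, (∀ n m, coeff k n m = (n : ℂ) * (n + 1) * coeff u n m) ∧
    ∀ (n : ℕ) (m : ℤ), 1 ≤ n → coeff f n m = ν * (2 - (n : ℂ) * (n + 1)) * coeff u n m -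
      Complex.I * a * m * coeff (cosOp (gapOp u) : LTwo) n m

theorem add_smul_eq_gapOp {u p : LTwoZero}
    (h : ∀ n m, coeff u n m = -((n : ℂ) * (n + 1)) * coeff p n m) :
    (u : LTwo) + (6 : ℂ) • (p : LTwo) = gapOp u := by
  refine ext_coeff fun n m => ?_
  rw [coeff_add, coeff_smul, coeff_gapOp, gap]
  rcases Nat.eq_zero_or_pos n with rfl | hn
  · rw [coeff_degree_zero, coeff_degree_zero]; simp
  · have h1 : (n : ℂ) ≠ 0 := by exact_mod_cast hn.ne'
    have h2 : (n : ℂ) + 1 ≠ 0 := by exact_mod_cast (Nat.succ_ne_zero n)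
    rw [h]
    push_cast
    field_simp
    ring

theorem graphLambda_coeff {u p : LTwoZero} {v : LTwo} (hp : HasLaplacian p u)
    (hv : IsWeakRotDeriv 2 (fun x => ((x.1 2 : ℝ) : ℂ) * (u.1 x + 6 * p.1 x)) v) :
    ∀ n m, coeff v n m = Complex.I * m * coeff (mulCos (gapOp u)) n m := by
  have hae : (fun x : S2 => ((x.1 2 : ℝ) : ℂ) * (u.1 x + 6 * p.1 x)) =ᵐ[surf] mulCos (gapOp u) := by
    rw [← add_smul_eq_gapOp (hasLaplacian_iff.1 hp)]
    filter_upwards [coeFn_mulCos ((u : LTwo) + (6 : ℂ) • (p : LTwo)),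
      Lp.coeFn_add (u : LTwo) ((6 : ℂ) • (p : LTwo)), Lp.coeFn_smul (6 : ℂ) (p : LTwo)] with x h1 h2 h3
    rw [h1, h2, Pi.add_apply, h3]
    rfl
  rw [IsWeakRotDeriv.congr_ae hae] at hv
  exact coeff_of_isWeakRotDeriv hv

/-- Replaces weak derivatives by equations between coefficients. Dropping the constant part of `cos
θ` times a function changes nothing, since it has order `m = 0` and the longitude derivative kills
it; hence `cosOp` may stand for `mulCos`, and degree zero may be ignored. -/
theorem graphL_iff (ν a : ℝ) (u f : LTwoZero) : GraphL ν a u f ↔ SpecGraph ν a u f := by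
  constructor
  · rintro ⟨g, h, ⟨f', hf', hg⟩, ⟨p, v, hp, hv, hh⟩, rfl⟩
    have hv' := graphLambda_coeff hp hv
    have hf := hasLaplacian_iff.1 hf'
    have hgc : ∀ n m, coeff (g : LTwo) n m = (2 - (n : ℂ) * (n + 1)) * coeff u n m := fun n m => by
      rw [hg, coeff_add, coeff_smul, hf]
      ring
    refine ⟨(2 : ℂ) • u - g, fun n m => ?_, fun n m hn => ?_⟩
    · rw [Submodule.coe_sub, Submodule.coe_smul, coeff_sub, coeff_smul, hgc]
      ring
    · rw [Submodule.coe_sub, Submodule.coe_smul, Submodule.coe_smul, coeff_sub, coeff_smul,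
        coeff_smul, hgc, hh, coeff_smul, hv', coeff_cosOp_of_pos _ hn]
      linear_combination (a * m * coeff (mulCos (gapOp u)) n m * Complex.I) * Complex.I_sq
  · rintro ⟨k, hk, hf⟩
    -- The longitude derivative of `u`, up to the factor `i`. It is in `L²` because `m/(n(n+1))` is
    -- a bounded multiplier applied to `k = -Δu`.
    set mu : LTwoZero := diagOp _ isMultiplier_ratio k
    have hmu : ∀ n m, coeff (mu : LTwo) n m = m * coeff u n m := fun n m => by
      rw [coeff_diagOp, hk]
      rcases Nat.eq_zero_or_pos n with rfl | hn
      · rw [coeff_degree_zero]; simp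
      · have h1 : (n : ℂ) ≠ 0 := by exact_mod_cast hn.ne'
        have h2 : (n : ℂ) + 1 ≠ 0 := by exact_mod_cast (Nat.succ_ne_zero n)
        field_simp
    set p : LTwoZero := diagOp _ isMultiplier_invLaplacian u
    have hp : ∀ n m, coeff u n m = -((n : ℂ) * (n + 1)) * coeff p n m := fun n m => by
      rw [coeff_diagOp]
      rcases Nat.eq_zero_or_pos n with rfl | hn
      · rw [coeff_degree_zero]; simp
      · have h1 : (n : ℂ) ≠ 0 := by exact_mod_cast hn.ne'
        have h2 : (n : ℂ) + 1 ≠ 0 := by exact_mod_cast (Nat.succ_ne_zero n)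
        field_simp
    have hm : ∀ n m, coeff (cosOp (gapOp mu) : LTwo) n m = m * coeff (mulCos (gapOp u)) n m := by
      intro n m
      rcases Nat.eq_zero_or_pos n with rfl | hn
      · rw [coeff_degree_zero]
        rcases eq_or_ne m 0 with rfl | h
        · simp
        · rw [coeff_eq_zero, mul_zero]
          have := abs_pos.2 h
          simpa using this
      · rw [coeff_cosOp _ hn, coeff_mulCos, coeff_gapOp, coeff_gapOp, coeff_gapOp, coeff_gapOp, hmu,
          hmu]
        ring
    refine ⟨(2 : ℂ) • u - k, cosOp (gapOp mu), ⟨-k, ?_, ?_⟩,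
      ⟨p, Complex.I • (cosOp (gapOp mu) : LTwo), hasLaplacian_iff.2 hp, ?_, ?_⟩, ?_⟩
    · rw [hasLaplacian_iff]
      intro n m
      rw [← neg_one_smul ℂ, coeff_smul, hk]
      ring
    · rw [Submodule.coe_sub, Submodule.coe_smul]
      abel
    · have hae : (fun x : S2 => ((x.1 2 : ℝ) : ℂ) * (u.1 x + 6 * p.1 x)) =ᵐ[surf]
          mulCos (gapOp u) := by
        rw [← add_smul_eq_gapOp hp]
        filter_upwards [coeFn_mulCos ((u : LTwo) + (6 : ℂ) • (p : LTwo)),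
          Lp.coeFn_add (u : LTwo) ((6 : ℂ) • (p : LTwo)), Lp.coeFn_smul (6 : ℂ) (p : LTwo)]
          with x h1 h2 h3
        rw [h1, h2, Pi.add_apply, h3]
        rfl
      rw [IsWeakRotDeriv.congr_ae hae]
      refine isWeakRotDeriv_of_coeff fun n m => ?_
      rw [coeff_smul, hm]
      simp only [rotCoeff, Matrix.cons_val]
      ring
    · rw [smul_smul]
      simp
    · refine ext_coeff_zero fun n m hn _ => ?_
      rw [hf n m hn, Submodule.coe_sub, Submodule.coe_smul, Submodule.coe_smul, coeff_sub,
        coeff_smul, coeff_smul, Submodule.coe_sub, coeff_sub, Submodule.coe_smul, coeff_smul, hk, hm,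
        coeff_cosOp_of_pos _ hn]
      ring

end MeanZero

/-! ### Inversion by Neumann series -/

section Neumann

variable {X : Type*} [NormedAddCommGroup X] [NormedSpace ℂ X] [CompleteSpace X]

theorem exists_inverse_add_smul (c : ℂ) (A F : X →L[ℂ] X) (h : ‖c‖ * (‖A‖ * ‖F‖) < 1) :
    ∃ B : X →L[ℂ] X, (∀ y, B (y + c • A (F y)) = y) ∧ ∀ y, B y + c • A (F (B y)) = y := by
  have hK : ‖-c • (A * F)‖ < 1 := by
    rw [norm_smul, norm_neg]
    exact lt_of_le_of_lt (by gcongr; exact norm_mul_le _ _) h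
  set U := Units.oneSub _ hK
  have hU : ∀ y, (U : X →L[ℂ] X) y = y + c • A (F y) := fun y => by
    change y - -c • A (F y) = _
    rw [neg_smul, sub_neg_eq_add]
  refine ⟨↑U⁻¹, fun y => ?_, fun y => ?_⟩
  · rw [← hU]
    change ((↑U⁻¹ : X →L[ℂ] X) * U) y = y
    rw [Units.inv_mul]
    rfl
  · rw [← hU]
    change ((U : X →L[ℂ] X) * ↑U⁻¹) y = y
    rw [Units.mul_inv]
    rfl

end Neumann

/-! ### Dense domain and resolvents -/

section Generation

open scoped ComplexConjugate

/-- Both `cos θ` and `I + 6Δ⁻¹` preserve the order `m`, so the longitude derivative may act first.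
This puts transport in the form of a bounded operator applied to `m u`. -/
theorem coeff_cosOp_gapOp_of_mul {u v : LTwoZero} (h : ∀ n m, coeff v n m = m * coeff u n m)
    (n : ℕ) (m : ℤ) :
    coeff (cosOp (gapOp v) : LTwo) n m = m * coeff (cosOp (gapOp u) : LTwo) n m := by
  rcases Nat.eq_zero_or_pos n with rfl | hn
  · rw [coeff_degree_zero, coeff_degree_zero, mul_zero]
  · rw [coeff_cosOp _ hn, coeff_cosOp _ hn, coeff_gapOp, coeff_gapOp, coeff_gapOp, coeff_gapOp, h, h]
    ring

theorem exists_mul_of_laplacian {u k : LTwoZero}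
    (hk : ∀ n m, coeff k n m = (n : ℂ) * (n + 1) * coeff u n m) :
    ∃ v : LTwoZero, ∀ n m, coeff v n m = m * coeff u n m := by
  refine ⟨diagOp _ isMultiplier_ratio k, fun n m => ?_⟩
  rw [coeff_diagOp, hk]
  rcases Nat.eq_zero_or_pos n with rfl | hn
  · rw [coeff_degree_zero]; simp
  · have h1 : (n : ℂ) ≠ 0 := by exact_mod_cast hn.ne'
    have h2 : (n : ℂ) + 1 ≠ 0 := by exact_mod_cast (Nat.succ_ne_zero n)
    field_simp

theorem specGraph_iff {ν a : ℝ} {u f : LTwoZero} : SpecGraph ν a u f ↔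
    ∃ k v : LTwoZero, (∀ n m, coeff k n m = (n : ℂ) * (n + 1) * coeff u n m) ∧
      (∀ n m, coeff v n m = m * coeff u n m) ∧
      f = (ν : ℂ) • ((2 : ℂ) • u - k) - (Complex.I * a) • cosOp (gapOp v) := by
  constructor
  · rintro ⟨k, hk, hf⟩
    obtain ⟨v, hv⟩ := exists_mul_of_laplacian hk
    refine ⟨k, v, hk, hv, ext_coeff_zero fun n m hn _ => ?_⟩
    rw [hf n m hn]
    simp only [Submodule.coe_sub, Submodule.coe_smul, coeff_sub, coeff_smul, hk,
      coeff_cosOp_gapOp_of_mul hv]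
    ring
  · rintro ⟨k, v, hk, hv, rfl⟩
    refine ⟨k, hk, fun n m _ => ?_⟩
    simp only [Submodule.coe_sub, Submodule.coe_smul, coeff_sub, coeff_smul, hk,
      coeff_cosOp_gapOp_of_mul hv]
    ring

/-- The range of the inverse Laplacian lies in the domain; that operator is symmetric and injective,
so its range is dense. -/
theorem dense_specGraph (ν a : ℝ) : Dense {u | ∃ f, SpecGraph ν a u f} := by
  set E := diagOp _ isMultiplier_invLaplacian
  have hE : ∀ y n m, coeff (E y : LTwo) n m = -1 / ((n : ℂ) * (n + 1)) * coeff y n m :=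
    fun y n m => coeff_diagOp _ _ _ _
  have hne : ∀ n : ℕ, 1 ≤ n → (n : ℂ) * (n + 1) ≠ 0 := fun n hn =>
    mul_ne_zero (by exact_mod_cast (by omega : n ≠ 0)) (by exact_mod_cast (Nat.succ_ne_zero n))
  have hdom : ∀ y, ∃ f, SpecGraph ν a (E y) f := fun y => by
    have hk : ∀ n m, coeff (-y : LTwoZero) n m = (n : ℂ) * (n + 1) * coeff (E y : LTwo) n m := by
      intro n m
      rw [hE, Submodule.coe_neg, ← neg_one_smul ℂ, coeff_smul]
      rcases Nat.eq_zero_or_pos n with rfl | hn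
      · rw [coeff_degree_zero]; simp
      · have := hne n hn
        rw [← mul_assoc, mul_div_cancel₀ _ this]
    obtain ⟨v, hv⟩ := exists_mul_of_laplacian hk
    exact ⟨_, specGraph_iff.2 ⟨-y, v, hk, hv, rfl⟩⟩
  have hd : (E.toLinearMap.range).topologicalClosure = ⊤ := by
    rw [Submodule.topologicalClosure_eq_top_iff, Submodule.eq_bot_iff]
    intro x hx
    have h0 : E x = 0 := by
      rw [← inner_self_eq_zero (𝕜 := ℂ)]
      have : inner ℂ (E x) (E x) = inner ℂ (E (E x)) x := by
        exact (inner_diagOp _ (fun n m => by simp) _ _).symm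
      rw [this]
      exact hx _ ⟨E x, rfl⟩
    refine ext_coeff_zero fun n m hn _ => ?_
    have h1 := hE x n m
    rw [h0] at h1
    have h2 := hne n hn
    rw [Submodule.coe_zero, coeff_zero] at h1 ⊢
    have h3 : -1 / ((n : ℂ) * (n + 1)) ≠ 0 := div_ne_zero (by norm_num) h2
    exact (mul_eq_zero.1 h1.symm).resolve_left h3
  refine (Submodule.dense_iff_topologicalClosure_eq_top.2 hd).mono ?_
  rintro _ ⟨y, rfl⟩
  exact hdom y

/-- Let `E = (lam - νA)⁻¹` and `F = mE`, both diagonal. Then `lam - 𝓛 = (1 + ia cosOp gapOp F) E⁻¹`,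
and for large `lam` the operator `F` is small enough for a Neumann series, so the resolvent is `E`
after the inverse `B` of the bracket. -/
theorem exists_resolvent {ν : ℝ} (hν : 0 < ν) (a : ℝ) : ∃ lam₀ : ℝ, 0 ≤ lam₀ ∧ ∀ lam : ℝ, lam₀ < lam →
    ∃ R : LTwoZero →L[ℂ] LTwoZero, ∀ u f, SpecGraph ν a u f ↔ u = R ((lam : ℂ) • u - f) := by
  -- The size allowed for `F`: it makes `|a| ‖cosOp ∘L gapOp‖ δ < 1`.
  set δ : ℝ := 1 / ((|a| + 1) * (‖cosOp ∘L gapOp‖ + 1)) with hδ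
  have hδ0 : 0 < δ := by positivity
  -- Completing the square gives `n/δ ≤ νn² + 1/(νδ²)`; the summand `2ν` offsets the `2` in `A`.
  -- Together they yield `|m| / den n ≤ δ`.
  refine ⟨2 * ν + 1 / (ν * δ ^ 2), by positivity, fun lam hlam => ?_⟩
  have hlam0 : 2 * ν < lam := lt_of_le_of_lt (le_add_of_nonneg_right (by positivity)) hlam
  have htwo : ∀ n : ℕ, 1 ≤ n → (0 : ℝ) ≤ n * (n + 1) - 2 := fun n hn => by
    have h1 : (1 : ℝ) ≤ n := by exact_mod_cast hn
    nlinarith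
  have hden : ∀ n : ℕ, 1 ≤ n → ν < lam + ν * (n * (n + 1) - 2) := fun n hn => by
    have := mul_nonneg hν.le (htwo n hn)
    linarith
  have hden' : ∀ n : ℕ, 1 ≤ n → (n : ℝ) / δ < lam + ν * (n * (n + 1) - 2) := fun n hn => by
    have h1 : (1 : ℝ) ≤ n := by exact_mod_cast hn
    have h2 : (n : ℝ) / δ ≤ ν * n ^ 2 + 1 / (ν * δ ^ 2) := by
      have : ν * n ^ 2 + 1 / (ν * δ ^ 2) - n / δ = (ν * n - 1 / (2 * δ)) ^ 2 / ν + 3 / (4 * ν * δ ^ 2) := by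
        field_simp
        ring
      have h3 : 0 ≤ (ν * n - 1 / (2 * δ)) ^ 2 / ν + 3 / (4 * ν * δ ^ 2) := by positivity
      linarith
    nlinarith
  set den : ℕ → ℝ := fun n => lam + ν * (n * (n + 1) - 2) with hdendef
  have hpos : ∀ n, 1 ≤ n → 0 < den n := fun n hn => lt_trans (by positivity) (hden n hn)
  have hdenc : ∀ n, 1 ≤ n → (den n : ℂ) ≠ 0 := fun n hn => by exact_mod_cast (hpos n hn).ne'
  have hE : IsMultiplier (fun n _ => ((1 / den n : ℝ) : ℂ)) (1 / ν) := fun n m hn _ => by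
    rw [Complex.norm_real, Real.norm_eq_abs, abs_of_pos (by have := hpos n hn; positivity)]
    exact one_div_le_one_div_of_le hν (by linarith [hden n hn])
  have hF : IsMultiplier (fun n m => (((m : ℝ) / den n : ℝ) : ℂ)) δ := fun n m hn hm => by
    have h2 : |(m : ℝ)| ≤ n := by exact_mod_cast hm
    rw [Complex.norm_real, Real.norm_eq_abs, abs_div, abs_of_pos (hpos n hn), div_le_iff₀ (hpos n hn)]
    have := hden' n hn
    rw [div_lt_iff₀ hδ0] at this
    linarith
  -- This multiplier is `-ΔE`; its boundedness puts the range of `E` into the domain.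
  have hL : IsMultiplier (fun n _ => (((n * (n + 1) : ℝ) / den n : ℝ) : ℂ)) (2 / ν + 1) := fun n m hn hm => by
    have h1 : (1 : ℝ) ≤ n := by exact_mod_cast hn
    rw [Complex.norm_real, Real.norm_eq_abs, abs_div, abs_of_pos (hpos n hn),
      div_le_iff₀ (hpos n hn), abs_of_pos (by positivity)]
    have h3 : (2 / ν + 1) * den n = 2 / ν * lam + lam + (2 + ν) * (n * (n + 1) - 2) := by
      rw [hdendef]
      field_simp
    have h4 : 2 / ν * lam ≥ 4 := by
      rw [ge_iff_le, div_mul_eq_mul_div, le_div_iff₀ hν]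
      linarith
    have h5 := htwo n hn
    have h6 := mul_nonneg hν.le h5
    rw [h3]
    linarith
  set E := diagOp _ hE
  set F := diagOp _ hF
  have hEF : ∀ y n m, coeff (F y : LTwo) n m = m * coeff (E y : LTwo) n m := fun y n m => by
    rw [coeff_diagOp, coeff_diagOp]
    push_cast
    ring
  have hEy : ∀ (y : LTwoZero) (n : ℕ) (m : ℤ), 1 ≤ n → coeff y n m = den n * coeff (E y : LTwo) n m := fun y n m hn => by
    rw [coeff_diagOp]
    have := hdenc n hn
    push_cast
    field_simp
  have hA := ContinuousLinearMap.opNorm_nonneg (cosOp ∘L gapOp)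
  obtain ⟨B, hB, hB'⟩ := exists_inverse_add_smul (Complex.I * a) (cosOp ∘L gapOp) F (by
    rw [norm_mul, Complex.norm_I, one_mul, Complex.norm_real, Real.norm_eq_abs]
    calc |a| * (‖cosOp ∘L gapOp‖ * ‖F‖) ≤ |a| * (‖cosOp ∘L gapOp‖ * δ) := by
          gcongr
          exact norm_diagOp_le hF
      _ = |a| * ‖cosOp ∘L gapOp‖ / ((|a| + 1) * (‖cosOp ∘L gapOp‖ + 1)) := by rw [hδ]; ring
      _ < 1 := by
        rw [div_lt_one (by positivity)]
        nlinarith [abs_nonneg a])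
  replace hB : ∀ y, B (y + (Complex.I * a) • cosOp (gapOp (F y))) = y := hB
  replace hB' : ∀ y, B y + (Complex.I * a) • cosOp (gapOp (F (B y))) = y := hB'
  refine ⟨E ∘L B, fun u f => ?_⟩
  change _ ↔ u = E (B ((lam : ℂ) • u - f))
  constructor
  · intro h
    obtain ⟨k, v, hk, hv, hf⟩ := specGraph_iff.1 h
    set y : LTwoZero := (lam : ℂ) • u + (ν : ℂ) • (k - (2 : ℂ) • u) with hy
    have hyc : ∀ n m, coeff y n m = den n * coeff u n m := fun n m => by
      simp only [hy, Submodule.coe_add, Submodule.coe_sub, Submodule.coe_smul, coeff_add, coeff_sub,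
        coeff_smul, hk, hdendef]
      push_cast
      ring
    have hEu : E y = u := ext_coeff_zero fun n m hn _ =>
      mul_left_cancel₀ (hdenc n hn) (by rw [← hEy y n m hn, hyc])
    have hFv : F y = v := ext_coeff_zero fun n m _ _ => by rw [hEF, hEu, hv]
    have : (lam : ℂ) • u - f = y + (Complex.I * a) • cosOp (gapOp (F y)) := by
      rw [hFv, hf, hy]
      module
    rw [this, hB, hEu]
  · intro h
    set y := B ((lam : ℂ) • u - f)
    have hy : (lam : ℂ) • u - f = y + (Complex.I * a) • cosOp (gapOp (F y)) := by
      exact (hB' _).symm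
    refine specGraph_iff.2 ⟨diagOp _ hL y, F y, fun n m => ?_, fun n m => ?_, ?_⟩
    · rw [coeff_diagOp, h, coeff_diagOp]
      push_cast
      ring
    · rw [hEF, ← h]
    · have h1 : y = (lam : ℂ) • u + (ν : ℂ) • (diagOp _ hL y - (2 : ℂ) • u) := by
        refine ext_coeff_zero fun n m hn _ => ?_
        have h2 := hEy y n m hn
        rw [← h] at h2
        have h3 : coeff (diagOp _ hL y : LTwo) n m = n * (n + 1) * coeff u n m := by
          rw [coeff_diagOp, h2]
          have := hdenc n hn
          push_cast
          field_simp
        simp only [Submodule.coe_add, Submodule.coe_sub, Submodule.coe_smul, coeff_add, coeff_sub,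
          coeff_smul, h3]
        rw [h2, hdendef]
        push_cast
        ring
      have h4 : f = (lam : ℂ) • u - (y + (Complex.I * a) • cosOp (gapOp (F y))) := by
        rw [← hy, sub_sub_cancel]
      rw [h4]
      nth_rewrite 1 [h1]
      module

end Generation

/-! ### From dissipativity to resolvent bounds -/

section Dissipative

variable {X : Type*} [NormedAddCommGroup X] [InnerProductSpace ℂ X]

/-- The **Lumer–Phillips** criterion, with the range condition given by resolvents. -/
theorem isHilleYosida_of_dissipative {G : X → X → Prop} {lam₀ : ℝ} {R : ℝ → X →L[ℂ] X}
    (h0 : 0 ≤ lam₀)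
    (hR : ∀ lam, lam₀ < lam → ∀ x y, G x y ↔ x = R lam ((lam : ℂ) • x - y))
    (hd : Dense {x | ∃ y, G x y}) (hdis : ∀ x y, G x y → (inner ℂ x y).re ≤ 0) :
    IsHilleYosida G lam₀ R := by
  refine ⟨h0, fun lam hlam => ?_, hR, hd⟩
  have hpos : 0 < lam := h0.trans_lt hlam
  refine ContinuousLinearMap.opNorm_le_bound _ (by positivity) fun z => ?_
  set x := R lam z with hx
  have hG : G x ((lam : ℂ) • x - z) := by
    rw [hR lam hlam, sub_sub_cancel]
  have h1 := hdis _ _ hG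
  rw [inner_sub_right, inner_smul_right, inner_self_eq_norm_sq_to_K, Complex.sub_re] at h1
  have h2 : ((lam : ℂ) * ((‖x‖ : ℝ) : ℂ) ^ 2).re = lam * ‖x‖ ^ 2 := by
    rw [← Complex.ofReal_pow, ← Complex.ofReal_mul, Complex.ofReal_re]
  have h3 : (inner ℂ x z).re ≤ ‖x‖ * ‖z‖ := (Complex.re_le_norm _).trans (norm_inner_le_norm _ _)
  have h4 : lam * ‖x‖ ^ 2 ≤ ‖x‖ * ‖z‖ := by
    have h5 : ((lam : ℂ) * ((‖x‖ : ℝ) : ℂ) ^ 2).re - (inner ℂ x z).re ≤ 0 := h1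
    linarith
  rw [one_div_mul_eq_div, le_div_iff₀ hpos]
  rcases (norm_nonneg x).eq_or_lt with h | h
  · rw [← h]
    simp
  · nlinarith

end Dissipative

/-! ### Weighted energy and generation of the semigroup -/

section Energy

open scoped ComplexConjugate

theorem re_inner_diagOp_le {d : ℕ → ℤ → ℂ} {K : ℝ} (hd : IsMultiplier d K) (u v : LTwoZero)
    (h : ∀ (n : ℕ) (m : ℤ), 1 ≤ n → |m| ≤ n →
      (conj (d n m * coeff u n m) * coeff v n m).re ≤ 0) : (inner ℂ (diagOp d hd u : LTwo) v).re ≤ 0 := by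
  have h1 := hasSum_inner_coeff (diagOp d hd u : LTwo) (v : LTwo)
  refine hasSum_le (fun q => ?_) (Complex.hasSum_re h1) hasSum_zero
  rw [coeff_diagOp]
  rcases Nat.eq_zero_or_pos q.1 with hn | hn
  · rw [hn, coeff_degree_zero v]; simp
  · by_cases hm : |q.2| ≤ q.1
    · exact h _ _ hn hm
    · rw [coeff_eq_zero (v : LTwo) (not_le.1 hm)]; simp

theorem inner_diagOp_mul {c d e : ℕ → ℤ → ℂ} {K L : ℝ} (hd : IsMultiplier d K)
    (he : IsMultiplier e L) {u x y : LTwoZero} (hce : ∀ n m, conj (d n m) * c n m = conj (e n m))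
    (h : ∀ n m, coeff y n m = c n m * coeff x n m) :
    inner ℂ (diagOp d hd u) y = inner ℂ (diagOp e he u) x := by
  rw [Submodule.coe_inner, Submodule.coe_inner]
  refine (hasSum_inner_coeff _ _).unique ((hasSum_inner_coeff _ _).congr_fun fun q => ?_)
  rw [coeff_diagOp, coeff_diagOp, h, map_mul, map_mul, ← hce]
  ring

/-- The transport term is skew for the inner product weighted by `I + 6 Δ⁻¹`. -/
theorem im_inner_gapOp {u v : LTwoZero} (hv : ∀ n m, coeff v n m = m * coeff u n m) :
    (inner ℂ (gapOp u : LTwo) (cosOp (gapOp v))).im = 0 := by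
  have h : inner ℂ (gapOp u : LTwo) (cosOp (gapOp v)) =
      inner ℂ (gapOp v : LTwo) (cosOp (gapOp u)) := by
    refine (hasSum_inner_coeff _ _).unique ((hasSum_inner_coeff _ _).congr_fun fun q => ?_)
    rw [coeff_gapOp, coeff_gapOp, coeff_cosOp_gapOp_of_mul hv, hv, map_mul, map_mul, map_mul,
      map_intCast]
    ring
  have h2 : inner ℂ (gapOp v : LTwo) (cosOp (gapOp u)) =
      inner ℂ (cosOp (gapOp v) : LTwo) (gapOp u) := (inner_cosOp _ _).symm
  rw [h2, ← inner_conj_symm] at h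
  rw [← inner_conj_symm, Complex.conj_im, neg_eq_zero]
  exact Complex.conj_eq_iff_im.1 h

theorem gap_le_one (n : ℕ) : gap n ≤ 1 := by
  rw [gap]
  have : 0 ≤ 6 / ((n : ℝ) * (n + 1)) := by positivity
  linarith

theorem half_le_gap {n : ℕ} (hn : 3 ≤ n) : 1 / 2 ≤ gap n := by
  have h1 : (3 : ℝ) ≤ n := by exact_mod_cast hn
  have : 6 / ((n : ℝ) * (n + 1)) ≤ 1 / 2 := by
    rw [div_le_iff₀ (by positivity)]
    nlinarith
  rw [gap]
  linarith

/-- A positive weight that agrees with the eigenvalues of `I + 6 Δ⁻¹` in degrees `≥ 3`. -/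
def weight (n : ℕ) : ℝ := if n ≤ 2 then 1 else gap n

theorem weight_le_one (n : ℕ) : weight n ≤ 1 := by
  rw [weight]
  split_ifs
  exacts [le_rfl, gap_le_one n]

theorem half_le_weight (n : ℕ) : 1 / 2 ≤ weight n := by
  rw [weight]
  split_ifs
  exacts [by norm_num, half_le_gap (by omega)]

theorem weight_pos (n : ℕ) : 0 < weight n := by linarith [half_le_weight n]

theorem isMultiplier_weight : IsMultiplier (fun n _ => (weight n : ℂ)) 1 := fun n m _ _ => by
  rw [Complex.norm_real, Real.norm_eq_abs, abs_of_pos (weight_pos n)]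
  exact weight_le_one n

theorem isMultiplier_sqrt_weight : IsMultiplier (fun n _ => (Real.sqrt (weight n) : ℂ)) 1 :=
  fun n m _ _ => by
    rw [Complex.norm_real, Real.norm_eq_abs, abs_of_nonneg (Real.sqrt_nonneg _)]
    exact Real.sqrt_le_one.2 (weight_le_one n)

theorem half_le_sqrt_weight (n : ℕ) : 1 / 2 ≤ Real.sqrt (weight n) := by
  refine Real.le_sqrt_of_sq_le ?_
  linarith [half_le_weight n]

theorem isMultiplier_inv_sqrt_weight :
    IsMultiplier (fun n _ => ((1 / Real.sqrt (weight n) : ℝ) : ℂ)) 2 := fun n m _ _ => by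
  have h := half_le_sqrt_weight n
  rw [Complex.norm_real, Real.norm_eq_abs, abs_of_pos (by positivity),
    div_le_iff₀ (by positivity)]
  linarith

theorem isMultiplier_weight_sub_gap : IsMultiplier (fun n _ => ((weight n - gap n : ℝ) : ℂ)) 3 :=
  fun n m _ _ => by
    have := weight_le_one n
    have := weight_pos n
    have := abs_le.1 (abs_gap_le n)
    rw [Complex.norm_real, Real.norm_eq_abs, abs_le]
    constructor <;> linarith

/-- The weight differs from `gap` only in degrees `≤ 2`, so even with the unbounded factor `m` the
difference stays bounded, by `2 · 3`. For this reason the weight is modified in low degrees only. -/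
theorem isMultiplier_mul_weight_sub_gap :
    IsMultiplier (fun n m => (((m : ℝ) * (weight n - gap n) : ℝ) : ℂ)) 6 := fun n m hn hm => by
  have h2 : |(m : ℝ)| ≤ n := by exact_mod_cast hm
  by_cases h : n ≤ 2
  · have h1 : (n : ℝ) ≤ 2 := by exact_mod_cast h
    have h3 := isMultiplier_weight_sub_gap n m hn hm
    rw [Complex.norm_real, Real.norm_eq_abs] at h3 ⊢
    rw [abs_mul]
    calc |(m : ℝ)| * |weight n - gap n| ≤ 2 * 3 := by gcongr; exact h2.trans h1
      _ = 6 := by norm_num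
  · have : weight n = gap n := if_neg h
    simp [this]

/-- The square root of the weight as an isomorphism of `L²₀(S²)`. -/
def weightEquiv : LTwoZero ≃L[ℂ] LTwoZero :=
  ContinuousLinearEquiv.equivOfInverse (diagOp _ isMultiplier_sqrt_weight)
    (diagOp _ isMultiplier_inv_sqrt_weight)
    (fun u => ext_coeff_zero fun n m _ _ => by
      rw [coeff_diagOp, coeff_diagOp, ← mul_assoc, ← Complex.ofReal_mul,
        one_div_mul_cancel (by have := half_le_sqrt_weight n; positivity), Complex.ofReal_one,
        one_mul])
    (fun u => ext_coeff_zero fun n m _ _ => by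
      rw [coeff_diagOp, coeff_diagOp, ← mul_assoc, ← Complex.ofReal_mul,
        mul_one_div_cancel (by have := half_le_sqrt_weight n; positivity), Complex.ofReal_one,
        one_mul])

/-- Conjugation by this isomorphism turns the weighted inner product into the given one, so
dissipativity can be tested in the original Hilbert space. -/
theorem inner_weightEquiv (u v : LTwoZero) : inner ℂ (weightEquiv u : LTwo) (weightEquiv v) =
    inner ℂ (diagOp _ isMultiplier_weight u : LTwo) v :=
  inner_diagOp_mul (c := fun n _ => (Real.sqrt (weight n) : ℂ)) isMultiplier_sqrt_weight
    isMultiplier_weight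
    (fun n m => by
      rw [Complex.conj_ofReal, Complex.conj_ofReal, ← Complex.ofReal_mul,
        Real.mul_self_sqrt (weight_pos n).le])
    (fun n m => coeff_diagOp isMultiplier_sqrt_weight v n m)

theorem norm_le_weightEquiv (u : LTwoZero) : ‖u‖ ≤ 2 * ‖weightEquiv u‖ := by
  have h := (diagOp _ isMultiplier_inv_sqrt_weight).le_of_opNorm_le
    (norm_diagOp_le isMultiplier_inv_sqrt_weight) (weightEquiv u)
  rwa [show diagOp _ isMultiplier_inv_sqrt_weight (weightEquiv u) = u from
    weightEquiv.symm_apply_apply u] at h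

/-- The viscous part is nonpositive because `n(n+1) ≥ 2`. In the transport part the weight splits as
`gap` plus a remainder: the `gap` part has no real contribution by skewness, and in the remainder
the factor `m` is moved onto the finitely supported multiplier. -/
theorem re_inner_weight_le {ν a : ℝ} (hν : 0 < ν) {u f : LTwoZero} (h : SpecGraph ν a u f) :
    (inner ℂ (diagOp _ isMultiplier_weight u : LTwo) f).re ≤
      6 * |a| * ‖cosOp ∘L gapOp‖ * ‖u‖ ^ 2 := by
  obtain ⟨k, v, hk, hv, rfl⟩ := specGraph_iff.1 h
  have h1 : (inner ℂ (diagOp _ isMultiplier_weight u : LTwo)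
      ((ν : ℂ) • ((2 : ℂ) • u - k) : LTwoZero)).re ≤ 0 := by
    refine re_inner_diagOp_le _ _ _ fun n m hn hm => ?_
    have h2 : (0 : ℝ) ≤ n * (n + 1) - 2 := by
      have : (1 : ℝ) ≤ n := by exact_mod_cast hn
      nlinarith
    have h3 : conj ((weight n : ℂ) * coeff u n m) *
        coeff ((ν : ℂ) • ((2 : ℂ) • u - k) : LTwoZero) n m =
        ((-(weight n * ν * (n * (n + 1) - 2)) * Complex.normSq (coeff u n m) : ℝ) : ℂ) := by
      simp only [Submodule.coe_sub, Submodule.coe_smul, coeff_sub, coeff_smul, hk]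
      push_cast
      rw [Complex.normSq_eq_conj_mul_self, map_mul, Complex.conj_ofReal]
      ring
    rw [h3, Complex.ofReal_re]
    have := mul_nonneg (mul_nonneg (weight_pos n).le hν.le) h2
    have := mul_nonneg this (Complex.normSq_nonneg (coeff u n m))
    linarith
  have h2 : (diagOp _ isMultiplier_weight u : LTwo) =
      gapOp u + diagOp _ isMultiplier_weight_sub_gap u := by
    refine ext_coeff fun n m => ?_
    rw [coeff_add, coeff_diagOp, coeff_diagOp, coeff_gapOp]
    push_cast
    ring
  have h3 : inner ℂ (diagOp _ isMultiplier_weight_sub_gap u : LTwo) (cosOp (gapOp v)) =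
      inner ℂ (diagOp _ isMultiplier_mul_weight_sub_gap u : LTwo) (cosOp (gapOp u)) :=
    inner_diagOp_mul (c := fun _ m => (m : ℂ)) _ _
      (fun n m => by
        rw [Complex.conj_ofReal, Complex.conj_ofReal]
        push_cast
        ring) (coeff_cosOp_gapOp_of_mul hv)
  have h4 : ‖(inner ℂ (diagOp _ isMultiplier_weight_sub_gap u : LTwo) (cosOp (gapOp v)))‖ ≤
      6 * ‖cosOp ∘L gapOp‖ * ‖u‖ ^ 2 := by
    rw [h3]
    refine (norm_inner_le_norm _ _).trans ?_
    have h5 := (diagOp _ isMultiplier_mul_weight_sub_gap).le_of_opNorm_le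
      (norm_diagOp_le isMultiplier_mul_weight_sub_gap) u
    have h6 := (cosOp ∘L gapOp).le_opNorm u
    calc _ ≤ (6 * ‖u‖) * (‖cosOp ∘L gapOp‖ * ‖u‖) :=
          mul_le_mul h5 h6 (norm_nonneg _) (by positivity)
      _ = _ := by ring
  have h5 : ∀ z : ℂ, (Complex.I * a * z).re = -(a * z.im) := fun z => by
    simp [mul_assoc]
  rw [Submodule.coe_sub, inner_sub_right, Complex.sub_re]
  have h6 : (inner ℂ (diagOp _ isMultiplier_weight u : LTwo)
      (((Complex.I * a) • cosOp (gapOp v) : LTwoZero) : LTwo)).re =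
      -(a * (inner ℂ (diagOp _ isMultiplier_weight_sub_gap u : LTwo) (cosOp (gapOp v))).im) := by
    rw [Submodule.coe_smul, inner_smul_right, h5, h2, inner_add_left, Complex.add_im,
      im_inner_gapOp hv, zero_add]
  rw [h6]
  have h7 := (Complex.abs_im_le_norm _).trans h4
  have h8 : a * (inner ℂ (diagOp _ isMultiplier_weight_sub_gap u : LTwo) (cosOp (gapOp v))).im ≤
      |a| * (6 * ‖cosOp ∘L gapOp‖ * ‖u‖ ^ 2) :=
    (le_abs_self _).trans ((abs_mul _ _).trans_le (by gcongr))
  linarith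

theorem exists_semigroup_graphL {ν : ℝ} (hν : 0 < ν) (a : ℝ) :
    ∃ T : ℝ → LTwoZero →L[ℂ] LTwoZero, IsSemigroupGeneratedBy T (GraphL ν a) := by
  have hA := ContinuousLinearMap.opNorm_nonneg (cosOp ∘L gapOp)
  -- The `6` of `re_inner_weight_le` times the `4` from `‖u‖² ≤ 4 ‖weightEquiv u‖²`.
  set γ : ℝ := 24 * |a| * ‖cosOp ∘L gapOp‖ with hγ
  have hγ0 : 0 ≤ γ := by positivity
  obtain ⟨lam₀, h0, hR⟩ := exists_resolvent hν a
  choose! R hR using hR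
  have key : IsHilleYosida
      (fun x y => SpecGraph ν a (weightEquiv.symm x) (weightEquiv.symm (y + (γ : ℂ) • x))) lam₀
      (fun lam => (weightEquiv : LTwoZero →L[ℂ] LTwoZero) ∘L R (lam + γ) ∘L
        (weightEquiv.symm : LTwoZero →L[ℂ] LTwoZero)) := by
    refine isHilleYosida_of_dissipative h0 (fun lam hlam x y => ?_) ?_ fun x y h => ?_
    · rw [hR (lam + γ) (by linarith)]
      change _ ↔ x = weightEquiv (R (lam + γ) (weightEquiv.symm ((lam : ℂ) • x - y)))
      rw [← weightEquiv.symm_apply_eq]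
      have : ((lam + γ : ℝ) : ℂ) • weightEquiv.symm x - weightEquiv.symm (y + (γ : ℂ) • x) =
          weightEquiv.symm ((lam : ℂ) • x - y) := by
        rw [← map_smul, ← map_sub]
        congr 1
        push_cast
        module
      rw [this]
    · have h1 := weightEquiv.surjective.denseRange.dense_image weightEquiv.continuous
        (dense_specGraph ν a)
      refine h1.mono ?_
      rintro _ ⟨u, ⟨f, hf⟩, rfl⟩
      refine ⟨weightEquiv f - (γ : ℂ) • weightEquiv u, ?_⟩
      rw [sub_add_cancel, weightEquiv.symm_apply_apply, weightEquiv.symm_apply_apply]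
      exact hf
    · obtain ⟨u, rfl⟩ := weightEquiv.surjective x
      rw [weightEquiv.symm_apply_apply] at h
      obtain ⟨f, hf⟩ := weightEquiv.surjective (y + (γ : ℂ) • weightEquiv u)
      rw [← hf, weightEquiv.symm_apply_apply] at h
      have hy : y = weightEquiv f - (γ : ℂ) • weightEquiv u := by rw [hf]; abel
      have h1 := re_inner_weight_le hν h
      have h2 := norm_le_weightEquiv u
      rw [hy, Submodule.coe_inner, Submodule.coe_sub, inner_sub_right, Submodule.coe_smul,
        inner_smul_right, inner_weightEquiv, inner_self_eq_norm_sq_to_K, Complex.sub_re]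
      have h3 : ((γ : ℂ) * ((‖(weightEquiv u : LTwo)‖ : ℝ) : ℂ) ^ 2).re =
          γ * ‖(weightEquiv u : LTwo)‖ ^ 2 := by
        rw [← Complex.ofReal_pow, ← Complex.ofReal_mul, Complex.ofReal_re]
      have h4 : ‖u‖ ^ 2 ≤ 4 * ‖weightEquiv u‖ ^ 2 := by
        nlinarith [norm_nonneg u]
      have h5 : 6 * |a| * ‖cosOp ∘L gapOp‖ * ‖u‖ ^ 2 ≤ γ * ‖weightEquiv u‖ ^ 2 := by
        have : 0 ≤ 6 * |a| * ‖cosOp ∘L gapOp‖ := by positivity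
        nlinarith
      refine (sub_le_sub h1 h3.ge).trans ?_
      exact sub_nonpos.2 h5
  obtain ⟨T, hT⟩ := key.exists_semigroup
  -- Undoes the shift by `γ` and the change of inner product.
  have := (hT.exp_smul γ).conj weightEquiv
  simp only [sub_add_cancel, weightEquiv.symm_apply_apply, ← graphL_iff] at this
  exact ⟨_, this⟩

end Energy

/-! ### Differential inequalities with right derivatives -/

section Gronwall

theorem le_exp_mul_of_deriv_right_le {g g' : ℝ → ℝ} {k : ℝ} (hg : ContinuousOn g (Set.Ici 0))
    (hg' : ∀ t, 0 ≤ t → HasDerivWithinAt g (g' t) (Set.Ici t) t)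
    (h : ∀ t, 0 ≤ t → g' t ≤ -k * g t) {t : ℝ} (ht : 0 ≤ t) : g t ≤ Real.exp (-k * t) * g 0 := by
  have hexp : ∀ s, HasDerivAt (fun s => Real.exp (k * s)) (Real.exp (k * s) * k) s := fun s => by
    simpa using ((hasDerivAt_id s).const_mul k).exp
  have key := image_le_of_deriv_right_le_deriv_boundary (a := 0) (b := t)
    (f := fun s => Real.exp (k * s) * g s) (f' := fun s => Real.exp (k * s) * k * g s + Real.exp (k * s) * g' s)
    (B := fun _ => g 0) (B' := fun _ => 0)
    ((Continuous.continuousOn (by fun_prop)).mul (hg.mono fun s hs => hs.1))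
    (fun s hs => (hexp s).hasDerivWithinAt.mul (hg' s hs.1)) (by simp) continuousOn_const
    (fun s _ => hasDerivWithinAt_const _ _ _)
    (fun s hs => by
      have := h s hs.1
      have h1 := Real.exp_pos (k * s)
      nlinarith) ⟨ht, le_rfl⟩
  have h2 : Real.exp (-k * t) * Real.exp (k * t) = 1 := by
    rw [← Real.exp_add]
    simp
  calc g t = Real.exp (-k * t) * (Real.exp (k * t) * g t) := by rw [← mul_assoc, h2, one_mul]
    _ ≤ Real.exp (-k * t) * g 0 := by
      gcongr

/-- A decaying source term in a damped linear equation. -/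
theorem norm_exp_mul_sub_le {z s : ℝ → ℂ} {k K δ : ℝ} (hδ : 0 < δ)
    (hz : ContinuousOn z (Set.Ici 0))
    (hz' : ∀ t, 0 ≤ t → HasDerivWithinAt z (-(k : ℂ) * z t + s t) (Set.Ici t) t)
    (hs : ∀ t, 0 ≤ t → ‖s t‖ ≤ K * Real.exp (-(k + δ) * t)) {t : ℝ} (ht : 0 ≤ t) :
    ‖((Real.exp (k * t) : ℝ) : ℂ) * z t - z 0‖ ≤ K / δ := by
  have hexp : ∀ r, HasDerivAt (fun r : ℝ => ((Real.exp (k * r) : ℝ) : ℂ))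
      ((Real.exp (k * r) * k : ℝ) : ℂ) r := fun r => by
    simpa using ((hasDerivAt_id r).const_mul k).exp.ofReal_comp
  have hK : 0 ≤ K := by simpa using (norm_nonneg _).trans (hs 0 le_rfl)
  -- The primitive of `K exp(-δr)` that vanishes at `0`, hence the integrated form of Duhamel's
  -- bound.
  have hB : ∀ r, HasDerivAt (fun r : ℝ => K / δ * (1 - Real.exp (-δ * r)))
      (K * Real.exp (-δ * r)) r := fun r => by
    refine ((((hasDerivAt_id r).const_mul (-δ)).exp.const_sub 1).const_mul (K / δ)).congr_deriv ?_
    simp only [id_eq]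
    field_simp
  have key := image_norm_le_of_norm_deriv_right_le_deriv_boundary (a := 0) (b := t)
    (f := fun r => ((Real.exp (k * r) : ℝ) : ℂ) * z r - z 0)
    (f' := fun r => ((Real.exp (k * r) : ℝ) : ℂ) * s r)
    (((Continuous.continuousOn (by fun_prop)).mul (hz.mono fun s hs => hs.1)).sub continuousOn_const)
    (fun r hr => (((hexp r).hasDerivWithinAt.mul (hz' r hr.1)).sub_const (z 0)).congr_deriv (by
      push_cast
      ring)) (by simp) hB
    (fun r hr => by
      rw [norm_mul, Complex.norm_real, Real.norm_eq_abs, Real.abs_exp]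
      calc Real.exp (k * r) * ‖s r‖ ≤ Real.exp (k * r) * (K * Real.exp (-(k + δ) * r)) := by
            gcongr
            exact hs r hr.1
        _ = K * (Real.exp (k * r) * Real.exp (-(k + δ) * r)) := by ring
        _ = K * Real.exp (-δ * r) := by
          rw [← Real.exp_add]
          ring_nf) ⟨ht, le_rfl⟩
  refine key.trans ?_
  have h1 : 1 - Real.exp (-δ * t) ≤ 1 := by linarith [Real.exp_pos (-δ * t)]
  calc K / δ * (1 - Real.exp (-δ * t)) ≤ K / δ * 1 := by gcongr
    _ = K / δ := mul_one _

variable {X : Type*} [NormedAddCommGroup X] [NormedSpace ℂ X] {T : ℝ → X →L[ℂ] X} {G : X → X → Prop}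

theorem IsSemigroupGeneratedBy.hasDerivWithinAt_apply {Y : Type*} [NormedAddCommGroup Y]
    [NormedSpace ℂ Y] (h : IsSemigroupGeneratedBy T G) (L : X →L[ℂ] Y) {x y : X} (hxy : G x y)
    {t : ℝ} (ht : 0 ≤ t) : HasDerivWithinAt (fun s => L (T s x)) (L (T t y)) (Set.Ici t) t :=
  (L.restrictScalars ℝ).hasFDerivAt.comp_hasDerivWithinAt t (h.hasDerivWithinAt hxy ht)

end Gronwall

/-! ### Decay estimates degree by degree -/

section Estimates

open scoped ComplexConjugate

/-- The coefficient functional on `L²₀(S²)`. -/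
def coeffL (n : ℕ) (m : ℤ) : LTwoZero →L[ℂ] ℂ := innerSL ℂ (sphHarm n m) ∘L LTwoZero.subtypeL

theorem coeffL_apply (n : ℕ) (m : ℤ) (u : LTwoZero) : coeffL n m u = coeff u n m := rfl

theorem norm_coeff_le (u : LTwo) (n : ℕ) (m : ℤ) : ‖coeff u n m‖ ≤ ‖u‖ := by
  have h := le_hasSum (hasSum_norm_sq_coeff u) (n, m) fun _ _ => by positivity
  exact le_of_sq_le_sq h (norm_nonneg _)

theorem norm_sphHarm_le (n : ℕ) (m : ℤ) : ‖sphHarm n m‖ ≤ 1 := by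
  have h : inner ℂ (sphHarm n m) (sphHarm n m) = coeff (sphHarm n m) n m := rfl
  rw [coeff_sphHarm, inner_self_eq_norm_sq_to_K] at h
  have h2 : ‖sphHarm n m‖ ^ 2 ≤ 1 := by
    split_ifs at h
    · have : ((‖sphHarm n m‖ ^ 2 : ℝ) : ℂ) = 1 := by push_cast; exact h
      exact le_of_eq (by exact_mod_cast this)
    · have : ((‖sphHarm n m‖ ^ 2 : ℝ) : ℂ) = 0 := by push_cast; exact h
      have : ‖sphHarm n m‖ ^ 2 = 0 := by exact_mod_cast this
      linarith
  exact (sq_le_one_iff₀ (norm_nonneg _)).1 h2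

theorem norm_degPart_le {k : ℕ} {u : LTwo} {K : ℝ} (h : ∀ m, |m| ≤ (k : ℤ) → ‖coeff u k m‖ ≤ K) :
    ‖degPart k u‖ ≤ (2 * k + 1) * K := by
  rw [degPart]
  refine (norm_sum_le_of_le _ (fun m hm => (?_ : _ ≤ K))).trans_eq ?_
  · rw [norm_smul]
    have h1 := h m (abs_le.2 (Finset.mem_Icc.1 hm))
    exact (mul_le_of_le_one_right (norm_nonneg _) (norm_sphHarm_le _ _)).trans h1
  · rw [Finset.sum_const, Int.card_Icc, nsmul_eq_mul]
    congr 1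
    have : ((k : ℤ) + 1 - -k).toNat = 2 * k + 1 := by omega
    rw [this]
    push_cast
    ring

theorem norm_tailPart_le (N : ℕ) (u : LTwo) : ‖tailPart N u‖ ≤ ‖u‖ := by
  refine le_of_sq_le_sq ?_ (norm_nonneg _)
  refine hasSum_le (fun q => ?_) (hasSum_norm_sq_coeff _) (hasSum_norm_sq_coeff u)
  rw [coeff_tailPart]
  split_ifs
  · exact le_rfl
  · simp

theorem isMultiplier_tail : IsMultiplier (fun n _ => if 3 ≤ n then 1 else 0) 1 := fun n m _ _ => by
  beta_reduce
  split_ifs <;> simp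

/-- The projection onto the degrees `≥ 3` in `L²₀(S²)`. -/
def tailOp : LTwoZero →L[ℂ] LTwoZero := diagOp _ isMultiplier_tail

theorem coe_tailOp (u : LTwoZero) : (tailOp u : LTwo) = tailPart 3 u := by
  refine ext_coeff fun n m => ?_
  rw [tailOp, coeff_diagOp, coeff_tailPart]
  split_ifs <;> simp

theorem continuous_tailPart : Continuous fun u : LTwoZero => tailPart 3 (u : LTwo) := by
  simp only [← coe_tailOp]
  exact continuous_subtype_val.comp tailOp.continuous

/-- The quadratic form of `I + 6 Δ⁻¹` in the degrees `≥ 3`. -/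
def tailEnergy (u : LTwoZero) : ℝ := (inner ℂ (gapOp (tailOp u) : LTwo) (u : LTwo)).re

theorem hasSum_tailEnergy (u : LTwoZero) :
    HasSum (fun q : ℕ × ℤ => gap q.1 * ‖coeff (tailPart 3 u) q.1 q.2‖ ^ 2) (tailEnergy u) := by
  refine (Complex.hasSum_re (hasSum_inner_coeff _ _)).congr_fun fun q => ?_
  rw [coeff_gapOp, coe_tailOp, coeff_tailPart, map_mul, Complex.conj_ofReal, mul_assoc,
    Complex.re_ofReal_mul]
  split_ifs
  · rw [Complex.conj_mul', ← Complex.ofReal_pow, Complex.ofReal_re]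
  · simp

theorem tailEnergy_le (u : LTwoZero) : tailEnergy u ≤ ‖tailPart 3 (u : LTwo)‖ ^ 2 :=
  hasSum_le (fun q => mul_le_of_le_one_left (by positivity) (gap_le_one _)) (hasSum_tailEnergy u)
    (hasSum_norm_sq_coeff _)

/-- The bound `gap n ≥ 1/2` for `n ≥ 3`, attained at `n = 3`, is the source of the factor `√2` in
the final estimate. -/
theorem norm_sq_tailPart_le (u : LTwoZero) : ‖tailPart 3 (u : LTwo)‖ ^ 2 ≤ 2 * tailEnergy u := by
  refine hasSum_le (fun q => ?_) (hasSum_norm_sq_coeff _) ((hasSum_tailEnergy u).mul_left 2)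
  rw [coeff_tailPart]
  split_ifs with h
  · have := half_le_gap h
    nlinarith [sq_nonneg ‖coeff (u : LTwo) q.1 q.2‖]
  · simp

theorem gap_two : gap 2 = 0 := by norm_num [gap]

/-- The viscous part gives the rate, as `n(n+1) - 2 ≥ 10` for `n ≥ 3`. Transport contributes
nothing: degree two does not enter because `gap 2 = 0`, and within the tail transport is skew for
the `gap` inner product. -/
theorem re_inner_gapOp_tailOp_le {ν a : ℝ} (hν : 0 < ν) {u f : LTwoZero} (h : SpecGraph ν a u f) :
    (inner ℂ (gapOp (tailOp u) : LTwo) (f : LTwo)).re ≤ -(10 * ν) * tailEnergy u := by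
  obtain ⟨k, v, hk, hv, rfl⟩ := specGraph_iff.1 h
  have hT : ∀ (w : LTwoZero) n m, coeff (tailOp w : LTwo) n m = if 3 ≤ n then coeff w n m else 0 :=
    fun w n m => by rw [coe_tailOp, coeff_tailPart]
  have h1 : (inner ℂ (gapOp (tailOp u) : LTwo)
      (((ν : ℂ) • ((2 : ℂ) • u - k) : LTwoZero) : LTwo)).re ≤ -(10 * ν) * tailEnergy u := by
    refine hasSum_le (fun q => ?_) (Complex.hasSum_re (hasSum_inner_coeff _ _))
      ((hasSum_tailEnergy u).mul_left _)
    rw [coeff_gapOp, hT, coeff_tailPart]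
    split_ifs with hn
    · have h2 : (10 : ℝ) ≤ q.1 * (q.1 + 1) - 2 := by
        have : (3 : ℝ) ≤ q.1 := by exact_mod_cast hn
        nlinarith
      have h3 : conj ((gap q.1 : ℂ) * coeff u q.1 q.2) *
          coeff ((ν : ℂ) • ((2 : ℂ) • u - k) : LTwoZero) q.1 q.2 =
          ((-(gap q.1 * ν * (q.1 * (q.1 + 1) - 2)) * ‖coeff u q.1 q.2‖ ^ 2 : ℝ) : ℂ) := by
        simp only [Submodule.coe_sub, Submodule.coe_smul, coeff_sub, coeff_smul, hk]
        push_cast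
        rw [← Complex.conj_mul', map_mul, Complex.conj_ofReal]
        ring
      rw [h3, Complex.ofReal_re]
      have h4 : 0 ≤ gap q.1 * ν * ‖coeff u q.1 q.2‖ ^ 2 := by
        have := half_le_gap hn
        positivity
      nlinarith
    · simp
  have h2 : inner ℂ (gapOp (tailOp u) : LTwo) (cosOp (gapOp v) : LTwo) =
      inner ℂ (gapOp (tailOp u) : LTwo) (cosOp (gapOp (tailOp v)) : LTwo) := by
    refine (hasSum_inner_coeff _ _).unique ((hasSum_inner_coeff _ _).congr_fun fun q => ?_)
    rw [coeff_gapOp, hT]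
    split_ifs with hn
    · rw [coeff_cosOp _ (by omega), coeff_cosOp _ (by omega)]
      simp only [coeff_gapOp, hT]
      rw [if_pos (by omega)]
      split_ifs with h3
      · rfl
      -- The one place where the tail meets lower degrees: degree three sees degree two, multiplied
      -- by `gap 2 = 0`.
      · have : q.1 - 1 = 2 := by omega
        rw [this, gap_two]
        simp
    · simp
  have h3 : (inner ℂ (gapOp (tailOp u) : LTwo) (cosOp (gapOp v) : LTwo)).im = 0 := by
    rw [h2]
    refine im_inner_gapOp fun n m => ?_
    rw [hT, hT, hv]
    split_ifs <;> simp
  have h5 : ∀ z : ℂ, (Complex.I * a * z).re = -(a * z.im) := fun z => by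
    simp [mul_assoc]
  rw [Submodule.coe_sub, inner_sub_right, Complex.sub_re, Submodule.coe_smul _ (cosOp (gapOp v)),
    inner_smul_right, h5, h3, mul_zero, neg_zero, sub_zero]
  exact h1

variable {ν a : ℝ} {T : ℝ → LTwoZero →L[ℂ] LTwoZero}

/-- By symmetry of the form the energy has right derivative `2 Re (gap u, 𝓛u)` taken in the tail, so
the rate `10ν` doubles. -/
theorem tailEnergy_semigroup_le (hν : 0 < ν) (hT : IsSemigroupGeneratedBy T (GraphL ν a))
    {u f : LTwoZero} (h : GraphL ν a u f) {t : ℝ} (ht : 0 ≤ t) :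
    tailEnergy (T t u) ≤ Real.exp (-(20 * ν) * t) * tailEnergy u := by
  set V : LTwoZero →L[ℂ] LTwo := LTwoZero.subtypeL ∘L gapOp ∘L tailOp
  have hsymm : ∀ x y : LTwoZero, (inner ℂ (V x) (y : LTwo)).re = (inner ℂ (V y) (x : LTwo)).re := by
    intro x y
    refine (Complex.hasSum_re (hasSum_inner_coeff _ _)).unique
      ((Complex.hasSum_re (hasSum_inner_coeff _ _)).congr_fun fun q => ?_)
    change (conj (coeff (gapOp (tailOp x) : LTwo) _ _) * _).re =
      (conj (coeff (gapOp (tailOp y) : LTwo) _ _) * _).re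
    rw [coeff_gapOp, coeff_gapOp, coe_tailOp, coe_tailOp, coeff_tailPart, coeff_tailPart]
    split_ifs
    · simp
      ring
    · simp
  have hder : ∀ s, 0 ≤ s → HasDerivWithinAt (fun s => tailEnergy (T s u))
      (2 * (inner ℂ (V (T s u)) (T s f : LTwo)).re) (Set.Ici s) s := by
    intro s hs
    have h1 := (hT.hasDerivWithinAt_apply V h hs).inner ℂ
      (hT.hasDerivWithinAt_apply LTwoZero.subtypeL h hs)
    refine (Complex.reCLM.hasFDerivAt.comp_hasDerivWithinAt s h1).congr_deriv ?_
    change (_ + _ : ℂ).re = _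
    rw [Complex.add_re, two_mul]
    congr 1
    exact hsymm _ _
  have hcont : ContinuousOn (fun s => tailEnergy (T s u)) (Set.Ici 0) := by
    have h1 : Continuous tailEnergy := by
      have : tailEnergy = fun x => (inner ℂ (V x) (x : LTwo)).re := rfl
      rw [this]
      exact Complex.continuous_re.comp (V.continuous.inner continuous_subtype_val)
    exact h1.comp_continuousOn (hT.continuousOn u)
  have key := le_exp_mul_of_deriv_right_le (k := 20 * ν) hcont hder (fun s hs => by
    have := re_inner_gapOp_tailOp_le hν ((graphL_iff _ _ _ _).1 (hT.graph_apply h hs))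
    change 2 * (inner ℂ (gapOp (tailOp (T s u)) : LTwo) (T s f : LTwo)).re ≤ _
    linarith) ht
  rwa [hT.map_zero] at key

theorem dense_graphL (ν a : ℝ) : Dense {u | ∃ f, GraphL ν a u f} := by
  simp only [graphL_iff]
  exact dense_specGraph ν a

theorem norm_tailPart_semigroup_le (hν : 0 < ν) (hT : IsSemigroupGeneratedBy T (GraphL ν a))
    (u : LTwoZero) {t : ℝ} (ht : 0 ≤ t) :
    ‖tailPart 3 (T t u : LTwo)‖ ≤ Real.sqrt 2 * Real.exp (-10 * ν * t) * ‖tailPart 3 (u : LTwo)‖ := by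
  have hcl : IsClosed {u : LTwoZero | ‖tailPart 3 (T t u : LTwo)‖ ≤
      Real.sqrt 2 * Real.exp (-10 * ν * t) * ‖tailPart 3 (u : LTwo)‖} := by
    exact isClosed_le (continuous_tailPart.comp (T t).continuous).norm
      (continuous_const.mul continuous_tailPart.norm)
  -- For fixed `t` the inequality is closed in the initial datum, so the domain, where orbits are
  -- differentiable, is enough.
  refine closure_minimal ?_ hcl (dense_graphL ν a u)
  rintro u ⟨f, h⟩
  rw [Set.mem_ofPred_eq]
  refine le_of_sq_le_sq ?_ (by positivity)
  have h1 := norm_sq_tailPart_le (T t u)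
  have h2 := tailEnergy_semigroup_le hν hT h ht
  have h3 := tailEnergy_le u
  have h4 : Real.exp (-10 * ν * t) ^ 2 = Real.exp (-(20 * ν) * t) := by
    rw [← Real.exp_nat_mul]
    push_cast
    ring_nf
  rw [mul_pow, mul_pow, Real.sq_sqrt zero_le_two, h4]
  calc _ ≤ 2 * tailEnergy (T t u) := h1
    _ ≤ 2 * (Real.exp (-(20 * ν) * t) * ‖tailPart 3 (u : LTwo)‖ ^ 2) := by
      gcongr
      exact h2.trans (by gcongr)
    _ = _ := by ring

/-- The time derivative vanishes: `2 - n(n+1) = 0` at `n = 1`, the neighbour of degree two carries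
`gap 2 = 0`, and degree zero is absent by the zero mean. -/
theorem coeff_one_semigroup (hT : IsSemigroupGeneratedBy T (GraphL ν a)) (u : LTwoZero) (m : ℤ)
    {t : ℝ} (ht : 0 ≤ t) : coeff (T t u : LTwo) 1 m = coeff u 1 m := by
  have hcl : IsClosed {u : LTwoZero | coeffL 1 m (T t u) = coeffL 1 m u} :=
    isClosed_eq (by fun_prop) (by fun_prop)
  refine closure_minimal ?_ hcl (dense_graphL ν a u)
  rintro u ⟨f, h⟩
  have h1 := constant_of_has_deriv_right_zero (f := fun s => coeffL 1 m (T s u)) (a := 0) (b := t)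
    (((coeffL 1 m).continuous.comp_continuousOn (hT.continuousOn u)).mono fun s hs => hs.1)
    (fun s hs => by
      refine (hT.hasDerivWithinAt_apply (coeffL 1 m) h hs.1).congr_deriv ?_
      obtain ⟨k, -, hf⟩ := (graphL_iff _ _ _ _).1 (hT.graph_apply h hs.1)
      rw [coeffL_apply, hf 1 m le_rfl, coeff_cosOp _ le_rfl, coeff_gapOp, coeff_gapOp, gap_two]
      norm_num
      rw [coeff_degree_zero]
      simp) t ⟨ht, le_rfl⟩
  simpa [hT.map_zero] using h1

theorem mul_alpha_two_mul_coeff (u : LTwo) (m : ℤ) :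
    (m : ℂ) * alpha 2 m * coeff u 1 m = m / (Real.sqrt 5 : ℝ) * coeff u 1 m := by
  by_cases hm : |m| ≤ 1
  · have h0 : m = 0 ∨ (m : ℝ) ^ 2 = 1 := by
      have := abs_le.1 hm
      have : m = -1 ∨ m = 0 ∨ m = 1 := by omega
      rcases this with rfl | rfl | rfl <;> norm_num
    rcases h0 with rfl | h0
    · simp
    · have : alpha 2 m = 1 / Real.sqrt 5 := by
        rw [alpha, h0, ← Real.sqrt_one, ← Real.sqrt_div (by norm_num)]
        norm_num
      rw [this]
      push_cast
      ring
  · rw [coeff_eq_zero u (by push_cast; omega)]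
    simp

theorem alpha_three_le (m : ℤ) : alpha 3 m ≤ 1 := by
  rw [alpha]
  refine Real.sqrt_le_one.2 ?_
  rw [div_le_one (by norm_num)]
  push_cast
  nlinarith [sq_nonneg (m : ℝ)]

/-- The coefficient of the equilibrium in degree two. -/
def equilibriumCoeff (ν a : ℝ) (m : ℤ) (u : LTwo) : ℂ :=
  ((a / ν : ℝ) : ℂ) * (Complex.I * m / (2 * (Real.sqrt 5 : ℝ))) * coeff u 1 m

/-- Here `2 - n(n+1) = -4`. Degree one enters with `gap 1 = -2` and `alpha 2 (±1) = 1/√5`, a force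
`2iam/√5` times the conserved coefficient, and this equals `4ν` times the coefficient of the
equilibrium. Only the coupling to degree three remains as a source. -/
theorem coeff_two_specGraph (hν : 0 < ν) {u f w : LTwoZero} {m : ℤ}
    (h : SpecGraph ν a u f) (hw : coeff u 1 m = coeff w 1 m) :
    coeff f 2 m = -((4 * ν : ℝ) : ℂ) * (coeff u 2 m - equilibriumCoeff ν a m w) +
      -(Complex.I * a * m * alpha 3 m * gap 3 * coeff u 3 m) := by
  obtain ⟨k, -, hf⟩ := h
  have h3 := mul_alpha_two_mul_coeff (w : LTwo) m
  have h4 : gap 1 = -2 := by norm_num [gap]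
  have h5 : ((Real.sqrt 5 : ℝ) : ℂ) ≠ 0 := by
    have : Real.sqrt 5 ≠ 0 := by positivity
    exact_mod_cast this
  have h6 : (ν : ℂ) ≠ 0 := by exact_mod_cast hν.ne'
  have h7 : 4 * ν * equilibriumCoeff ν a m w =
      2 * Complex.I * a * (m * alpha 2 m * coeff w 1 m) := by
    rw [h3, equilibriumCoeff]
    push_cast
    field_simp
    ring
  rw [hf 2 m (by norm_num), coeff_cosOp _ (by norm_num), coeff_gapOp,
    coeff_gapOp, show 2 - 1 = 1 from rfl, show 2 + 1 = 3 from rfl, h4, hw]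
  push_cast
  linear_combination -h7

/-- The value `gap 3 = 1/2` absorbs the `√2 ≤ 2` of the tail estimate. The rate `10ν` is written as
`4ν + 6ν` to show its excess over the damping of degree two. -/
theorem norm_source_le (hν : 0 < ν) (hT : IsSemigroupGeneratedBy T (GraphL ν a)) (u : LTwoZero)
    (m : ℤ) {t : ℝ} (ht : 0 ≤ t) :
    ‖-(Complex.I * a * m * alpha 3 m * gap 3 * coeff (T t u : LTwo) 3 m)‖ ≤
      |(m : ℝ)| * |a| * ‖tailPart 3 (u : LTwo)‖ * Real.exp (-(4 * ν + 6 * ν) * t) := by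
  have h3 := norm_coeff_le (tailPart 3 (T t u : LTwo)) 3 m
  rw [coeff_tailPart, if_pos le_rfl] at h3
  have h4 := h3.trans (norm_tailPart_semigroup_le hν hT u ht)
  have h5 : gap 3 = 1 / 2 := by norm_num [gap]
  have h6 : Real.sqrt 2 ≤ 2 := by
    rw [Real.sqrt_le_left (by norm_num)]
    norm_num
  rw [norm_neg, norm_mul, norm_mul, norm_mul, norm_mul, norm_mul, Complex.norm_I, one_mul,
    Complex.norm_real, Complex.norm_real, Complex.norm_real, Complex.norm_intCast,
    Real.norm_eq_abs, Real.norm_eq_abs, Real.norm_eq_abs, abs_of_nonneg (alpha_nonneg _ _), h5,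
    abs_of_pos (by norm_num : (0 : ℝ) < 1 / 2)]
  calc |a| * |(m : ℝ)| * alpha 3 m * (1 / 2) * ‖coeff (T t u : LTwo) 3 m‖
      ≤ |a| * |(m : ℝ)| * 1 * (1 / 2) *
        (2 * Real.exp (-10 * ν * t) * ‖tailPart 3 (u : LTwo)‖) := by
        gcongr
        · exact alpha_three_le m
        · exact h4.trans (by gcongr)
    _ = |(m : ℝ)| * |a| * ‖tailPart 3 (u : LTwo)‖ * Real.exp (-(4 * ν + 6 * ν) * t) := by
      ring_nf

/-- Duhamel's bound with damping `4ν` and excess `6ν`, the source integrating to order `|a|/ν`. The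
factor `|m|` is kept because for `m = 0` the right side is zero and the evolution is exact. -/
theorem coeff_two_semigroup (hν : 0 < ν) (hT : IsSemigroupGeneratedBy T (GraphL ν a)) (u : LTwoZero)
    (m : ℤ) {t : ℝ} (ht : 0 ≤ t) :
    ‖((Real.exp (4 * ν * t) : ℝ) : ℂ) * (coeff (T t u : LTwo) 2 m - equilibriumCoeff ν a m u) -
      (coeff u 2 m - equilibriumCoeff ν a m u)‖ ≤
      |(m : ℝ)| * (|a| / ν) * ‖tailPart 3 (u : LTwo)‖ := by
  have hE : Continuous fun u : LTwoZero => equilibriumCoeff ν a m u :=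
    continuous_const.mul (coeffL 1 m).continuous
  have h2 : Continuous fun u : LTwoZero => coeff (u : LTwo) 2 m := (coeffL 2 m).continuous
  have hcl : IsClosed {u : LTwoZero | ‖((Real.exp (4 * ν * t) : ℝ) : ℂ) *
      (coeff (T t u : LTwo) 2 m - equilibriumCoeff ν a m u) -
      (coeff u 2 m - equilibriumCoeff ν a m u)‖ ≤
      |(m : ℝ)| * (|a| / ν) * ‖tailPart 3 (u : LTwo)‖} :=
    isClosed_le
      ((continuous_const.mul ((h2.comp (T t).continuous).sub hE)).sub (h2.sub hE)).norm
      (continuous_const.mul continuous_tailPart.norm)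
  refine closure_minimal ?_ hcl (dense_graphL ν a u)
  rintro u ⟨f, h⟩
  have key := norm_exp_mul_sub_le (k := 4 * ν) (δ := 6 * ν)
    (K := |(m : ℝ)| * |a| * ‖tailPart 3 (u : LTwo)‖)
    (z := fun s => coeffL 2 m (T s u) - equilibriumCoeff ν a m u)
    (s := fun s => -(Complex.I * a * m * alpha 3 m * gap 3 * coeff (T s u : LTwo) 3 m))
    (by positivity)
    (((coeffL 2 m).continuous.comp_continuousOn (hT.continuousOn u)).sub continuousOn_const)
    (fun s hs => ((hT.hasDerivWithinAt_apply (coeffL 2 m) h hs).sub_const _).congr_deriv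
      (coeff_two_specGraph hν ((graphL_iff _ _ _ _).1 (hT.graph_apply h hs))
        (coeff_one_semigroup hT u m hs)))
    (fun s hs => norm_source_le hν hT u m hs) ht
  simp only [hT.map_zero] at key
  refine LE.le.trans key ?_
  rw [div_le_iff₀ (by positivity)]
  have h3 : |(m : ℝ)| * (|a| / ν) * ‖tailPart 3 (u : LTwo)‖ * (6 * ν) =
      6 * (|(m : ℝ)| * |a| * ‖tailPart 3 (u : LTwo)‖) := by
    field_simp
  rw [h3]
  have h4 : 0 ≤ |(m : ℝ)| * |a| * ‖tailPart 3 (u : LTwo)‖ := by positivity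
  linarith

theorem coeff_equilibrium (ν a : ℝ) (u : LTwo) (n : ℕ) (m : ℤ) : coeff (equilibrium ν a u) n m =
    if n = 1 then coeff u 1 m else if n = 2 then equilibriumCoeff ν a m u else 0 := by
  rw [equilibrium, Finset.sum_pair (by norm_num), coeff_add, coeff_add, coeff_smul, coeff_smul,
    coeff_smul, coeff_add, coeff_add, coeff_smul, coeff_smul]
  simp only [coeff_sphHarm]
  have hm : m = 0 ∨ m = 1 ∨ m = -1 ∨ 1 < |m| := by
    rw [lt_abs]
    omega
  by_cases h1 : n = 1
  · subst h1
    rw [if_pos (rfl : 1 = 1)]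
    rcases hm with rfl | rfl | rfl | h
    · simp
    · simp
    · simp
    · have h3 : m ≠ 0 := by rintro rfl; simp at h
      have h4 : m ≠ 1 := by rintro rfl; simp at h
      have h5 : m ≠ -1 := by rintro rfl; simp at h
      rw [coeff_eq_zero u (by exact_mod_cast h : ((1 : ℕ) : ℤ) < |m|)]
      simp [h3, h4, h5]
  by_cases h2 : n = 2
  · subst h2
    rw [if_neg h1, if_pos (rfl : 2 = 2)]
    rcases hm with rfl | rfl | rfl | h
    · simp [equilibriumCoeff]
    · simp [equilibriumCoeff]
      ring
    · simp [equilibriumCoeff]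
      ring
    · have h4 : m ≠ 1 := by rintro rfl; simp at h
      have h5 : m ≠ -1 := by rintro rfl; simp at h
      rw [equilibriumCoeff, coeff_eq_zero u (by exact_mod_cast h : ((1 : ℕ) : ℤ) < |m|)]
      simp [h4, h5]
  · simp [h1, h2]

theorem norm_equilibriumCoeff_le (hν : 0 < ν) (m : ℤ) (u : LTwo) :
    ‖equilibriumCoeff ν a m u‖ ≤ |a| / ν * ‖coeff u 1 m‖ := by
  rw [equilibriumCoeff, norm_mul, norm_mul, Complex.norm_real, Real.norm_eq_abs, abs_div,
    abs_of_pos hν]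
  by_cases hm : |m| ≤ 1
  · have h1 : |(m : ℝ)| ≤ 1 := by exact_mod_cast hm
    have h2 : ‖Complex.I * m / (2 * (Real.sqrt 5 : ℝ))‖ ≤ 1 := by
      rw [norm_div, norm_mul, norm_mul, Complex.norm_I, one_mul, Complex.norm_intCast,
        Complex.norm_real, Real.norm_eq_abs, abs_of_nonneg (Real.sqrt_nonneg 5)]
      have h3 : 1 ≤ Real.sqrt 5 := Real.one_le_sqrt.2 (by norm_num)
      rw [div_le_one (by norm_num)]
      norm_num
      linarith
    gcongr
    exact mul_le_of_le_one_right (by positivity) h2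
  · rw [coeff_eq_zero u (by push_cast; omega)]
    simp

theorem coeff_sub_equilibrium_two (u v : LTwo) (m : ℤ) :
    coeff (v - equilibrium ν a u) 2 m = coeff v 2 m - equilibriumCoeff ν a m u := by
  rw [coeff_sub, coeff_equilibrium, if_neg (by norm_num), if_pos rfl]

theorem norm_coeff_two_le (hν : 0 < ν) (hT : IsSemigroupGeneratedBy T (GraphL ν a)) (u : LTwoZero)
    (m : ℤ) {t : ℝ} (ht : 0 ≤ t) :
    ‖coeff ((T t u : LTwo) - equilibrium ν a u) 2 m‖ ≤ Real.exp (-4 * ν * t) *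
      (‖coeff u 2 m‖ + |a| / ν * (‖coeff u 1 m‖ + |(m : ℝ)| * ‖tailPart 3 (u : LTwo)‖)) := by
  have key := coeff_two_semigroup hν hT u m ht
  rw [← coeff_sub_equilibrium_two] at key
  set z := coeff ((T t u : LTwo) - equilibrium ν a u) 2 m
  have h1 : Real.exp (-4 * ν * t) * Real.exp (4 * ν * t) = 1 := by
    rw [← Real.exp_add]
    simp
  have h2 : Real.exp (4 * ν * t) * ‖z‖ = ‖((Real.exp (4 * ν * t) : ℝ) : ℂ) * z‖ := by
    rw [norm_mul, Complex.norm_real, Real.norm_eq_abs, Real.abs_exp]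
  have h3 := norm_equilibriumCoeff_le (a := a) hν m u
  have h4 := norm_le_norm_add_norm_sub' (((Real.exp (4 * ν * t) : ℝ) : ℂ) * z)
    (coeff u 2 m - equilibriumCoeff ν a m u)
  have h5 := norm_sub_le (coeff u 2 m) (equilibriumCoeff ν a m u)
  calc ‖z‖ = Real.exp (-4 * ν * t) * (Real.exp (4 * ν * t) * ‖z‖) := by
        rw [← mul_assoc, h1, one_mul]
    _ ≤ _ := by
      rw [h2]
      gcongr
      linarith

theorem coeff_two_zero (hν : 0 < ν) (hT : IsSemigroupGeneratedBy T (GraphL ν a)) (u : LTwoZero)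
    {t : ℝ} (ht : 0 ≤ t) :
    coeff ((T t u : LTwo) - equilibrium ν a u) 2 0 =
      (Real.exp (-4 * ν * t) : ℝ) * coeff u 2 0 := by
  have key := coeff_two_semigroup hν hT u 0 ht
  have h0 : equilibriumCoeff ν a 0 u = 0 := by simp [equilibriumCoeff]
  rw [← coeff_sub_equilibrium_two, h0, sub_zero, Int.cast_zero, abs_zero, zero_mul, zero_mul,
    norm_le_zero_iff, sub_eq_zero] at key
  rw [← key, ← mul_assoc, ← Complex.ofReal_mul, ← Real.exp_add]
  simp

theorem degPart_one_sub_equilibrium (hT : IsSemigroupGeneratedBy T (GraphL ν a)) (u : LTwoZero)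
    {t : ℝ} (ht : 0 ≤ t) : degPart 1 ((T t u : LTwo) - equilibrium ν a u) = 0 := by
  refine Finset.sum_eq_zero fun m _ => ?_
  rw [coeff_sub, coeff_equilibrium, if_pos rfl, coeff_one_semigroup hT u m ht, sub_self, zero_smul]

theorem tailPart_sub_equilibrium (u v : LTwo) :
    tailPart 3 (v - equilibrium ν a u) = tailPart 3 v := by
  refine ext_coeff fun n m => ?_
  rw [coeff_tailPart, coeff_tailPart]
  split_ifs with h
  · rw [coeff_sub, coeff_equilibrium, if_neg (by omega), if_neg (by omega), sub_zero]
  · rfl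

theorem eq_degPart_two_add_tailPart {u : LTwo} (h0 : ∀ m, coeff u 0 m = 0)
    (h1 : ∀ m, coeff u 1 m = 0) : u = degPart 2 u + tailPart 3 u := by
  refine ext_coeff fun n m => ?_
  rw [coeff_add, coeff_degPart, coeff_tailPart]
  rcases (by omega : n = 0 ∨ n = 1 ∨ n = 2 ∨ 3 ≤ n) with rfl | rfl | rfl | h
  · simp [h0]
  · simp [h1]
  · simp
  · rw [if_neg (by omega), if_pos h, zero_add]

/-- Only degree two and the tail remain. The five coefficients of degree two contribute at most `5(1
+ 3|a|/ν)` and the tail at most `2`, so `20(1 + |a|/ν)` suffices. -/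
theorem norm_sub_equilibrium_le (hν : 0 < ν) (hT : IsSemigroupGeneratedBy T (GraphL ν a))
    (u : LTwoZero) {t : ℝ} (ht : 0 ≤ t) :
    ‖(T t u : LTwo) - equilibrium ν a u‖ ≤
      20 * (1 + |a| / ν) * Real.exp (-4 * ν * t) * ‖u‖ := by
  set w := (T t u : LTwo) - equilibrium ν a u with hw
  have h0 : ∀ m, coeff w 0 m = 0 := fun m => by
    rw [hw, coeff_sub, coeff_equilibrium, coeff_degree_zero]
    simp
  have h1 : ∀ m, coeff w 1 m = 0 := fun m => by
    rw [hw, coeff_sub, coeff_equilibrium, if_pos rfl, coeff_one_semigroup hT u m ht, sub_self]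
  have ha : 0 ≤ |a| / ν := by positivity
  have hu : ‖(u : LTwo)‖ = ‖u‖ := rfl
  have h2 : ‖degPart 2 w‖ ≤ (2 * (2 : ℕ) + 1) *
      (Real.exp (-4 * ν * t) * (‖u‖ + |a| / ν * (‖u‖ + 2 * ‖u‖))) := by
    refine norm_degPart_le fun m hm => ?_
    have h3 : |(m : ℝ)| ≤ 2 := by exact_mod_cast hm
    refine (norm_coeff_two_le hν hT u m ht).trans ?_
    gcongr
    · exact norm_coeff_le _ _ _
    · exact norm_coeff_le _ _ _
    · exact norm_tailPart_le _ _
  have h3 : ‖tailPart 3 w‖ ≤ 2 * Real.exp (-4 * ν * t) * ‖u‖ := by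
    rw [hw, tailPart_sub_equilibrium]
    refine (norm_tailPart_semigroup_le hν hT u ht).trans ?_
    have h6 : Real.sqrt 2 ≤ 2 := by
      rw [Real.sqrt_le_left (by norm_num)]
      norm_num
    gcongr
    · have := mul_nonneg hν.le ht
      linarith
    · exact norm_tailPart_le _ _
  rw [eq_degPart_two_add_tailPart h0 h1]
  refine (norm_add_le_of_le h2 h3).trans ?_
  have h4 : 0 ≤ Real.exp (-4 * ν * t) * ‖u‖ := by positivity
  have h5 : 0 ≤ |a| / ν * (Real.exp (-4 * ν * t) * ‖u‖) := by positivity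
  push_cast
  linarith

theorem norm_coeff_two_le_remainder (hν : 0 < ν) (hT : IsSemigroupGeneratedBy T (GraphL ν a))
    (u : LTwoZero) {m : ℤ} (hm : |m| = 1 ∨ |m| = 2) {t : ℝ} (ht : 0 ≤ t) :
    ‖coeff ((T t u : LTwo) - equilibrium ν a u) 2 m‖ ≤ 20 * Real.exp (-4 * ν * t) *
      (‖coeff u 2 m‖ + |a| / ν * remainder m u) := by
  refine (norm_coeff_two_le hν hT u m ht).trans ?_
  have h1 : ‖coeff (u : LTwo) 1 m‖ + |(m : ℝ)| * ‖tailPart 3 (u : LTwo)‖ ≤ 20 * remainder m u := by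
    have h2 := norm_nonneg (tailPart 3 (u : LTwo))
    rcases hm with hm | hm
    · have h3 : |(m : ℝ)| = 1 := by exact_mod_cast hm
      rw [remainder, if_pos hm, h3]
      linarith [norm_nonneg (coeff (u : LTwo) 1 m)]
    · have h3 : |(m : ℝ)| = 2 := by exact_mod_cast hm
      -- For `|m| = 2` there is no harmonic of degree one, so only the tail forces this coefficient.
      rw [remainder, if_neg (by omega), h3, coeff_eq_zero (u : LTwo) (by omega), norm_zero]
      linarith
  have h4 := norm_nonneg (coeff (u : LTwo) 2 m)
  calc _ ≤ Real.exp (-4 * ν * t) * (20 * ‖coeff (u : LTwo) 2 m‖ + |a| / ν * (20 * remainder m u)) := by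
        gcongr
        linarith
    _ = _ := by ring

end Estimates

end SphereFlow

end

theorem theorem1p1 :
    ∃ C : ℝ, 0 < C ∧ ∀ ν a : ℝ, 0 < ν →
      (∃ T : ℝ → LTwoZero →L[ℂ] LTwoZero, IsSemigroupGeneratedBy T (GraphL ν a)) ∧
      ∀ T : ℝ → LTwoZero →L[ℂ] LTwoZero, IsSemigroupGeneratedBy T (GraphL ν a) →
        ∀ (ω₀ : LTwoZero) (t : ℝ), 0 ≤ t →
          let ω : LTwo := (T t ω₀ : LTwo) - equilibrium ν a ω₀
          ‖ω‖ ≤ C * (1 + |a| / ν) * Real.exp (-4 * ν * t) * ‖ω₀‖ ∧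
          degPart 1 ω = 0 ∧
          ‖tailPart 3 ω‖ ≤ Real.sqrt 2 * Real.exp (-10 * ν * t) * ‖tailPart 3 (ω₀ : LTwo)‖ ∧
          coeff ω 2 0 = (Real.exp (-4 * ν * t) : ℝ) * coeff ω₀ 2 0 ∧
          ∀ m : ℤ, |m| = 1 ∨ |m| = 2 →
            ‖coeff ω 2 m‖ ≤ C * Real.exp (-4 * ν * t) *
              (‖coeff ω₀ 2 m‖ + |a| / ν * remainder m ω₀) := by
  refine ⟨20, by norm_num, fun ν a hν => ⟨exists_semigroup_graphL hν a, fun T hT ω₀ t ht => ?_⟩⟩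
  refine ⟨norm_sub_equilibrium_le hν hT ω₀ ht, degPart_one_sub_equilibrium hT ω₀ ht, ?_,
    coeff_two_zero hν hT ω₀ ht, fun m hm => norm_coeff_two_le_remainder hν hT ω₀ hm ht⟩
  rw [tailPart_sub_equilibrium]
  exact norm_tailPart_semigroup_le hν hT ω₀ ht
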